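/- Let $k=\mathbb F_q$ be a finite field with $q$ elements, $t=\sqrt q$, let $B$ be a finite-dimensional associative unital $k$-algebra of global dimension at most $2$, and let $\mathcal A=\mathrm{mod}\,B$ be the category of finitely generated right $B$-modules, with Euler form $\langle A,C\rangle=\sum_{i\ge 0}(-1)^i\dim_k\mathrm{Ext}^i_{\mathcal A}(A,C)$. The twisted Ringel–Hall algebra $\mathcal H_{tw}(\mathcal A)$ is the $\mathbb C$-vector space with basis the isomorphism classes $[A]$ of objects of $\mathcal A$, with unit $[0]$ and multiplication $$[A]*[C]=t^{\langle A,C\rangle}\sum_{[L]}\frac{|\mathrm{Ext}^1_{\mathcal A}(A,C)_L|}{|\mathrm{Hom}_{\mathcal A}(A,C)|}\,[L],$$ where $\mathrm{Ext}^1(A,C)_L\subseteq \mathrm{Ext}^1(A,C)$ is the set of classes of extensions $0\to C\to X\to A\to 0$ with $X\cong L$. Let $\mathcal C_2(\mathcal A)$ be the abelian category of $\mathbb Z/2$-graded complexes $M=(d_1:M_1\rightleftarrows M_0:d_0)$, $d_0d_1=0$, $d_1d_0=0$, in $\mathcal A$, let $\mathcal C_2(\mathcal P)$ be its full subcategory of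 complexes with projective components, and let $M^*=(-d_0:M_0\rightleftarrows M_1:-d_1)$ be the shift of $M$. Let $\mathcal H_{tw}(\mathcal C_2(\mathcal P))$ be the algebra with basis the isomorphism classes $[M]$ of objects of $\mathcal C_2(\mathcal P)$, with unit $[0]$ and multiplication $$[M]*[N]=t^{\langle M_0,N_0\rangle+\langle M_1,N_1\rangle}\sum_{[L]}\frac{|\mathrm{Ext}^1_{\mathcal C_2(\mathcal A)}(M,N)_L|}{|\mathrm{Hom}_{\mathcal C_2(\mathcal A)}(M,N)|}\,[L].$$ Let $\mathcal{DH}(\mathcal A)$ be its localization obtained by inverting all $[M]$ with $M$ acyclic, let $$\mathcal{DH}_{red}(\mathcal A)=\mathcal{DH}(\mathcal A)/\big([M]-1 : M \text{ acyclic},\ M\cong M^*\big)$$ be Bridgeland's reduced Hall algebra, and let $\pi:\mathcal{DH}(\mathcal A)\to\mathcal{DH}_{red}(\mathcal A)$ be the quotient map. For a projective module $P$ put $K_P=(1:P\rightleftarrows P:0)$ and $K_P^*=(0:P\rightleftarrows P:1)$. For a projective resolution $0\to P_2\xrightarrow{a_2}P_1\xrightarrow{a_1}P_0\xrightarrow{a_0}A\to0$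 of $A\in\mathcal A$, let $C_A$ be the complex with $(C_A)_1=P_1$, $(C_A)_0=P_0\oplus P_2$, $d_1=\binom{a_1}{0}$, $d_0=(0\ \ a_2)$, and put $$E_A=t^{\langle P_1,A\rangle-2\langle P_2,A\rangle}\,[K_{P_1}]^{-1}*[K_{P_2}]*[K^*_{P_2}]^{-1}*[C_A]\in\mathcal{DH}(\mathcal A).$$ Then every $A\in\mathcal A$ has such a resolution, and there is a homomorphism of unital algebras $I_+:\mathcal H_{tw}(\mathcal A)\to\mathcal{DH}(\mathcal A)$ with $I_+([A])=E_A$ for every $A\in\mathcal A$ and every projective resolution of $A$ of the above form (in particular, for a minimal one), such that the composite $$\widetilde{I_+}=\pi\circ I_+:\mathcal H_{tw}(\mathcal A)\longrightarrow\mathcal{DH}_{red}(\mathcal A)$$ is injective; so $\widetilde{I_+}$ is an embedding of algebras. -/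

import Mathlib

open CategoryTheory CategoryTheory.Limits
open scoped ZeroObject

universe w v u

noncomputable section

namespace BridgelandHall

/-! ### Algebras given by structure constants, and universal localisation -/

/-- The complex vector space with basis `I`, to be equipped with the bilinear multiplication
`[a] * [c] = ∑ b, γ a c b • [b]` and the distinguished element `1 = [e]`.
(The sum is used only for `γ` such that `γ a c b ≠ 0` for finitely many `b` only.) -/
def ConstAlg {I : Type u} (_γ : I → I → I → ℂ) (_e : I) : Type u := I →₀ ℂ

namespace ConstAlg

variable {I : Type u} {γ : I → I → I → ℂ} {e : I}

instance : AddCommGroup (ConstAlg γ e) := inferInstanceAs (AddCommGroup (I →₀ ℂ))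

instance : Module ℂ (ConstAlg γ e) := inferInstanceAs (Module ℂ (I →₀ ℂ))

/-- The basis element `[a]`. -/
def basisElt (γ : I → I → I → ℂ) (e : I) (a : I) : ConstAlg γ e :=
  (Finsupp.single a 1 : I →₀ ℂ)

/-- The bilinear multiplication `[a] * [c] = ∑ b, γ a c b • [b]`. -/
def mulMap (γ : I → I → I → ℂ) : (I →₀ ℂ) →ₗ[ℂ] (I →₀ ℂ) →ₗ[ℂ] (I →₀ ℂ) :=
  Finsupp.linearCombination ℂ fun a =>
    Finsupp.linearCombination ℂ fun c => ∑ᶠ b : I, Finsupp.single b (γ a c b)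

instance : NonUnitalNonAssocRing (ConstAlg γ e) where
  mul x y := mulMap γ x y
  left_distrib x y z := (mulMap γ x).map_add y z
  right_distrib x y z := (mulMap γ).map_add₂ x y z
  zero_mul x := (mulMap γ).map_zero₂ x
  mul_zero x := (mulMap γ x).map_zero

instance : One (ConstAlg γ e) := ⟨basisElt γ e e⟩

end ConstAlg

section Localisation

variable (H : Type u) [NonUnitalNonAssocRing H] [One H] [Module ℂ H] (S : Set H)

/-- The relations of the universal localisation: the generators `x` (for `x : H`) add, scale and
multiply as in `H`, and the generator `s⁻¹` (for `s ∈ S`) is a two-sided inverse of `s`. -/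
inductive LocRel : FreeAlgebra ℂ (H ⊕ S) → FreeAlgebra ℂ (H ⊕ S) → Prop
  | add (x y : H) : LocRel (FreeAlgebra.ι ℂ (Sum.inl (x + y)))
      (FreeAlgebra.ι ℂ (Sum.inl x) + FreeAlgebra.ι ℂ (Sum.inl y))
  | smul (c : ℂ) (x : H) : LocRel (FreeAlgebra.ι ℂ (Sum.inl (c • x)))
      (c • FreeAlgebra.ι ℂ (Sum.inl x))
  | one : LocRel (FreeAlgebra.ι ℂ (Sum.inl 1)) 1
  | mul (x y : H) : LocRel (FreeAlgebra.ι ℂ (Sum.inl (x * y)))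
      (FreeAlgebra.ι ℂ (Sum.inl x) * FreeAlgebra.ι ℂ (Sum.inl y))
  | mul_inv (s : S) : LocRel
      (FreeAlgebra.ι ℂ (Sum.inl (s : H)) * FreeAlgebra.ι ℂ (Sum.inr s)) 1
  | inv_mul (s : S) : LocRel
      (FreeAlgebra.ι ℂ (Sum.inr s) * FreeAlgebra.ι ℂ (Sum.inl (s : H))) 1

/-- The universal localisation `H[s⁻¹ | s ∈ S]`: the universal associative unital `ℂ`-algebra
with an algebra map from `H` sending every element of `S` to a unit. -/
abbrev Loc : Type u := RingQuot (LocRel H S)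

/-- The canonical map `H → H[s⁻¹ | s ∈ S]`. -/
def Loc.of (x : H) : Loc H S :=
  RingQuot.mkAlgHom ℂ (LocRel H S) (FreeAlgebra.ι ℂ (Sum.inl x))

end Localisation

/-! ### Twisted Hall algebras -/

/-- The set of isomorphism classes of objects of a category. -/
abbrev IsoCl (𝒞 : Type u) [Category.{v} 𝒞] : Type u := Quotient (isIsomorphicSetoid 𝒞)

/-- The isomorphism class of an object. -/
abbrev isoClass {𝒞 : Type u} [Category.{v} 𝒞] (X : 𝒞) : IsoCl 𝒞 :=
  Quotient.mk (isIsomorphicSetoid 𝒞) X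

/-- `|Ext¹(A, C)_B|`: the number of classes in `Ext¹(A, C)` of short exact sequences
`0 → C → B → A → 0`. -/
def extCount {𝒞 : Type u} [Category.{v} 𝒞] [Abelian 𝒞] (A C B : 𝒞) : ℕ :=
  letI := HasExt.standard 𝒞
  Nat.card {e : Abelian.Ext.{max u v} A C 1 //
    ∃ (i : C ⟶ B) (p : B ⟶ A) (w : i ≫ p = 0) (h : (ShortComplex.mk i p w).ShortExact),
      h.extClass = e}

/-- The structure constant `|Ext¹(A, C)_B| / |Hom(A, C)|`. -/
def hallNumber {𝒞 : Type u} [Category.{v} 𝒞] [Abelian 𝒞] (A C B : 𝒞) : ℂ :=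
  (extCount A C B : ℂ) / (Nat.card (A ⟶ C) : ℂ)

/-- The Euler form `∑ (-1)^i dim_k Ext^i(A, B)`. -/
def eulerForm (k : Type w) [Field k] {𝒜 : Type u} [Category.{v} 𝒜] [Abelian 𝒜] [Linear k 𝒜]
    (A B : 𝒜) : ℤ :=
  letI := HasExt.standard 𝒜
  ∑ᶠ i : ℕ, (-1 : ℤ) ^ i * (Module.finrank k (Abelian.Ext.{max u v} A B i) : ℤ)

/-- `t = √q`, where `q` is the number of elements of `k`. -/
def tt (k : Type w) : ℂ := ((Real.sqrt (Nat.card k : ℝ) : ℝ) : ℂ)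

section Hall

variable (k : Type w) [Field k] (𝒜 : Type u) [Category.{v} 𝒜] [Abelian 𝒜] [Linear k 𝒜]

/-- The twisted Hall algebra `H_tw(𝒜)`: it has the basis `[A]`, `A ∈ Iso(𝒜)`, the multiplication
`[A] * [C] = t^⟨A, C⟩ ∑_B (|Ext¹(A, C)_B| / |Hom(A, C)|) [B]`, and the unit `[0]`. -/
abbrev TwHall : Type u :=
  ConstAlg (I := IsoCl 𝒜)
    (fun a c b => tt k ^ eulerForm k a.out c.out * hallNumber a.out c.out b.out)
    (isoClass 0)

variable {𝒜} in
/-- The basis element `[A]` of `H_tw(𝒜)`. -/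
def TwHall.cls (A : 𝒜) : TwHall k 𝒜 := ConstAlg.basisElt _ _ (isoClass A)

/-! ### `ℤ/2`-graded complexes -/

/-- The abelian category `C₂(𝒜)` of `ℤ/2`-graded complexes in `𝒜`. -/
abbrev C2 : Type _ := HomologicalComplex 𝒜 (ComplexShape.up (ZMod 2))

variable {𝒜} in
/-- The shift involution `M ↦ M^*`: it exchanges the two degrees and changes the sign of the
differentials. -/
def C2.star (M : C2 𝒜) : C2 𝒜 where
  X i := M.X (i + 1)
  d i j := -M.d (i + 1) (j + 1)
  shape i j h := by
    rw [M.shape, neg_zero]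
    intro h'
    exact h (add_right_cancel (b := (1 : ZMod 2)) h')
  d_comp_d' i j l _ _ := by simp

variable {𝒜} in
/-- The objects underlying the complex `M₁ ⇄ M₀`. -/
def C2.ofX (M₁ M₀ : 𝒜) : Fin 2 → 𝒜
  | 0 => M₀
  | 1 => M₁

variable {𝒜} in
/-- The differentials of the complex `M₁ ⇄ M₀`. -/
def C2.ofD {M₁ M₀ : 𝒜} (d₁ : M₁ ⟶ M₀) (d₀ : M₀ ⟶ M₁) :
    ∀ i j : Fin 2, C2.ofX M₁ M₀ i ⟶ C2.ofX M₁ M₀ j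
  | 0, 0 => 0
  | 0, 1 => d₀
  | 1, 0 => d₁
  | 1, 1 => 0

variable {𝒜} in
/-- The `ℤ/2`-graded complex with components `M₁`, `M₀` and differentials `d₁ : M₁ ⟶ M₀`,
`d₀ : M₀ ⟶ M₁`. -/
def C2.of {M₁ M₀ : 𝒜} (d₁ : M₁ ⟶ M₀) (d₀ : M₀ ⟶ M₁) (h : d₁ ≫ d₀ = 0) (h' : d₀ ≫ d₁ = 0) :
    C2 𝒜 where
  X := C2.ofX M₁ M₀
  d := C2.ofD d₁ d₀
  shape i j hij := by
    change Fin 2 at i j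
    fin_cases i <;> fin_cases j
    · rfl
    · exact absurd (by decide : (0 : ZMod 2) + 1 = 1) hij
    · exact absurd (by decide : (1 : ZMod 2) + 1 = 0) hij
    · rfl
  d_comp_d' i j l _ _ := by
    change Fin 2 at i j l
    fin_cases i <;> fin_cases j <;> fin_cases l <;>
      first
        | exact h
        | exact h'
        | exact zero_comp
        | exact comp_zero

/-- The complexes all of whose components are projective. -/
def projComplex : ObjectProperty (C2 𝒜) := fun M => ∀ i, Projective (M.X i)

/-- The category `C₂(𝒫)` of `ℤ/2`-graded complexes of projective objects, a full subcategory of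
`C₂(𝒜)`. -/
abbrev C2P : Type _ := (projComplex 𝒜).FullSubcategory

variable {𝒜} in
/-- The complex of projectives `M₁ ⇄ M₀`. -/
def C2P.of {M₁ M₀ : 𝒜} [Projective M₁] [Projective M₀] (d₁ : M₁ ⟶ M₀) (d₀ : M₀ ⟶ M₁)
    (h : d₁ ≫ d₀ = 0) (h' : d₀ ≫ d₁ = 0) : C2P 𝒜 :=
  ⟨C2.of d₁ d₀ h h', fun i => by
    change Fin 2 at i
    fin_cases i
    · exact (inferInstance : Projective M₀)
    · exact (inferInstance : Projective M₁)⟩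

variable {𝒜} in
/-- The zero complex, as a complex of projectives. -/
def C2P.zero : C2P 𝒜 := C2P.of (0 : (0 : 𝒜) ⟶ 0) 0 zero_comp zero_comp

/-- The twisted Hall algebra `H_tw(C₂(𝒫))`: it has the basis `[M]`, `M ∈ Iso(C₂(𝒫))`, the
multiplication
`[M] * [N] = t^(⟨M₀, N₀⟩ + ⟨M₁, N₁⟩) ∑_L (|Ext¹(M, N)_L| / |Hom(M, N)|) [L]`,
where `Ext¹` and `Hom` are taken in `C₂(𝒜)`, and the unit `[0]`.
(If `Ext¹(M, N)_L` is not empty, then the components of `L` are projective.) -/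
abbrev TwHallC2P : Type _ :=
  ConstAlg (I := IsoCl (C2P 𝒜))
    (fun m n l =>
      tt k ^ (eulerForm k (m.out.obj.X 0) (n.out.obj.X 0)
          + eulerForm k (m.out.obj.X 1) (n.out.obj.X 1))
        * hallNumber m.out.obj n.out.obj l.out.obj)
    (isoClass C2P.zero)

variable {𝒜} in
/-- The basis element `[M]` of `H_tw(C₂(𝒫))`. -/
def TwHallC2P.cls (M : C2P 𝒜) : TwHallC2P k 𝒜 := ConstAlg.basisElt _ _ (isoClass M)

/-! ### The localised and the reduced localised Hall algebra -/

/-- Bridgeland's Hall algebra `DH(𝒜) = H_tw(C₂(𝒫))[[M]⁻¹ | M acyclic]`. -/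
abbrev DH : Type _ :=
  Loc (TwHallC2P k 𝒜) {x | ∃ M : C2P 𝒜, M.obj.Acyclic ∧ x = TwHallC2P.cls k M}

variable {𝒜} in
/-- The image in `DH(𝒜)` of `[M]`. -/
def DH.cls (M : C2P 𝒜) : DH k 𝒜 := Loc.of _ _ (TwHallC2P.cls k M)

/-- The relations `[M] = 1` for `M` acyclic with `M ≅ M^*`. -/
inductive RedRel : DH k 𝒜 → DH k 𝒜 → Prop
  | mk (M : C2P 𝒜) (hM : M.obj.Acyclic) (hs : Nonempty (M.obj ≅ M.obj.star)) :
      RedRel (DH.cls k M) 1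

/-- The reduced localised Hall algebra
`DH_red(𝒜) = DH(𝒜) / ([M] - 1 | M acyclic, M ≅ M^*)`. -/
abbrev DHred : Type _ := RingQuot (RedRel k 𝒜)

/-- The quotient map `π : DH(𝒜) → DH_red(𝒜)`. -/
def redMap : DH k 𝒜 →ₐ[ℂ] DHred k 𝒜 := RingQuot.mkAlgHom ℂ (RedRel k 𝒜)

variable {𝒜}

/-- The acyclic complex `K_P`, that is `P ⇄ P` with `d₁ = 1`, `d₀ = 0`. -/
def complexK (P : 𝒜) [Projective P] : C2P 𝒜 := C2P.of (𝟙 P) 0 comp_zero zero_comp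

/-- The acyclic complex `K_P^*`, that is `P ⇄ P` with `d₁ = 0`, `d₀ = 1`. -/
def complexKstar (P : 𝒜) [Projective P] : C2P 𝒜 := C2P.of 0 (𝟙 P) zero_comp comp_zero

/-- A projective resolution `0 → P₂ → P₁ → P₀ → A → 0`. -/
structure ProjRes (A : 𝒜) where
  /-- The term in degree 2. -/
  P₂ : 𝒜
  /-- The term in degree 1. -/
  P₁ : 𝒜
  /-- The term in degree 0. -/
  P₀ : 𝒜
  proj₂ : Projective P₂
  proj₁ : Projective P₁
  proj₀ : Projective P₀
  /-- The map `P₂ ⟶ P₁`. -/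
  a₂ : P₂ ⟶ P₁
  /-- The map `P₁ ⟶ P₀`. -/
  a₁ : P₁ ⟶ P₀
  /-- The augmentation. -/
  a₀ : P₀ ⟶ A
  comp₂₁ : a₂ ≫ a₁ = 0
  comp₁₀ : a₁ ≫ a₀ = 0
  mono₂ : Mono a₂
  exact₁ : (ShortComplex.mk a₂ a₁ comp₂₁).Exact
  exact₀ : (ShortComplex.mk a₁ a₀ comp₁₀).Exact
  epi₀ : Epi a₀

attribute [instance] ProjRes.proj₂ ProjRes.proj₁ ProjRes.proj₀

/-- The complex `P₁ ⇄ P₀ ⊕ P₂` with differentials `(a₁, 0)` and `(0, a₂)`. -/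
def ProjRes.complexC {A : 𝒜} (R : ProjRes A) : C2P 𝒜 :=
  C2P.of (M₁ := R.P₁) (M₀ := R.P₀ ⊞ R.P₂) (biprod.lift R.a₁ 0) (biprod.desc 0 R.a₂)
    (by simp) (by ext <;> simp [R.comp₂₁])

/-- The element
`E_A = t^⟨P₁ - 2 P₂, A⟩ • [K_{P₁}]⁻¹ * [K_{P₂}] * [K_{P₂}^*]⁻¹ * [C_A]` of `DH(𝒜)`, computed from
a projective resolution of `A`. (The elements inverted here are units of `DH(𝒜)`.) -/
def ProjRes.E {A : 𝒜} (R : ProjRes A) : DH k 𝒜 :=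
  tt k ^ (eulerForm k R.P₁ A - 2 * eulerForm k R.P₂ A) •
    (Ring.inverse (DH.cls k (complexK R.P₁)) * DH.cls k (complexK R.P₂)
      * Ring.inverse (DH.cls k (complexKstar R.P₂)) * DH.cls k R.complexC)

end Hall

/-! ### Right modules over a finite-dimensional algebra -/

theorem isNoetherianRing_op (k : Type w) [Field k] (B : Type u) [Ring B] [Algebra k B]
    [Module.Finite k B] : IsNoetherianRing Bᵐᵒᵖ :=
  haveI : Module.Finite k Bᵐᵒᵖ := Module.Finite.equiv (MulOpposite.opLinearEquiv k)
  isNoetherian_of_tower k inferInstance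

end BridgelandHall

end

open BridgelandHall

noncomputable section

namespace BridgelandHall

/-! ### Counting extension classes through a parametrising family. -/

section ExtClass

variable {𝒞 : Type u} [Category.{v} 𝒞] [Abelian 𝒞]

open Abelian

/-! Product. An extension of complexes whose quotient term has projective components splits in each
degree, so it is a twisted sum `C2.tw g`, where the cocycle `g` is the off-diagonal part of the
differential. Equivalences of twisted sums are unipotent matrices with an arbitrary off-diagonal
entry. Hence [M] * [N] = t^(-d) ∑_g [tw g] with d = ⟨M₀, N₀⟩ + ⟨M₁, N₁⟩ (`TwHallC2P.cls_mul_cls`).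
Associativity becomes a bijection of upper triangular data. Cocycles to or from K_P and K_P^* are
boundaries, these complexes being contractible, so [K_P] and [K_P^*] commute with every [M] up to a
power of t.

Independence of the resolution. By Schanuel's argument two resolutions of A become isomorphic after
adding discs S = S in degrees 1, 0 and then in degrees 2, 1. The torus factor and the power of t in
E_A are exactly what absorbs a disc (`ProjRes.E_eq_E`).

Multiplicativity. Let K be the first syzygy of A. Extensions of A by C are pushouts along maps f : K
⟶ C, so [A] * [C] is a multiple of ∑_f [ext f]. On the side of complexes, a cocycle from C_A to C_C
has a part of ℤ-degree 1 and a part of ℤ-degree -1 with respect to the resolutions. The second part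
is null-homotopic, since there are no negative Ext groups. The first part defines a surjective
homomorphism `extHom` onto Hom(K, C), and the horseshoe construction identifies tw g with the
complex of a resolution of ext f. The fibres have the size of the kernel, which `card_ker_extHom`
computes, and the powers of t then agree (`ProjRes.E_mul_E`).

Injectivity. No basis of DH_red is needed, only one representation. Divide H_tw(C₂(𝒫)) by the left
ideal spanned by all x * [K_P] - x and x * [K_P^*] - x. On the quotient, [K_P] and [K_P^*] act on
each [M] by mutually inverse powers of t. Bounded projective dimension makes every acyclic M a sum
of some K_P and K_Q^*, so [M] acts invertibly, and M ≅ M^* forces P ≅ Q, so then [M] acts trivially.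
Thus DH_red acts. For a suitable weight the map [M] ↦ t^weight(M) [H₀(M)] is well defined on the
quotient, and it sends E_A · [0] to a nonzero multiple of [A]. A map that is diagonal with nonzero
entries is injective, hence so is the embedding. -/

lemma shortExact_lift {A C X T : 𝒞} {i : C ⟶ X} {p : X ⟶ A} {h : i ≫ p = 0}
    (hS : (ShortComplex.mk i p h).ShortExact) (x : T ⟶ X) (hx : x ≫ p = 0) :
    ∃ y : T ⟶ C, y ≫ i = x := by
  have : Mono (ShortComplex.mk i p h).f := hS.mono_f
  exact hS.exact.lift' x hx

lemma shortExact_desc {A C X T : 𝒞} {i : C ⟶ X} {p : X ⟶ A} {h : i ≫ p = 0}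
    (hS : (ShortComplex.mk i p h).ShortExact) (x : X ⟶ T) (hx : i ≫ x = 0) :
    ∃ y : A ⟶ T, p ≫ y = x := by
  have : Epi (ShortComplex.mk i p h).g := hS.epi_g
  exact hS.exact.desc' x hx

lemma extClass_eq_of_hom [HasExt.{w} 𝒞] {A C X X' : 𝒞} {i : C ⟶ X} {p : X ⟶ A} {h : i ≫ p = 0}
    {i' : C ⟶ X'} {p' : X' ⟶ A} {h' : i' ≫ p' = 0}
    (hS : (ShortComplex.mk i p h).ShortExact) (hS' : (ShortComplex.mk i' p' h').ShortExact)
    (φ : X ⟶ X') (hi : i ≫ φ = i') (hp : φ ≫ p' = p) : hS.extClass = hS'.extClass := by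
  have := ShortComplex.ShortExact.extClass_naturality hS hS'
    { τ₁ := 𝟙 C, τ₂ := φ, τ₃ := 𝟙 A, comm₁₂ := by simp [hi], comm₂₃ := by simp [hp] }
  simpa using this

/-- The class of the second extension dies when pulled back along `p`, so `p` lifts to some `φ` over
`A`. On `C` this `φ` induces an endomorphism `a` which fixes the extension class, so `a - 1` extends
along `i` to some `v`. Subtracting `v ≫ i'` from `φ` repairs the restriction to `C`. -/
lemma exists_hom_of_extClass_eq [HasExt.{w} 𝒞] {A C X X' : 𝒞} {i : C ⟶ X} {p : X ⟶ A}
    {h : i ≫ p = 0} {i' : C ⟶ X'} {p' : X' ⟶ A} {h' : i' ≫ p' = 0}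
    (hS : (ShortComplex.mk i p h).ShortExact) (hS' : (ShortComplex.mk i' p' h').ShortExact)
    (e : hS.extClass = hS'.extClass) : ∃ φ : X ⟶ X', i ≫ φ = i' ∧ φ ≫ p' = p := by
  obtain ⟨y, hy⟩ := Ext.covariant_sequence_exact₃ _ hS' (Ext.mk₀ p) (zero_add 1)
    (by rw [← e]; exact hS.comp_extClass)
  obtain ⟨φ, rfl⟩ := (Ext.mk₀_bijective X X').2 y
  have hφ : φ ≫ p' = p := by
    rw [Ext.mk₀_comp_mk₀] at hy
    exact (Ext.mk₀_bijective _ _).1 hy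
  obtain ⟨a, ha⟩ := shortExact_lift hS' (i ≫ φ) (by rw [Category.assoc, hφ, h])
  have ha' : hS.extClass.comp (Ext.mk₀ a) (add_zero 1) = hS.extClass := by
    have := ShortComplex.ShortExact.extClass_naturality hS hS'
      { τ₁ := a, τ₂ := φ, τ₃ := 𝟙 A, comm₁₂ := by simp [ha], comm₂₃ := by simp [hφ] }
    rw [this, e]
    simp
  obtain ⟨z, hz⟩ := Ext.contravariant_sequence_exact₁ hS C (Ext.mk₀ (a + -𝟙 C)) (add_zero 1)
    (by rw [Ext.mk₀_add, Ext.comp_add, ha', Ext.mk₀_neg, Ext.comp_neg, Ext.comp_mk₀_id]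
        exact add_neg_cancel _)
  obtain ⟨v, rfl⟩ := (Ext.mk₀_bijective X C).2 z
  have hv : i ≫ v = a + -𝟙 C := by
    rw [Ext.mk₀_comp_mk₀] at hz
    exact (Ext.mk₀_bijective _ _).1 hz
  refine ⟨φ - v ≫ i', ?_, ?_⟩
  · rw [Preadditive.comp_sub, ← Category.assoc, hv]
    simp [ha]
  · rw [Preadditive.sub_comp, Category.assoc, h', comp_zero, sub_zero, hφ]

lemma isIso_of_extension_hom {A C X X' : 𝒞} {i : C ⟶ X} {p : X ⟶ A}
    {h : i ≫ p = 0} {i' : C ⟶ X'} {p' : X' ⟶ A} {h' : i' ≫ p' = 0}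
    (hS : (ShortComplex.mk i p h).ShortExact) (hS' : (ShortComplex.mk i' p' h').ShortExact)
    (φ : X ⟶ X') (hi : i ≫ φ = i') (hp : φ ≫ p' = p) : IsIso φ := by
  let f : ShortComplex.mk i p h ⟶ ShortComplex.mk i' p' h' :=
    { τ₁ := 𝟙 C, τ₂ := φ, τ₃ := 𝟙 A, comm₁₂ := by simp [hi], comm₂₃ := by simp [hp] }
  have : IsIso f.τ₁ := inferInstanceAs (IsIso (𝟙 C))
  have : IsIso f.τ₃ := inferInstanceAs (IsIso (𝟙 A))
  exact ShortComplex.isIso₂_of_shortExact_of_isIso₁₃ f hS hS'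

lemma shortExact_of_isos {A C X A' C' X' : 𝒞} {i : C ⟶ X} {p : X ⟶ A}
    {h : i ≫ p = 0} {i' : C' ⟶ X'} {p' : X' ⟶ A'} (h' : i' ≫ p' = 0)
    (hS : (ShortComplex.mk i p h).ShortExact) (c : C ≅ C') (e : X ≅ X') (a : A ≅ A')
    (hi : c.hom ≫ i' = i ≫ e.hom) (hp : e.hom ≫ p' = p ≫ a.hom) :
    (ShortComplex.mk i' p' h').ShortExact :=
  ShortComplex.shortExact_of_iso (S₁ := ShortComplex.mk i p h)
    (ShortComplex.isoMk c e a hi hp) hS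

/-- A family of extensions of `A` by `C` which contains every extension up to equivalence, and in
which each extension admits `N` equivalences to members of the family. -/
structure ExtFamily (A C : 𝒞) (Z : Type w) (N : ℕ) where
  X : Z → 𝒞
  i : ∀ z, C ⟶ X z
  p : ∀ z, X z ⟶ A
  w : ∀ z, i z ≫ p z = 0
  exact : ∀ z, (ShortComplex.mk _ _ (w z)).ShortExact
  surj : ∀ {B : 𝒞} (i' : C ⟶ B) (p' : B ⟶ A) (h : i' ≫ p' = 0),
    (ShortComplex.mk _ _ h).ShortExact → ∃ z, ∃ φ : B ⟶ X z, i' ≫ φ = i z ∧ φ ≫ p z = p'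
  card : ∀ z, Nat.card (Σ z', {φ : X z ⟶ X z' // i z ≫ φ = i z' ∧ φ ≫ p z' = p z}) = N

namespace ExtFamily

variable {A C : 𝒞} {Z : Type w} {N : ℕ} (F : ExtFamily A C Z N)

/-- Two equivalences between the same extensions differ by a map which factors as X ⟶ A ⟶ C ⟶ X', so
the equivalences form a torsor under Hom(A, C) once one exists. -/
lemma card_hom {z z' : Z} (φ₀ : F.X z ⟶ F.X z') (h₀ : F.i z ≫ φ₀ = F.i z' ∧ φ₀ ≫ F.p z' = F.p z) :
    Nat.card {φ : F.X z ⟶ F.X z' // F.i z ≫ φ = F.i z' ∧ φ ≫ F.p z' = F.p z} =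
      Nat.card (A ⟶ C) := by
  have hm : Mono (F.i z') := (F.exact z').mono_f
  have he : Epi (F.p z) := (F.exact z).epi_g
  symm
  refine Nat.card_eq_of_bijective (fun u => ⟨φ₀ + F.p z ≫ u ≫ F.i z', ?_, ?_⟩) ⟨?_, ?_⟩
  · rw [Preadditive.comp_add, h₀.1, ← Category.assoc, F.w, zero_comp, add_zero]
  · rw [Preadditive.add_comp, h₀.2, Category.assoc, Category.assoc, F.w, comp_zero, comp_zero,
      add_zero]
  · intro u u' h
    have h1 := add_left_cancel (congrArg Subtype.val h)
    rwa [cancel_epi, cancel_mono] at h1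
  · rintro ⟨φ, h1, h2⟩
    obtain ⟨x, hx⟩ := shortExact_desc (F.exact z) (φ - φ₀) (by
      rw [Preadditive.comp_sub, h1, h₀.1, sub_self])
    obtain ⟨u, hu⟩ := shortExact_lift (F.exact z') x (by
      rw [← cancel_epi (F.p z), ← Category.assoc, hx, Preadditive.sub_comp, h2, h₀.2, sub_self,
        comp_zero])
    exact ⟨u, Subtype.ext (by simp only; rw [hu, hx]; abel)⟩

/-- Double counting: the members of the family with middle term `B` map onto the classes with middle
term `B`, and every fibre, multiplied by |Hom(A, C)|, counts the `N` equivalences out of one member.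
Thus the family may repeat each class, as long as it does so uniformly. -/
theorem extCount_mul [Finite Z] [Finite (A ⟶ C)] (B : 𝒞) :
    extCount A C B * N = Nat.card {z // Nonempty (F.X z ≅ B)} * Nat.card (A ⟶ C) := by
  classical
  have := Fintype.ofFinite Z
  let := HasExt.standard 𝒞
  let E := {e : Abelian.Ext.{max u v} A C 1 //
    ∃ (i : C ⟶ B) (p : B ⟶ A) (w : i ≫ p = 0) (h : (ShortComplex.mk i p w).ShortExact),
      h.extClass = e}
  let D := {z // Nonempty (F.X z ≅ B)}
  let ψ : D → E := fun z => ⟨(F.exact z.1).extClass, by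
    obtain ⟨z, ⟨e⟩⟩ := z
    have hS : (ShortComplex.mk (F.i z ≫ e.hom) (e.inv ≫ F.p z) (by simp [F.w])).ShortExact :=
      shortExact_of_isos _ (F.exact z) (Iso.refl _) e (Iso.refl _) (by simp) (by simp)
    exact ⟨_, _, _, hS, extClass_eq_of_hom _ _ e.inv (by simp) (by simp)⟩⟩
  have hψ : Function.Surjective ψ := by
    rintro ⟨_, i', p', h, hS, rfl⟩
    obtain ⟨z, φ, h1, h2⟩ := F.surj i' p' h hS
    have := isIso_of_extension_hom hS (F.exact z) φ h1 h2
    exact ⟨⟨z, ⟨(asIso φ).symm⟩⟩, Subtype.ext (extClass_eq_of_hom hS (F.exact z) φ h1 h2).symm⟩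
  have : Finite E := Finite.of_surjective ψ hψ
  have := Fintype.ofFinite E
  have hfib : ∀ e : E, Nat.card {d // ψ d = e} * Nat.card (A ⟶ C) = N := by
    intro e
    obtain ⟨⟨z, hz⟩, rfl⟩ := hψ e
    refine Eq.trans ?_ (F.card z)
    -- Members of the same class contribute a torsor under Hom(A, C), and all others contribute
    -- nothing.
    have key : ∀ z', Nat.card {φ : F.X z ⟶ F.X z' // F.i z ≫ φ = F.i z' ∧ φ ≫ F.p z' = F.p z} =
        if (F.exact z').extClass = (F.exact z).extClass then Nat.card (A ⟶ C) else 0 := by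
      intro z'
      split_ifs with h
      · obtain ⟨φ, hφ⟩ := exists_hom_of_extClass_eq _ _ h.symm
        exact F.card_hom φ hφ
      · have : IsEmpty {φ : F.X z ⟶ F.X z' // F.i z ≫ φ = F.i z' ∧ φ ≫ F.p z' = F.p z} :=
          ⟨fun φ => h (extClass_eq_of_hom _ _ φ.1 φ.2.1 φ.2.2).symm⟩
        exact Nat.card_of_isEmpty
    have hfin : ∀ z', Finite {φ : F.X z ⟶ F.X z' //
        F.i z ≫ φ = F.i z' ∧ φ ≫ F.p z' = F.p z} := by
      intro z'
      by_cases h : (F.exact z').extClass = (F.exact z).extClass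
      · refine Nat.finite_of_card_ne_zero ?_
        rw [key, if_pos h]
        exact Nat.card_pos.ne'
      · refine @Finite.of_subsingleton _ ⟨fun φ => (h (extClass_eq_of_hom _ _ φ.1 φ.2.1 φ.2.2).symm).elim⟩
    rw [Nat.card_sigma, Finset.sum_congr rfl (fun z' _ => key z'), Finset.sum_ite,
      Finset.sum_const_zero, add_zero, Finset.sum_const, smul_eq_mul]
    congr 1
    rw [← Fintype.card_subtype, ← Nat.card_eq_fintype_card]
    refine Nat.card_congr
      { toFun := fun d => ⟨d.1.1, congrArg Subtype.val d.2⟩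
        invFun := fun d => ⟨⟨d.1, ?_⟩, Subtype.ext d.2⟩
        left_inv := fun _ => rfl
        right_inv := fun _ => rfl }
    -- A member with the same class automatically has middle term `B`, because equivalences of
    -- extensions are isomorphisms.
    obtain ⟨φ, h1, h2⟩ := exists_hom_of_extClass_eq _ _ d.2
    have := isIso_of_extension_hom (F.exact d.1) (F.exact z) φ h1 h2
    exact hz.map fun e => asIso φ ≪≫ e
  have h1 : Nat.card D = ∑ e : E, Nat.card {d // ψ d = e} := by
    rw [← Nat.card_sigma]
    exact Nat.card_congr (Equiv.sigmaFiberEquiv ψ).symm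
  change Nat.card E * N = Nat.card D * _
  rw [h1, Finset.sum_mul, Finset.sum_congr rfl (fun e _ => hfib e), Finset.sum_const, smul_eq_mul,
    Finset.card_univ, Nat.card_eq_fintype_card]

/-- Transport of a family of extensions along isomorphisms of the outer terms. -/
def transport {A' C' : 𝒞} (a : A ≅ A') (c : C ≅ C') : ExtFamily A' C' Z N where
  X := F.X
  i z := c.inv ≫ F.i z
  p z := F.p z ≫ a.hom
  w z := by simp [reassoc_of% (F.w z)]
  exact z := shortExact_of_isos _ (F.exact z) c (Iso.refl _) a (by simp) (by simp)
  surj i' p' h hS := by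
    obtain ⟨z, φ, h1, h2⟩ := F.surj (c.hom ≫ i') (p' ≫ a.inv) (by simp [reassoc_of% h])
      (shortExact_of_isos _ hS c.symm (Iso.refl _) a.symm (by simp) (by simp))
    exact ⟨z, φ, by rw [← h1]; simp, by rw [← Category.assoc, h2]; simp⟩
  card z := by
    refine Eq.trans ?_ (F.card z)
    refine Nat.card_congr (Equiv.sigmaCongrRight fun z' => Equiv.subtypeEquivRight fun φ => ?_)
    simp only [Category.assoc, cancel_epi]
    rw [← Category.assoc, cancel_mono]

end ExtFamily

end ExtClass

/-! ### Extensions of ℤ/2-graded complexes as twisted sums. -/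

section TwoPeriodic

variable {𝒜 : Type u} [Category.{v} 𝒜] [Abelian 𝒜]

namespace C2

/-- Component `i` of a pair of morphisms indexed by `1` and `0`. -/
def pairHom {M N : C2 𝒜} (f₁ : M.X 1 ⟶ N.X 1) (f₀ : M.X 0 ⟶ N.X 0) :
    ∀ i : Fin 2, M.X (i : ZMod 2) ⟶ N.X (i : ZMod 2)
  | 0 => f₀
  | 1 => f₁

/-- A morphism of `ℤ/2`-graded complexes from its two components. -/
def homMk {M N : C2 𝒜} (f₁ : M.X 1 ⟶ N.X 1) (f₀ : M.X 0 ⟶ N.X 0)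
    (h₁ : M.d 1 0 ≫ f₀ = f₁ ≫ N.d 1 0) (h₀ : M.d 0 1 ≫ f₁ = f₀ ≫ N.d 0 1) : M ⟶ N where
  f := pairHom f₁ f₀
  comm' i j hij := by
    change Fin 2 at i j
    fin_cases i <;> fin_cases j
    · exact absurd (show (0 : ZMod 2) + 1 = 0 from hij) (by decide)
    · exact h₀.symm
    · exact h₁.symm
    · exact absurd (show (1 : ZMod 2) + 1 = 1 from hij) (by decide)

@[simp] lemma homMk_f_one {M N : C2 𝒜} (f₁ : M.X 1 ⟶ N.X 1) (f₀ : M.X 0 ⟶ N.X 0) (h₁ h₀) :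
    (homMk f₁ f₀ h₁ h₀).f 1 = f₁ := rfl

@[simp] lemma homMk_f_zero {M N : C2 𝒜} (f₁ : M.X 1 ⟶ N.X 1) (f₀ : M.X 0 ⟶ N.X 0) (h₁ h₀) :
    (homMk f₁ f₀ h₁ h₀).f 0 = f₀ := rfl

lemma forall_zmod_two {p : ZMod 2 → Prop} (h₁ : p 1) (h₀ : p 0) (i : ZMod 2) : p i := by
  change Fin 2 at i
  fin_cases i
  · exact h₀
  · exact h₁

lemma hom_ext {M N : C2 𝒜} {f g : M ⟶ N} (h₁ : f.f 1 = g.f 1) (h₀ : f.f 0 = g.f 0) : f = g :=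
  HomologicalComplex.hom_ext _ _ (forall_zmod_two h₁ h₀)

/-- An isomorphism of `ℤ/2`-graded complexes from its two components. -/
def isoMk {M N : C2 𝒜} (e₁ : M.X 1 ≅ N.X 1) (e₀ : M.X 0 ≅ N.X 0)
    (h₁ : M.d 1 0 ≫ e₀.hom = e₁.hom ≫ N.d 1 0) (h₀ : M.d 0 1 ≫ e₁.hom = e₀.hom ≫ N.d 0 1) :
    M ≅ N where
  hom := homMk e₁.hom e₀.hom h₁ h₀
  inv := homMk e₁.inv e₀.inv
    (by rw [Iso.comp_inv_eq, Category.assoc, h₁, Iso.inv_hom_id_assoc])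
    (by rw [Iso.comp_inv_eq, Category.assoc, h₀, Iso.inv_hom_id_assoc])
  hom_inv_id := hom_ext (by simp) (by simp)
  inv_hom_id := hom_ext (by simp) (by simp)

/-- An isomorphism of `ℤ/2`-graded complexes given by explicit data. -/
def isoOf {M₁ M₀ N₁ N₀ : 𝒜} {d₁ : M₁ ⟶ M₀} {d₀ : M₀ ⟶ M₁} {h : d₁ ≫ d₀ = 0} {h' : d₀ ≫ d₁ = 0}
    {c₁ : N₁ ⟶ N₀} {c₀ : N₀ ⟶ N₁} {k : c₁ ≫ c₀ = 0} {k' : c₀ ≫ c₁ = 0}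
    (e₁ : M₁ ≅ N₁) (e₀ : M₀ ≅ N₀)
    (h₁ : d₁ ≫ e₀.hom = e₁.hom ≫ c₁) (h₀ : d₀ ≫ e₁.hom = e₀.hom ≫ c₀) :
    C2.of d₁ d₀ h h' ≅ C2.of c₁ c₀ k k' :=
  isoMk (M := C2.of d₁ d₀ h h') (N := C2.of c₁ c₀ k k') e₁ e₀ h₁ h₀

lemma d_one_zero_one (M : C2 𝒜) : M.d 1 0 ≫ M.d 0 1 = 0 := M.d_comp_d _ _ _

lemma d_zero_one_zero (M : C2 𝒜) : M.d 0 1 ≫ M.d 1 0 = 0 := M.d_comp_d _ _ _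

instance (M N : C2 𝒜) [∀ X Y : 𝒜, Finite (X ⟶ Y)] : Finite (M ⟶ N) :=
  Finite.of_injective (fun f : M ⟶ N => (f.f 1, f.f 0)) fun _ _ h =>
    hom_ext (congrArg Prod.fst h) (congrArg Prod.snd h)

/-- The degree one cocycles `M ⟶ N`: pairs of morphisms `M₁ ⟶ N₀`, `M₀ ⟶ N₁` which anticommute
with the differentials. -/
def Cocycle (M N : C2 𝒜) : AddSubgroup ((M.X 1 ⟶ N.X 0) × (M.X 0 ⟶ N.X 1)) where
  carrier := {g | M.d 1 0 ≫ g.2 + g.1 ≫ N.d 0 1 = 0 ∧ M.d 0 1 ≫ g.1 + g.2 ≫ N.d 1 0 = 0}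
  add_mem' {a b} ha hb := by
    constructor
    · simpa [add_add_add_comm] using congrArg₂ (· + ·) ha.1 hb.1
    · simpa [add_add_add_comm] using congrArg₂ (· + ·) ha.2 hb.2
  zero_mem' := by simp
  neg_mem' {a} ha := by
    constructor
    · simpa [add_comm] using congrArg (- ·) ha.1
    · simpa [add_comm] using congrArg (- ·) ha.2

instance (M N : C2 𝒜) [∀ X Y : 𝒜, Finite (X ⟶ Y)] : Finite (Cocycle M N) :=
  inferInstanceAs (Finite (Subtype _))

/-- The extension of `M` by `N` defined by a cocycle. -/
def tw {M N : C2 𝒜} (g : Cocycle M N) : C2 𝒜 :=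
  C2.of (M₁ := M.X 1 ⊞ N.X 1) (M₀ := M.X 0 ⊞ N.X 0)
    (Biprod.ofComponents (M.d 1 0) g.1.1 0 (N.d 1 0))
    (Biprod.ofComponents (M.d 0 1) g.1.2 0 (N.d 0 1))
    (by have := g.2.1; ext <;> simp [M.d_one_zero_one, N.d_one_zero_one, this])
    (by have := g.2.2; ext <;> simp [M.d_zero_one_zero, N.d_zero_one_zero, this])

/-- The inclusion `N ⟶ tw g`. -/
def twInr {M N : C2 𝒜} (g : Cocycle M N) : N ⟶ tw g :=
  homMk (N := tw g) biprod.inr biprod.inr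
    (show N.d 1 0 ≫ biprod.inr = biprod.inr ≫ Biprod.ofComponents _ _ _ _ by simp)
    (show N.d 0 1 ≫ biprod.inr = biprod.inr ≫ Biprod.ofComponents _ _ _ _ by simp)

/-- The projection `tw g ⟶ M`. -/
def twFst {M N : C2 𝒜} (g : Cocycle M N) : tw g ⟶ M :=
  homMk (M := tw g) biprod.fst biprod.fst
    (show Biprod.ofComponents _ _ _ _ ≫ biprod.fst = biprod.fst ≫ M.d 1 0 by simp)
    (show Biprod.ofComponents _ _ _ _ ≫ biprod.fst = biprod.fst ≫ M.d 0 1 by simp)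

lemma tw_w {M N : C2 𝒜} (g : Cocycle M N) : twInr g ≫ twFst g = 0 :=
  hom_ext biprod.inr_fst biprod.inr_fst

lemma tw_shortExact {M N : C2 𝒜} (g : Cocycle M N) :
    (ShortComplex.mk (twInr g) (twFst g) (tw_w g)).ShortExact := by
  have key : ∀ X Y : 𝒜, (ShortComplex.mk (biprod.inr : Y ⟶ X ⊞ Y) biprod.fst
      biprod.inr_fst).ShortExact := fun X Y =>
    ShortComplex.Splitting.shortExact
      { r := biprod.snd, s := biprod.inl
        id := (add_comm _ _).trans biprod.total }
  refine HomologicalComplex.shortExact_of_degreewise_shortExact _ (forall_zmod_two ?_ ?_)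
  · exact key (M.X 1) (N.X 1)
  · exact key (M.X 0) (N.X 0)

/-- The isomorphism of extensions defined by a pair of morphisms `M₁ ⟶ N₁`, `M₀ ⟶ N₀`. -/
def twIso {M N : C2 𝒜} (g g' : Cocycle M N) (h₁ : M.X 1 ⟶ N.X 1) (h₀ : M.X 0 ⟶ N.X 0)
    (e₁ : g'.1.1 = g.1.1 + M.d 1 0 ≫ h₀ - h₁ ≫ N.d 1 0)
    (e₀ : g'.1.2 = g.1.2 + M.d 0 1 ≫ h₁ - h₀ ≫ N.d 0 1) : tw g ≅ tw g' :=
  isoOf (Biprod.unipotentUpper h₁) (Biprod.unipotentUpper h₀)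
    (by rw [e₁]; ext <;> simp [Biprod.unipotentUpper]; abel)
    (by rw [e₀]; ext <;> simp [Biprod.unipotentUpper]; abel)

/-- The cocycle `g + d h`. -/
def addBoundary {M N : C2 𝒜} (g : Cocycle M N) (h₁ : M.X 1 ⟶ N.X 1) (h₀ : M.X 0 ⟶ N.X 0) :
    Cocycle M N :=
  ⟨(g.1.1 + M.d 1 0 ≫ h₀ - h₁ ≫ N.d 1 0, g.1.2 + M.d 0 1 ≫ h₁ - h₀ ≫ N.d 0 1), by
    constructor
    · rw [← g.2.1]
      simp [reassoc_of% M.d_one_zero_one, N.d_one_zero_one]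
    · rw [← g.2.2]
      simp [reassoc_of% M.d_zero_one_zero, N.d_zero_one_zero]⟩

/-- Projectivity of the components of `M` splits the sequence in each degree. In such a splitting
the differential of `B` is upper triangular, and only its off-diagonal entry is new. -/
lemma exists_tw_of_shortExact {M N B : C2 𝒜} (hM : projComplex 𝒜 M) (i : N ⟶ B) (p : B ⟶ M)
    (w : i ≫ p = 0) (hS : (ShortComplex.mk i p w).ShortExact) :
    ∃ g : Cocycle M N, ∃ φ : B ⟶ tw g, i ≫ φ = twInr g ∧ φ ≫ twFst g = p := by
  have hs : ∀ j, ∃ (r : B.X j ⟶ N.X j) (s : M.X j ⟶ B.X j), i.f j ≫ r = 𝟙 _ ∧ s ≫ p.f j = 𝟙 _ ∧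
      r ≫ i.f j + p.f j ≫ s = 𝟙 _ := by
    intro j
    have h := (HomologicalComplex.shortExact_iff_degreewise_shortExact _).1 hS j
    have : Projective (M.X j) := hM j
    have : Projective ((ShortComplex.mk i p w).map
      (HomologicalComplex.eval 𝒜 (ComplexShape.up (ZMod 2)) j)).X₃ := this
    let σ := h.splittingOfProjective
    exact ⟨σ.r, σ.s, σ.f_r, σ.s_g, σ.id⟩
  have hw : ∀ j, i.f j ≫ p.f j = 0 := fun j => by
    rw [← HomologicalComplex.comp_f, w, HomologicalComplex.zero_f]
  obtain ⟨r₁, s₁, ir₁, sp₁, t₁⟩ := hs 1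
  obtain ⟨r₀, s₀, ir₀, sp₀, t₀⟩ := hs 0
  have q₁ : s₁ ≫ r₁ = 0 := by
    have := congrArg (s₁ ≫ · ≫ r₁) t₁
    simpa [ir₁, reassoc_of% sp₁] using this
  have q₀ : s₀ ≫ r₀ = 0 := by
    have := congrArg (s₀ ≫ · ≫ r₀) t₀
    simpa [ir₀, reassoc_of% sp₀] using this
  have u₁ : r₁ ≫ i.f 1 = 𝟙 _ - p.f 1 ≫ s₁ := by rw [← t₁]; abel
  have u₀ : r₀ ≫ i.f 0 = 𝟙 _ - p.f 0 ≫ s₀ := by rw [← t₀]; abel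
  have e₁ : B.d 1 0 ≫ r₀ = p.f 1 ≫ s₁ ≫ B.d 1 0 ≫ r₀ + r₁ ≫ N.d 1 0 := by
    have : r₁ ≫ N.d 1 0 = r₁ ≫ i.f 1 ≫ B.d 1 0 ≫ r₀ := by
      rw [i.comm_assoc, ir₀, Category.comp_id]
    rw [this, reassoc_of% u₁]
    simp
  have e₀ : B.d 0 1 ≫ r₁ = p.f 0 ≫ s₀ ≫ B.d 0 1 ≫ r₁ + r₀ ≫ N.d 0 1 := by
    have : r₀ ≫ N.d 0 1 = r₀ ≫ i.f 0 ≫ B.d 0 1 ≫ r₁ := by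
      rw [i.comm_assoc, ir₁, Category.comp_id]
    rw [this, reassoc_of% u₀]
    simp
  -- The off-diagonal block of the differential; the cocycle identities are the off-diagonal block
  -- of d² = 0.
  let g : Cocycle M N := ⟨(s₁ ≫ B.d 1 0 ≫ r₀, s₀ ≫ B.d 0 1 ≫ r₁), by
    constructor
    · have : r₀ ≫ N.d 0 1 = B.d 0 1 ≫ r₁ - p.f 0 ≫ s₀ ≫ B.d 0 1 ≫ r₁ := by
        rw [eq_sub_iff_add_eq, add_comm, ← e₀]
      simp only [Category.assoc, this]
      have hc : s₁ ≫ B.d 1 0 ≫ p.f 0 = M.d 1 0 := by rw [← p.comm, reassoc_of% sp₁]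
      simp [reassoc_of% hc, reassoc_of% B.d_one_zero_one]
    · have : r₁ ≫ N.d 1 0 = B.d 1 0 ≫ r₀ - p.f 1 ≫ s₁ ≫ B.d 1 0 ≫ r₀ := by
        rw [eq_sub_iff_add_eq, add_comm, ← e₁]
      simp only [Category.assoc, this]
      have hc : s₀ ≫ B.d 0 1 ≫ p.f 1 = M.d 0 1 := by rw [← p.comm, reassoc_of% sp₀]
      simp [reassoc_of% hc, reassoc_of% B.d_zero_one_zero]⟩
  refine ⟨g, homMk (N := tw g) (biprod.lift (p.f 1) r₁) (biprod.lift (p.f 0) r₀) ?_ ?_,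
    hom_ext ?_ ?_, hom_ext ?_ ?_⟩
  · change B.d 1 0 ≫ biprod.lift (p.f 0) r₀ = biprod.lift (p.f 1) r₁ ≫
      Biprod.ofComponents (M.d 1 0) (s₁ ≫ B.d 1 0 ≫ r₀) 0 (N.d 1 0)
    ext
    · simp
    · simpa using e₁
  · change B.d 0 1 ≫ biprod.lift (p.f 1) r₁ = biprod.lift (p.f 0) r₀ ≫
      Biprod.ofComponents (M.d 0 1) (s₀ ≫ B.d 0 1 ≫ r₁) 0 (N.d 0 1)
    ext
    · simp
    · simpa using e₀
  · change i.f 1 ≫ biprod.lift (p.f 1) r₁ = biprod.inr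
    ext <;> simp [hw, ir₁]
  · change i.f 0 ≫ biprod.lift (p.f 0) r₀ = biprod.inr
    ext <;> simp [hw, ir₀]
  · exact biprod.lift_fst _ _
  · exact biprod.lift_fst _ _

/-- An equivalence out of `tw g` is unipotent with off-diagonal entry a pair `(h₁, h₀)`. Being a
chain map determines its target, namely `addBoundary g h₁ h₀`, and puts no condition on the pair. So
the target ranges over all cocycles while only pairs are counted. -/
lemma card_extensionHom {M N : C2 𝒜} (g : Cocycle M N) :
    Nat.card (Σ g' : Cocycle M N,
      {φ : tw g ⟶ tw g' // twInr g ≫ φ = twInr g' ∧ φ ≫ twFst g' = twFst g}) =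
      Nat.card (M.X 1 ⟶ N.X 1) * Nat.card (M.X 0 ⟶ N.X 0) := by
  rw [← Nat.card_prod]
  symm
  refine Nat.card_eq_of_bijective (fun h =>
    (⟨addBoundary g h.1 h.2, (twIso g (addBoundary g h.1 h.2) h.1 h.2 rfl rfl).hom,
      hom_ext ?_ ?_, hom_ext ?_ ?_⟩ : Σ g' : Cocycle M N,
      {φ : tw g ⟶ tw g' // twInr g ≫ φ = twInr g' ∧ φ ≫ twFst g' = twFst g})) ⟨?_, ?_⟩
  · change biprod.inr ≫ Biprod.ofComponents _ _ _ _ = biprod.inr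
    simp
  · change biprod.inr ≫ Biprod.ofComponents _ _ _ _ = biprod.inr
    simp
  · change Biprod.ofComponents _ _ _ _ ≫ biprod.fst = biprod.fst
    simp
  · change Biprod.ofComponents _ _ _ _ ≫ biprod.fst = biprod.fst
    simp
  · let F : (Σ g' : Cocycle M N,
        {φ : tw g ⟶ tw g' // twInr g ≫ φ = twInr g' ∧ φ ≫ twFst g' = twFst g}) →
        (M.X 1 ⟶ N.X 1) × (M.X 0 ⟶ N.X 0) := fun x =>
      (biprod.inl ≫ (x.2.1.f 1 : M.X 1 ⊞ N.X 1 ⟶ M.X 1 ⊞ N.X 1) ≫ biprod.snd,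
        biprod.inl ≫ (x.2.1.f 0 : M.X 0 ⊞ N.X 0 ⟶ M.X 0 ⊞ N.X 0) ≫ biprod.snd)
    refine Function.LeftInverse.injective (g := F) fun h => Prod.ext ?_ ?_
    · change biprod.inl ≫ Biprod.ofComponents (𝟙 _) h.1 0 (𝟙 _) ≫ biprod.snd = h.1
      simp
    · change biprod.inl ≫ Biprod.ofComponents (𝟙 _) h.2 0 (𝟙 _) ≫ biprod.snd = h.2
      simp
  · rintro ⟨g', φ, hi, hp⟩
    obtain ⟨φ₁, hφ₁⟩ : ∃ φ₁ : M.X 1 ⊞ N.X 1 ⟶ M.X 1 ⊞ N.X 1, φ₁ = φ.f 1 := ⟨_, rfl⟩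
    obtain ⟨φ₀, hφ₀⟩ : ∃ φ₀ : M.X 0 ⊞ N.X 0 ⟶ M.X 0 ⊞ N.X 0, φ₀ = φ.f 0 := ⟨_, rfl⟩
    have i₁ : biprod.inr ≫ φ₁ = biprod.inr := by
      rw [hφ₁]; exact congrArg (fun f => HomologicalComplex.Hom.f f 1) hi
    have i₀ : biprod.inr ≫ φ₀ = biprod.inr := by
      rw [hφ₀]; exact congrArg (fun f => HomologicalComplex.Hom.f f 0) hi
    have p₁ : φ₁ ≫ biprod.fst = biprod.fst := by
      rw [hφ₁]; exact congrArg (fun f => HomologicalComplex.Hom.f f 1) hp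
    have p₀ : φ₀ ≫ biprod.fst = biprod.fst := by
      rw [hφ₀]; exact congrArg (fun f => HomologicalComplex.Hom.f f 0) hp
    -- Compatibility with the inclusion of `N` and the projection to `M` leaves one free matrix
    -- entry.
    have c₁ : φ₁ = Biprod.ofComponents (𝟙 _) (biprod.inl ≫ φ₁ ≫ biprod.snd) 0 (𝟙 _) := by
      ext <;> simp [p₁, reassoc_of% i₁]
    have c₀ : φ₀ = Biprod.ofComponents (𝟙 _) (biprod.inl ≫ φ₀ ≫ biprod.snd) 0 (𝟙 _) := by
      ext <;> simp [p₀, reassoc_of% i₀]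
    generalize biprod.inl ≫ φ₁ ≫ biprod.snd = h₁ at c₁
    generalize biprod.inl ≫ φ₀ ≫ biprod.snd = h₀ at c₀
    have m₁ : Biprod.ofComponents (𝟙 _) h₁ 0 (𝟙 _) ≫
        Biprod.ofComponents (M.d 1 0) g'.1.1 0 (N.d 1 0) =
        Biprod.ofComponents (M.d 1 0) g.1.1 0 (N.d 1 0) ≫
          Biprod.ofComponents (𝟙 _) h₀ 0 (𝟙 _) := by
      rw [← c₁, ← c₀, hφ₁, hφ₀]; exact φ.comm 1 0
    have m₀ : Biprod.ofComponents (𝟙 _) h₀ 0 (𝟙 _) ≫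
        Biprod.ofComponents (M.d 0 1) g'.1.2 0 (N.d 0 1) =
        Biprod.ofComponents (M.d 0 1) g.1.2 0 (N.d 0 1) ≫
          Biprod.ofComponents (𝟙 _) h₁ 0 (𝟙 _) := by
      rw [← c₁, ← c₀, hφ₁, hφ₀]; exact φ.comm 0 1
    have n₁ := congrArg (fun f => biprod.inl ≫ f ≫ biprod.snd) m₁
    have n₀ := congrArg (fun f => biprod.inl ≫ f ≫ biprod.snd) m₀
    simp only [Biprod.ofComponents_snd, Preadditive.comp_add, biprod.inl_fst_assoc,
      biprod.inl_snd_assoc, Category.id_comp, Category.comp_id, zero_comp, add_zero,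
      Biprod.ofComponents_comp] at n₁ n₀
    obtain rfl : g' = addBoundary g h₁ h₀ := by
      refine Subtype.ext (Prod.ext ?_ ?_)
      · change g'.1.1 = g.1.1 + M.d 1 0 ≫ h₀ - h₁ ≫ N.d 1 0
        rw [eq_sub_iff_add_eq, n₁, add_comm]
      · change g'.1.2 = g.1.2 + M.d 0 1 ≫ h₁ - h₀ ≫ N.d 0 1
        rw [eq_sub_iff_add_eq, n₀, add_comm]
    refine ⟨(h₁, h₀), Sigma.ext rfl (heq_of_eq (Subtype.ext (hom_ext ?_ ?_)))⟩
    · exact (hφ₁.symm.trans c₁).symm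
    · exact (hφ₀.symm.trans c₀).symm

/-- The family of the extensions of `M` by `N` defined by cocycles. -/
def twFamily {M : C2 𝒜} (hM : projComplex 𝒜 M) (N : C2 𝒜) :
    ExtFamily M N (Cocycle M N) (Nat.card (M.X 1 ⟶ N.X 1) * Nat.card (M.X 0 ⟶ N.X 0)) where
  X := tw
  i := twInr
  p := twFst
  w := tw_w
  exact := tw_shortExact
  surj := exists_tw_of_shortExact hM
  card := card_extensionHom

end C2

end TwoPeriodic

/-! ### The Hall product as a sum over cocycles. -/

section Multiplication

set_option linter.unusedSectionVars false

namespace ConstAlg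

variable {I : Type u} {γ : I → I → I → ℂ} {e : I}

/-- This trades structure constants for a sum over a finite parameter set with repetitions, the form
in which products are compared by bijections. -/
lemma basisElt_mul_basisElt {Z : Type w} [Fintype Z] (f : Z → I) (s : ℂ) (a c : I)
    (h : ∀ b, γ a c b = s * (Nat.card {z // f z = b} : ℂ)) :
    basisElt γ e a * basisElt γ e c = s • ∑ z, basisElt γ e (f z) := by
  classical
  change mulMap γ (Finsupp.single a 1) (Finsupp.single c 1) =
    s • ∑ z, (Finsupp.single (f z) 1 : I →₀ ℂ)
  simp only [mulMap, Finsupp.linearCombination_single, one_smul]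
  -- The structure constants vanish off the finite image of `f`, so the `finsum` is a genuine sum
  -- and not the default value 0.
  rw [finsum_eq_sum_of_support_subset (s := Finset.univ.image f)]
  · have hc : ∀ b, (Nat.card {z // f z = b} : ℂ) = ∑ z, if f z = b then 1 else 0 := by
      intro b
      rw [Finset.sum_boole, Nat.card_eq_fintype_card, Fintype.card_subtype]
    ext b
    simp only [Finsupp.finsetSum_apply, Finsupp.smul_apply, Finsupp.single_apply, smul_eq_mul,
      ← hc]
    rw [Finset.sum_ite_eq' (Finset.univ.image f) b (fun b => γ a c b), h]
    split_ifs with hb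
    · rfl
    · rw [hc, Finset.sum_eq_zero, mul_zero]
      intro z _
      rw [if_neg]
      rintro rfl
      exact hb (Finset.mem_image_of_mem f (Finset.mem_univ z))
  · intro b hb
    by_contra hn
    apply hb
    have : IsEmpty {z // f z = b} :=
      ⟨fun z => hn (by simp [← z.2])⟩
    simp [h]

end ConstAlg

variable (k : Type w) [Field k] {𝒜 : Type u} [Category.{v} 𝒜] [Abelian 𝒜] [Linear k 𝒜]

/-- The dimension of `Hom(X, Y)`, as an integer. -/
def homDim (X Y : 𝒜) : ℤ := (Module.finrank k (X ⟶ Y) : ℤ)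

lemma homDim_congr {X X' Y Y' : 𝒜} (e : X ≅ X') (f : Y ≅ Y') : homDim k X Y = homDim k X' Y' := by
  refine congrArg Nat.cast (LinearEquiv.finrank_eq
    { toFun := fun g => e.inv ≫ g ≫ f.hom
      invFun := fun g => e.hom ≫ g ≫ f.inv
      map_add' := by simp
      map_smul' := by simp
      left_inv := fun g => by simp
      right_inv := fun g => by simp })

lemma eulerForm_eq_homDim (P Y : 𝒜) [Projective P] : eulerForm k P Y = homDim k P Y := by
  let := HasExt.standard 𝒜
  unfold eulerForm
  rw [finsum_eq_single _ 0]
  · simp only [pow_zero, one_mul]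
    exact congrArg Nat.cast (LinearEquiv.finrank_eq Abelian.Ext.linearEquiv₀)
  · intro i hi
    obtain ⟨j, rfl⟩ := Nat.exists_eq_succ_of_ne_zero hi
    have := Abelian.Ext.subsingleton_of_projective P Y j
    rw [Module.finrank_zero_of_subsingleton]
    simp

variable [Finite k]

lemma one_lt_natCard : (1 : ℝ) < Nat.card k := by
  exact_mod_cast Finite.one_lt_card

lemma tt_ne_zero : tt k ≠ 0 := by
  have := one_lt_natCard k
  simp only [tt, ne_eq, Complex.ofReal_eq_zero, Real.sqrt_eq_zero']
  linarith

lemma tt_sq : tt k ^ (2 : ℤ) = (Nat.card k : ℂ) := by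
  have : (0 : ℝ) ≤ Nat.card k := Nat.cast_nonneg _
  rw [tt, zpow_ofNat, ← Complex.ofReal_pow, Real.sq_sqrt this, Complex.ofReal_natCast]

lemma tt_add (a b : ℤ) : tt k ^ (a + b) = tt k ^ a * tt k ^ b := zpow_add₀ (tt_ne_zero k) a b

lemma card_module (V : Type*) [AddCommGroup V] [Module k V] [Finite V] :
    (Nat.card V : ℂ) = tt k ^ (2 * (Module.finrank k V : ℤ)) := by
  have : Module.Finite k V := Module.Finite.of_finite
  rw [zpow_mul, tt_sq, zpow_natCast, Module.natCard_eq_pow_finrank (K := k), Nat.cast_pow]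

variable [∀ X Y : 𝒜, Finite (X ⟶ Y)]

lemma card_hom (X Y : 𝒜) : (Nat.card (X ⟶ Y) : ℂ) = tt k ^ (2 * homDim k X Y) :=
  card_module k (X ⟶ Y)

/-- The structure constants of a Hall algebra, in terms of a family of extensions. -/
lemma hallNumber_eq {𝒞 : Type u} [Category.{v} 𝒞] [Abelian 𝒞] {A C A' C' : 𝒞} {Z : Type w}
    [Finite Z] [Finite (A' ⟶ C')] {N : ℕ} (hN : N ≠ 0) (F : ExtFamily A C Z N) (a : A ≅ A')
    (c : C ≅ C') (B : 𝒞) :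
    hallNumber A' C' B = (N : ℂ)⁻¹ * Nat.card {z // Nonempty (F.X z ≅ B)} := by
  have h := (F.transport a c).extCount_mul B
  have h0 : (Nat.card (A' ⟶ C') : ℂ) ≠ 0 := Nat.cast_ne_zero.2 Nat.card_pos.ne'
  have hN' : (N : ℂ) ≠ 0 := Nat.cast_ne_zero.2 hN
  have h' : (extCount A' C' B : ℂ) * N = Nat.card {z // Nonempty (F.X z ≅ B)} *
      Nat.card (A' ⟶ C') := by exact_mod_cast h
  rw [hallNumber, div_eq_iff h0, mul_assoc, ← h']
  field_simp

instance (M N : C2 𝒜) : Fintype (C2.Cocycle M N) := Fintype.ofFinite _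

/-- The extension of `M` by `N` defined by a cocycle, as a complex of projectives. -/
def twP {M N : C2P 𝒜} (g : C2.Cocycle M.obj N.obj) : C2P 𝒜 :=
  ⟨C2.tw g, C2.forall_zmod_two
    (by
      have := M.property 1
      have := N.property 1
      exact inferInstanceAs (Projective (M.obj.X 1 ⊞ N.obj.X 1)))
    (by
      have := M.property 0
      have := N.property 0
      exact inferInstanceAs (Projective (M.obj.X 0 ⊞ N.obj.X 0)))⟩

lemma isoClass_eq_iff (M N : C2P 𝒜) : isoClass M = isoClass N ↔ Nonempty (M.obj ≅ N.obj) :=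
  Quotient.eq.trans ⟨fun ⟨e⟩ => ⟨(projComplex 𝒜).ι.mapIso e⟩,
    fun ⟨e⟩ => ⟨(projComplex 𝒜).isoMk e⟩⟩

lemma nonempty_iso_out (M : C2P 𝒜) : Nonempty (M.obj ≅ (isoClass M).out.obj) :=
  (isoClass_eq_iff _ _).1 (Quotient.out_eq (isoClass M)).symm

/-- `⟨M₀, N₀⟩ + ⟨M₁, N₁⟩`. -/
def homDim₂ (M N : C2 𝒜) : ℤ := homDim k (M.X 0) (N.X 0) + homDim k (M.X 1) (N.X 1)

/-- The isomorphism of the components of two isomorphic complexes. -/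
def C2.appIso {M N : C2 𝒜} (e : M ≅ N) (i : ZMod 2) : M.X i ≅ N.X i :=
  (HomologicalComplex.eval 𝒜 _ i).mapIso e

/-- Components are projective, so the Euler forms in the twist are dimensions of Hom spaces, and the
denominator |Hom(M, N)| is already absorbed by `hallNumber_eq`. -/
theorem TwHallC2P.cls_mul_cls (M N : C2P 𝒜) :
    TwHallC2P.cls k M * TwHallC2P.cls k N =
      tt k ^ (-homDim₂ k M.obj N.obj) •
        ∑ g : C2.Cocycle M.obj N.obj, TwHallC2P.cls k (twP g) := by
  refine ConstAlg.basisElt_mul_basisElt (fun g => isoClass (twP g)) _ _ _ fun b => ?_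
  obtain ⟨eM⟩ := nonempty_iso_out M
  obtain ⟨eN⟩ := nonempty_iso_out N
  have hM : ∀ i, Projective ((isoClass M).out.obj.X i) := (isoClass M).out.property
  rw [eulerForm_eq_homDim, eulerForm_eq_homDim,
    ← homDim_congr k (C2.appIso eM 0) (C2.appIso eN 0),
    ← homDim_congr k (C2.appIso eM 1) (C2.appIso eN 1),
    hallNumber_eq (Nat.mul_ne_zero Nat.card_pos.ne' Nat.card_pos.ne')
      (C2.twFamily M.property N.obj) eM eN, ← mul_assoc]
  congr 1
  -- With d the value of `homDim₂`, the twist gives t^d and the multiplicity of the family gives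
  -- q^(-d) = t^(-2d).
  · rw [Nat.cast_mul, card_hom k, card_hom k, ← tt_add, ← zpow_neg, ← tt_add]
    congr 1
    unfold homDim₂
    ring
  · congr 1
    refine Nat.card_congr (Equiv.subtypeEquivRight fun g => ?_)
    exact (isoClass_eq_iff (twP g) b.out).symm.trans (Eq.congr_right (Quotient.out_eq b))

end Multiplication

/-! ### Reassociating twisted sums. -/

section HallAlgebra

namespace ConstAlg

variable {I : Type u} {γ : I → I → I → ℂ} {e : I}

instance : IsScalarTower ℂ (ConstAlg γ e) (ConstAlg γ e) where
  smul_assoc c x y := (mulMap γ).map_smul₂ c x y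

instance : SMulCommClass ℂ (ConstAlg γ e) (ConstAlg γ e) where
  smul_comm c x y := ((mulMap γ x).map_smul c y).symm

lemma induction {p : ConstAlg γ e → Prop} (h0 : p 0) (hadd : ∀ x y, p x → p y → p (x + y))
    (hsmul : ∀ (c : ℂ) x, p x → p (c • x)) (hb : ∀ a, p (basisElt γ e a)) (x : ConstAlg γ e) :
    p x := by
  refine Finsupp.induction_linear (motive := p) x h0 hadd fun a c => ?_
  have : (Finsupp.single a c : I →₀ ℂ) = c • (Finsupp.single a 1 : I →₀ ℂ) := by simp
  rw [this]
  exact hsmul c _ (hb a)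

lemma mul_assoc_of_basis (h : ∀ a b c, basisElt γ e a * basisElt γ e b * basisElt γ e c =
    basisElt γ e a * (basisElt γ e b * basisElt γ e c)) (x y z : ConstAlg γ e) :
    x * y * z = x * (y * z) := by
  induction x using induction with
  | h0 => simp
  | hadd x x' hx hx' => simp [add_mul, hx, hx']
  | hsmul r x hx => simp [smul_mul_assoc, hx]
  | hb a =>
    induction y using induction with
    | h0 => simp
    | hadd x x' hx hx' => simp [add_mul, mul_add, hx, hx']
    | hsmul r x hx => simp [smul_mul_assoc, mul_smul_comm, hx]
    | hb b =>
      induction z using induction with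
      | h0 => simp
      | hadd x x' hx hx' => simp [mul_add, hx, hx']
      | hsmul r x hx => simp [mul_smul_comm, hx]
      | hb c => exact h a b c

end ConstAlg

variable {𝒜 : Type u} [Category.{v} 𝒜] [Abelian 𝒜]

section Matrices

variable {A A' B C D A₁ A₂ A₃ B₁ B₂ B₃ C₁ C₂ : 𝒜}

@[simp]
lemma inl_ofComponents_assoc (f : A₁ ⟶ B₁) (g : A₁ ⟶ B₂) (f' : A₂ ⟶ B₁) (g' : A₂ ⟶ B₂)
    (h : B₁ ⊞ B₂ ⟶ D) :
    biprod.inl ≫ Biprod.ofComponents f g f' g' ≫ h = f ≫ biprod.inl ≫ h + g ≫ biprod.inr ≫ h := by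
  rw [← Category.assoc, Biprod.inl_ofComponents]
  simp

@[simp]
lemma inr_ofComponents_assoc (f : A₁ ⟶ B₁) (g : A₁ ⟶ B₂) (f' : A₂ ⟶ B₁) (g' : A₂ ⟶ B₂)
    (h : B₁ ⊞ B₂ ⟶ D) :
    biprod.inr ≫ Biprod.ofComponents f g f' g' ≫ h =
      f' ≫ biprod.inl ≫ h + g' ≫ biprod.inr ≫ h := by
  rw [← Category.assoc, Biprod.inr_ofComponents]
  simp

@[simp]
lemma ofComponents_fst_assoc (f : A₁ ⟶ B₁) (g : A₁ ⟶ B₂) (f' : A₂ ⟶ B₁) (g' : A₂ ⟶ B₂)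
    (h : B₁ ⟶ D) :
    Biprod.ofComponents f g f' g' ≫ biprod.fst ≫ h =
      biprod.fst ≫ f ≫ h + biprod.snd ≫ f' ≫ h := by
  rw [← Category.assoc, Biprod.ofComponents_fst]
  simp

@[simp]
lemma ofComponents_snd_assoc (f : A₁ ⟶ B₁) (g : A₁ ⟶ B₂) (f' : A₂ ⟶ B₁) (g' : A₂ ⟶ B₂)
    (h : B₂ ⟶ D) :
    Biprod.ofComponents f g f' g' ≫ biprod.snd ≫ h =
      biprod.fst ≫ g ≫ h + biprod.snd ≫ g' ≫ h := by
  rw [← Category.assoc, Biprod.ofComponents_snd]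
  simp

/-- For a cocycle out of a twisted sum, the row of the sub-object is the cocycle condition for that
sub-object alone, while the other row carries the correction by `g`. The next lemma is the dual
statement for cocycles into a twisted sum. -/
lemma ofComponents_comp_add_eq_zero_iff (m : A₁ ⟶ B₁) (g : A₁ ⟶ B₂) (n : A₂ ⟶ B₂)
    (x : B₁ ⊞ B₂ ⟶ D) (y : A₁ ⊞ A₂ ⟶ C) (l : C ⟶ D) :
    Biprod.ofComponents m g 0 n ≫ x + y ≫ l = 0 ↔
      (m ≫ biprod.inl ≫ x + g ≫ biprod.inr ≫ x + (biprod.inl ≫ y) ≫ l = 0) ∧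
        n ≫ biprod.inr ≫ x + (biprod.inr ≫ y) ≫ l = 0 := by
  constructor
  · intro h
    constructor
    · simpa [add_assoc] using congrArg (biprod.inl ≫ ·) h
    · simpa using congrArg (biprod.inr ≫ ·) h
  · rintro ⟨h, h'⟩
    apply biprod.hom_ext'
    · simpa [add_assoc] using h
    · simpa using h'

lemma comp_add_ofComponents_eq_zero_iff (d : A ⟶ A') (x : A' ⟶ C₁ ⊞ C₂) (y : A ⟶ B₁ ⊞ B₂)
    (n : B₁ ⟶ C₁) (b : B₁ ⟶ C₂) (l : B₂ ⟶ C₂) :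
    d ≫ x + y ≫ Biprod.ofComponents n b 0 l = 0 ↔
      (d ≫ x ≫ biprod.fst + (y ≫ biprod.fst) ≫ n = 0) ∧
        d ≫ x ≫ biprod.snd + (y ≫ biprod.fst) ≫ b + (y ≫ biprod.snd) ≫ l = 0 := by
  constructor
  · intro h
    constructor
    · simpa using congrArg (· ≫ biprod.fst) h
    · simpa [add_assoc] using congrArg (· ≫ biprod.snd) h
  · rintro ⟨h, h'⟩
    apply biprod.hom_ext
    · simpa using h
    · simpa [add_assoc] using h'

lemma ofComponents_associator (m : A₁ ⟶ B₁) (n : A₂ ⟶ B₂) (l : A₃ ⟶ B₃) (g : A₁ ⟶ B₂)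
    (h : A₁ ⊞ A₂ ⟶ B₃) :
    Biprod.ofComponents (Biprod.ofComponents m g 0 n) h 0 l ≫ (biprod.associator B₁ B₂ B₃).hom =
      (biprod.associator A₁ A₂ A₃).hom ≫
        Biprod.ofComponents m (biprod.lift g (biprod.inl ≫ h)) 0
          (Biprod.ofComponents n (biprod.inr ≫ h) 0 l) := by
  ext <;> simp

lemma ofComponents_braiding (m : A₁ ⟶ B₁) (n : A₂ ⟶ B₂) :
    Biprod.ofComponents m 0 0 n ≫ (biprod.braiding B₁ B₂).hom =
      (biprod.braiding A₁ A₂).hom ≫ Biprod.ofComponents n 0 0 m := by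
  ext <;> simp

lemma desc_inl_inr (h : A₁ ⊞ A₂ ⟶ B) : biprod.desc (biprod.inl ≫ h) (biprod.inr ≫ h) = h := by
  ext <;> simp

lemma lift_fst_snd (h : A ⟶ B₁ ⊞ B₂) : biprod.lift (h ≫ biprod.fst) (h ≫ biprod.snd) = h := by
  ext <;> simp

lemma ofComponents_id_id (X Y : 𝒜) : Biprod.ofComponents (𝟙 X) 0 0 (𝟙 Y) = 𝟙 (X ⊞ Y) := by
  ext <;> simp

lemma ofComponents_zero (X Y X' Y' : 𝒜) :
    Biprod.ofComponents (0 : X ⟶ X') 0 0 (0 : Y ⟶ Y') = 0 := by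
  ext <;> simp

end Matrices

/-- The direct sum of complexes of projectives. -/
def dsum (M N : C2P 𝒜) : C2P 𝒜 := twP (M := M) (N := N) 0

lemma nonempty_dsum_comm (M N : C2P 𝒜) : Nonempty ((dsum M N).obj ≅ (dsum N M).obj) :=
  ⟨C2.isoMk (M := C2.tw 0) (N := C2.tw 0) (biprod.braiding (M.obj.X 1) (N.obj.X 1))
    (biprod.braiding (M.obj.X 0) (N.obj.X 0)) (ofComponents_braiding _ _)
    (ofComponents_braiding _ _)⟩

section Associativity

variable {M N L : C2P 𝒜}

lemma sigma_cocycle_ext {x y : Σ g : C2.Cocycle M.obj N.obj, C2.Cocycle (twP g).obj L.obj}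
    (h : x.1 = y.1) (h' : (x.2.1 : (M.obj.X 1 ⊞ N.obj.X 1 ⟶ L.obj.X 0) ×
      (M.obj.X 0 ⊞ N.obj.X 0 ⟶ L.obj.X 1)) = y.2.1) : x = y := by
  obtain ⟨g, a⟩ := x
  obtain ⟨g', a'⟩ := y
  obtain rfl : g = g' := h
  obtain rfl : a = a' := Subtype.ext h'
  rfl

lemma sigma_cocycle_ext' {x y : Σ g : C2.Cocycle N.obj L.obj, C2.Cocycle M.obj (twP g).obj}
    (h : x.1 = y.1) (h' : (x.2.1 : (M.obj.X 1 ⟶ N.obj.X 0 ⊞ L.obj.X 0) ×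
      (M.obj.X 0 ⟶ N.obj.X 1 ⊞ L.obj.X 1)) = y.2.1) : x = y := by
  obtain ⟨g, a⟩ := x
  obtain ⟨g', a'⟩ := y
  obtain rfl : g = g' := h
  obtain rfl : a = a' := Subtype.ext h'
  rfl

variable (M N L) in
/-- Iterated extensions of `M`, `N`, `L` can be built up in two ways. -/
def cocycleAssoc : (Σ g : C2.Cocycle M.obj N.obj, C2.Cocycle (twP g).obj L.obj) ≃
    (Σ g : C2.Cocycle N.obj L.obj, C2.Cocycle M.obj (twP g).obj) where
  toFun x := ⟨⟨((biprod.inr : N.obj.X 1 ⟶ M.obj.X 1 ⊞ N.obj.X 1) ≫ x.2.1.1,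
      (biprod.inr : N.obj.X 0 ⟶ M.obj.X 0 ⊞ N.obj.X 0) ≫ x.2.1.2),
      ((ofComponents_comp_add_eq_zero_iff _ _ _ _ _ _).1 x.2.2.1).2,
      ((ofComponents_comp_add_eq_zero_iff _ _ _ _ _ _).1 x.2.2.2).2⟩,
    ⟨(biprod.lift x.1.1.1 ((biprod.inl : M.obj.X 1 ⟶ M.obj.X 1 ⊞ N.obj.X 1) ≫ x.2.1.1),
      biprod.lift x.1.1.2 ((biprod.inl : M.obj.X 0 ⟶ M.obj.X 0 ⊞ N.obj.X 0) ≫ x.2.1.2)),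
      (comp_add_ofComponents_eq_zero_iff _ _ _ _ _ _).2 (by
        simp only [biprod.lift_fst, biprod.lift_snd]
        exact ⟨x.1.2.1, ((ofComponents_comp_add_eq_zero_iff _ _ _ _ _ _).1 x.2.2.1).1⟩),
      (comp_add_ofComponents_eq_zero_iff _ _ _ _ _ _).2 (by
        simp only [biprod.lift_fst, biprod.lift_snd]
        exact ⟨x.1.2.2, ((ofComponents_comp_add_eq_zero_iff _ _ _ _ _ _).1 x.2.2.2).1⟩)⟩⟩
  invFun x := ⟨⟨(x.2.1.1 ≫ (biprod.fst : N.obj.X 0 ⊞ L.obj.X 0 ⟶ N.obj.X 0),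
      x.2.1.2 ≫ (biprod.fst : N.obj.X 1 ⊞ L.obj.X 1 ⟶ N.obj.X 1)),
      ((comp_add_ofComponents_eq_zero_iff _ _ _ _ _ _).1 x.2.2.1).1,
      ((comp_add_ofComponents_eq_zero_iff _ _ _ _ _ _).1 x.2.2.2).1⟩,
    ⟨(biprod.desc (x.2.1.1 ≫ (biprod.snd : N.obj.X 0 ⊞ L.obj.X 0 ⟶ L.obj.X 0)) x.1.1.1,
      biprod.desc (x.2.1.2 ≫ (biprod.snd : N.obj.X 1 ⊞ L.obj.X 1 ⟶ L.obj.X 1)) x.1.1.2),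
      (ofComponents_comp_add_eq_zero_iff _ _ _ _ _ _).2 (by
        simp only [biprod.inl_desc, biprod.inr_desc]
        exact ⟨((comp_add_ofComponents_eq_zero_iff _ _ _ _ _ _).1 x.2.2.1).2, x.1.2.1⟩),
      (ofComponents_comp_add_eq_zero_iff _ _ _ _ _ _).2 (by
        simp only [biprod.inl_desc, biprod.inr_desc]
        exact ⟨((comp_add_ofComponents_eq_zero_iff _ _ _ _ _ _).1 x.2.2.2).2, x.1.2.2⟩)⟩⟩
  left_inv x := by
    refine sigma_cocycle_ext ?_ ?_
    · exact Subtype.ext (Prod.ext (biprod.lift_fst _ _) (biprod.lift_fst _ _))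
    · refine Prod.ext ?_ ?_
      · refine Eq.trans ?_ (desc_inl_inr x.2.1.1)
        exact congrArg (fun h => biprod.desc h _) (biprod.lift_snd _ _)
      · refine Eq.trans ?_ (desc_inl_inr x.2.1.2)
        exact congrArg (fun h => biprod.desc h _) (biprod.lift_snd _ _)
  right_inv x := by
    refine sigma_cocycle_ext' ?_ ?_
    · exact Subtype.ext (Prod.ext (biprod.inr_desc _ _) (biprod.inr_desc _ _))
    · refine Prod.ext ?_ ?_
      · refine Eq.trans ?_ (lift_fst_snd x.2.1.1)
        exact congrArg (fun h => biprod.lift _ h) (biprod.inl_desc _ _)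
      · refine Eq.trans ?_ (lift_fst_snd x.2.1.2)
        exact congrArg (fun h => biprod.lift _ h) (biprod.inl_desc _ _)

/-- Both complexes carry the same upper triangular 3 × 3 differential, bracketed in two ways. -/
lemma nonempty_tw_assoc (x : Σ g : C2.Cocycle M.obj N.obj, C2.Cocycle (twP g).obj L.obj) :
    Nonempty ((twP (N := L) x.2).obj ≅ (twP (M := M) (cocycleAssoc M N L x).2).obj) :=
  ⟨C2.isoMk (M := C2.tw _) (N := C2.tw _)
    (biprod.associator (M.obj.X 1) (N.obj.X 1) (L.obj.X 1))
    (biprod.associator (M.obj.X 0) (N.obj.X 0) (L.obj.X 0))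
    (ofComponents_associator _ _ _ _ _) (ofComponents_associator _ _ _ _ _)⟩

end Associativity

end HallAlgebra

/-! ### Associativity, and products with K_P and K_P^*. -/

section TorusAction

set_option linter.unusedSectionVars false

variable (k : Type w) [Field k] [Finite k] {𝒜 : Type u} [Category.{v} 𝒜] [Abelian 𝒜] [Linear k 𝒜]
  [∀ X Y : 𝒜, Finite (X ⟶ Y)]

lemma TwHallC2P.cls_congr {M N : C2P 𝒜} (e : Nonempty (M.obj ≅ N.obj)) :
    TwHallC2P.cls k M = TwHallC2P.cls k N :=
  congrArg (ConstAlg.basisElt _ _) ((isoClass_eq_iff M N).2 e)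

lemma homDim_biprod_left (X Y Z : 𝒜) : homDim k (X ⊞ Y) Z = homDim k X Z + homDim k Y Z := by
  have : ∀ X Y : 𝒜, Module.Finite k (X ⟶ Y) := fun _ _ => Module.Finite.of_finite
  unfold homDim
  rw [← Nat.cast_add, ← Module.finrank_prod]
  refine congrArg Nat.cast (LinearEquiv.finrank_eq
    { toFun := fun f => (biprod.inl ≫ f, biprod.inr ≫ f)
      invFun := fun f => biprod.desc f.1 f.2
      map_add' := by simp
      map_smul' := by simp
      left_inv := fun f => by simp [desc_inl_inr]
      right_inv := fun f => by simp })

lemma homDim_biprod_right (X Y Z : 𝒜) : homDim k X (Y ⊞ Z) = homDim k X Y + homDim k X Z := by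
  have : ∀ X Y : 𝒜, Module.Finite k (X ⟶ Y) := fun _ _ => Module.Finite.of_finite
  unfold homDim
  rw [← Nat.cast_add, ← Module.finrank_prod]
  refine congrArg Nat.cast (LinearEquiv.finrank_eq
    { toFun := fun f => (f ≫ biprod.fst, f ≫ biprod.snd)
      invFun := fun f => biprod.lift f.1 f.2
      map_add' := by simp
      map_smul' := by simp
      left_inv := fun f => by simp [lift_fst_snd]
      right_inv := fun f => by simp })

lemma homDim_zero_left {Z : 𝒜} (h : IsZero Z) (X : 𝒜) : homDim k Z X = 0 := by
  have : Subsingleton (Z ⟶ X) := ⟨h.eq_of_src⟩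
  simp [homDim, Module.finrank_zero_of_subsingleton]

lemma homDim_zero_right {Z : 𝒜} (h : IsZero Z) (X : 𝒜) : homDim k X Z = 0 := by
  have : Subsingleton (X ⟶ Z) := ⟨h.eq_of_tgt⟩
  simp [homDim, Module.finrank_zero_of_subsingleton]

lemma homDim₂_tw_left {M N : C2 𝒜} (g : C2.Cocycle M N) (L : C2 𝒜) :
    homDim₂ k (C2.tw g) L = homDim₂ k M L + homDim₂ k N L := by
  have h₀ : homDim k ((C2.tw g).X 0) (L.X 0) = _ := homDim_biprod_left k (M.X 0) (N.X 0) _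
  have h₁ : homDim k ((C2.tw g).X 1) (L.X 1) = _ := homDim_biprod_left k (M.X 1) (N.X 1) _
  unfold homDim₂
  rw [h₀, h₁]
  ring

lemma homDim₂_tw_right {M N : C2 𝒜} (g : C2.Cocycle M N) (L : C2 𝒜) :
    homDim₂ k L (C2.tw g) = homDim₂ k L M + homDim₂ k L N := by
  have h₀ : homDim k (L.X 0) ((C2.tw g).X 0) = _ := homDim_biprod_right k _ (M.X 0) (N.X 0)
  have h₁ : homDim k (L.X 1) ((C2.tw g).X 1) = _ := homDim_biprod_right k _ (M.X 1) (N.X 1)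
  unfold homDim₂
  rw [h₀, h₁]
  ring

/-- Both bracketings sum over the same triangular data through `cocycleAssoc`, and the exponents
agree because `homDim₂` is additive on twisted sums. -/
theorem TwHallC2P.mul_assoc (x y z : TwHallC2P k 𝒜) : x * y * z = x * (y * z) := by
  refine ConstAlg.mul_assoc_of_basis (fun a b c => ?_) x y z
  induction a using Quotient.inductionOn with | h M =>
  induction b using Quotient.inductionOn with | h N =>
  induction c using Quotient.inductionOn with | h L =>
  change cls k M * cls k N * cls k L = cls k M * (cls k N * cls k L)
  rw [cls_mul_cls, cls_mul_cls k N, smul_mul_assoc, mul_smul_comm, Finset.sum_mul, Finset.mul_sum]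
  simp only [cls_mul_cls]
  have h1 : ∀ g : C2.Cocycle M.obj N.obj, homDim₂ k (twP g).obj L.obj =
      homDim₂ k M.obj L.obj + homDim₂ k N.obj L.obj := fun g => homDim₂_tw_left k g _
  have h2 : ∀ g : C2.Cocycle N.obj L.obj, homDim₂ k M.obj (twP g).obj =
      homDim₂ k M.obj N.obj + homDim₂ k M.obj L.obj := fun g => homDim₂_tw_right k g _
  simp only [h1, h2, ← Finset.smul_sum, smul_smul, ← tt_add]
  congr 1
  · congr 1
    ring
  · rw [← Fintype.sum_sigma' (fun (g : C2.Cocycle M.obj N.obj)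
      (h : C2.Cocycle (twP g).obj L.obj) => cls k (twP (N := L) h)),
      ← Fintype.sum_sigma' (fun (g : C2.Cocycle N.obj L.obj)
      (h : C2.Cocycle M.obj (twP g).obj) => cls k (twP (M := M) h))]
    exact Fintype.sum_equiv (cocycleAssoc M N L) _ _ fun x => cls_congr k (nonempty_tw_assoc x)

variable {M : C2P 𝒜}

lemma TwHallC2P.cls_mul_cls_of_split {M N : C2P 𝒜}
    (h : ∀ g : C2.Cocycle M.obj N.obj, Nonempty (C2.tw g ≅ C2.tw (0 : C2.Cocycle M.obj N.obj)))
    {n : ℤ} (hn : (Nat.card (C2.Cocycle M.obj N.obj) : ℂ) = tt k ^ n) :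
    cls k M * cls k N = tt k ^ (n - homDim₂ k M.obj N.obj) • cls k (dsum M N) := by
  have : ∀ g : C2.Cocycle M.obj N.obj, cls k (twP g) = cls k (dsum M N) :=
    fun g => cls_congr k (h g)
  rw [cls_mul_cls]
  simp only [this, Finset.sum_const, Finset.card_univ, ← Nat.card_eq_fintype_card]
  rw [← Nat.cast_smul_eq_nsmul ℂ, hn, smul_smul, ← tt_add]
  congr 2
  ring

variable (P : 𝒜) [Projective P] (M)

/-- `⟨P, M₀⟩ - ⟨P, M₁⟩`. -/
def chiL (M : C2 𝒜) : ℤ := homDim k P (M.X 0) - homDim k P (M.X 1)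

/-- `⟨M₀, P⟩ - ⟨M₁, P⟩`. -/
def chiR (M : C2 𝒜) : ℤ := homDim k (M.X 0) P - homDim k (M.X 1) P

/-- Since K_P is contractible, every cocycle is a boundary and is determined by one free component,
here P ⟶ M₀. The exponent is 2⟨P, M₀⟩ - (⟨P, M₀⟩ + ⟨P, M₁⟩). The three companions differ only in
which component is free. -/
theorem TwHallC2P.complexK_mul : cls k (complexK P) * cls k M =
    tt k ^ chiL k P M.obj • cls k (dsum M (complexK P)) := by
  rw [cls_mul_cls_of_split k (n := 2 * homDim k P (M.obj.X 0)),
    cls_congr k (nonempty_dsum_comm (complexK P) M)]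
  · congr 2
    change 2 * homDim k P (M.obj.X 0) - (homDim k P (M.obj.X 0) + homDim k P (M.obj.X 1)) = _
    unfold chiL
    ring
  · rintro ⟨⟨g₁, g₀⟩, h, h'⟩
    change P ⟶ M.obj.X 0 at g₁
    change P ⟶ M.obj.X 1 at g₀
    change 𝟙 P ≫ g₀ + g₁ ≫ M.obj.d 0 1 = 0 at h
    rw [Category.id_comp] at h
    -- The differential of K_P is the identity, so the homotopy `-g₁` removes `g₁`; the cocycle
    -- condition then says that it removes `g₀` as well.
    refine ⟨C2.twIso _ _ 0 (-g₁) ?_ ?_⟩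
    · change (0 : P ⟶ M.obj.X 0) = g₁ + 𝟙 P ≫ (-g₁) - (0 : P ⟶ M.obj.X 1) ≫ M.obj.d 1 0
      simp
    · change (0 : P ⟶ M.obj.X 1) = g₀ + (0 : P ⟶ P) ≫ (0 : P ⟶ M.obj.X 1) - (-g₁) ≫ M.obj.d 0 1
      simpa using h.symm
  · rw [← card_hom]
    congr 1
    refine Nat.card_eq_of_bijective (fun g => g.1.1) ⟨?_, ?_⟩
    · rintro ⟨⟨g₁, g₀⟩, h, h'⟩ ⟨⟨f₁, f₀⟩, e, e'⟩ (rfl : g₁ = f₁)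
      change P ⟶ M.obj.X 0 at g₁
      change P ⟶ M.obj.X 1 at g₀ f₀
      change 𝟙 P ≫ g₀ + g₁ ≫ M.obj.d 0 1 = 0 at h
      change 𝟙 P ≫ f₀ + g₁ ≫ M.obj.d 0 1 = 0 at e
      have := h.trans e.symm
      simp only [Category.id_comp, add_left_inj] at this
      obtain rfl := this
      rfl
    · intro g₁
      change P ⟶ M.obj.X 0 at g₁
      refine ⟨⟨(g₁, -g₁ ≫ M.obj.d 0 1), ?_, ?_⟩, rfl⟩
      · change 𝟙 P ≫ (-g₁ ≫ M.obj.d 0 1) + g₁ ≫ M.obj.d 0 1 = 0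
        simp
      · change (0 : P ⟶ P) ≫ g₁ + (-g₁ ≫ M.obj.d 0 1) ≫ M.obj.d 1 0 = 0
        simp

theorem TwHallC2P.mul_complexK : cls k M * cls k (complexK P) =
    tt k ^ (-chiR k P M.obj) • cls k (dsum M (complexK P)) := by
  rw [cls_mul_cls_of_split k (n := 2 * homDim k (M.obj.X 1) P)]
  · congr 2
    change 2 * homDim k (M.obj.X 1) P - (homDim k (M.obj.X 0) P + homDim k (M.obj.X 1) P) = _
    unfold chiR
    ring
  · rintro ⟨⟨g₁, g₀⟩, h, h'⟩
    change M.obj.X 1 ⟶ P at g₁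
    change M.obj.X 0 ⟶ P at g₀
    change M.obj.d 0 1 ≫ g₁ + g₀ ≫ 𝟙 P = 0 at h'
    refine ⟨C2.twIso _ _ g₁ 0 ?_ ?_⟩
    · change (0 : M.obj.X 1 ⟶ P) = g₁ + M.obj.d 1 0 ≫ (0 : M.obj.X 0 ⟶ P) - g₁ ≫ 𝟙 P
      simp
    · change (0 : M.obj.X 0 ⟶ P) = g₀ + M.obj.d 0 1 ≫ g₁ - (0 : M.obj.X 0 ⟶ P) ≫ (0 : P ⟶ P)
      simpa [add_comm] using h'.symm
  · rw [← card_hom]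
    congr 1
    refine Nat.card_eq_of_bijective (fun g => g.1.1) ⟨?_, ?_⟩
    · rintro ⟨⟨g₁, g₀⟩, h, h'⟩ ⟨⟨f₁, f₀⟩, e, e'⟩ (rfl : g₁ = f₁)
      change M.obj.X 1 ⟶ P at g₁
      change M.obj.X 0 ⟶ P at g₀ f₀
      change M.obj.d 0 1 ≫ g₁ + g₀ ≫ 𝟙 P = 0 at h'
      change M.obj.d 0 1 ≫ g₁ + f₀ ≫ 𝟙 P = 0 at e'
      have := h'.trans e'.symm
      simp only [Category.comp_id, add_right_inj] at this
      obtain rfl := this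
      rfl
    · intro g₁
      change M.obj.X 1 ⟶ P at g₁
      refine ⟨⟨(g₁, -M.obj.d 0 1 ≫ g₁), ?_, ?_⟩, rfl⟩
      · change M.obj.d 1 0 ≫ (-M.obj.d 0 1 ≫ g₁) + g₁ ≫ (0 : P ⟶ P) = 0
        simp
      · change M.obj.d 0 1 ≫ g₁ + (-M.obj.d 0 1 ≫ g₁) ≫ 𝟙 P = 0
        simp

theorem TwHallC2P.complexKstar_mul : cls k (complexKstar P) * cls k M =
    tt k ^ (-chiL k P M.obj) • cls k (dsum M (complexKstar P)) := by
  rw [cls_mul_cls_of_split k (n := 2 * homDim k P (M.obj.X 1)),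
    cls_congr k (nonempty_dsum_comm (complexKstar P) M)]
  · congr 2
    change 2 * homDim k P (M.obj.X 1) - (homDim k P (M.obj.X 0) + homDim k P (M.obj.X 1)) = _
    unfold chiL
    ring
  · rintro ⟨⟨g₁, g₀⟩, h, h'⟩
    change P ⟶ M.obj.X 0 at g₁
    change P ⟶ M.obj.X 1 at g₀
    change 𝟙 P ≫ g₁ + g₀ ≫ M.obj.d 1 0 = 0 at h'
    rw [Category.id_comp] at h'
    refine ⟨C2.twIso _ _ (-g₀) 0 ?_ ?_⟩
    · change (0 : P ⟶ M.obj.X 0) = g₁ + (0 : P ⟶ P) ≫ (0 : P ⟶ M.obj.X 0) - (-g₀) ≫ M.obj.d 1 0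
      simpa using h'.symm
    · change (0 : P ⟶ M.obj.X 1) = g₀ + 𝟙 P ≫ (-g₀) - (0 : P ⟶ M.obj.X 0) ≫ M.obj.d 0 1
      simp
  · rw [← card_hom]
    congr 1
    refine Nat.card_eq_of_bijective (fun g => g.1.2) ⟨?_, ?_⟩
    · rintro ⟨⟨g₁, g₀⟩, h, h'⟩ ⟨⟨f₁, f₀⟩, e, e'⟩ (rfl : g₀ = f₀)
      change P ⟶ M.obj.X 0 at g₁ f₁
      change P ⟶ M.obj.X 1 at g₀
      change 𝟙 P ≫ g₁ + g₀ ≫ M.obj.d 1 0 = 0 at h'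
      change 𝟙 P ≫ f₁ + g₀ ≫ M.obj.d 1 0 = 0 at e'
      have := h'.trans e'.symm
      simp only [Category.id_comp, add_left_inj] at this
      obtain rfl := this
      rfl
    · intro g₀
      change P ⟶ M.obj.X 1 at g₀
      refine ⟨⟨(-g₀ ≫ M.obj.d 1 0, g₀), ?_, ?_⟩, rfl⟩
      · change (0 : P ⟶ P) ≫ g₀ + (-g₀ ≫ M.obj.d 1 0) ≫ M.obj.d 0 1 = 0
        simp
      · change 𝟙 P ≫ (-g₀ ≫ M.obj.d 1 0) + g₀ ≫ M.obj.d 1 0 = 0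
        simp

theorem TwHallC2P.mul_complexKstar : cls k M * cls k (complexKstar P) =
    tt k ^ chiR k P M.obj • cls k (dsum M (complexKstar P)) := by
  rw [cls_mul_cls_of_split k (n := 2 * homDim k (M.obj.X 0) P)]
  · congr 2
    change 2 * homDim k (M.obj.X 0) P - (homDim k (M.obj.X 0) P + homDim k (M.obj.X 1) P) = _
    unfold chiR
    ring
  · rintro ⟨⟨g₁, g₀⟩, h, h'⟩
    change M.obj.X 1 ⟶ P at g₁
    change M.obj.X 0 ⟶ P at g₀
    change M.obj.d 1 0 ≫ g₀ + g₁ ≫ 𝟙 P = 0 at h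
    refine ⟨C2.twIso _ _ 0 g₀ ?_ ?_⟩
    · change (0 : M.obj.X 1 ⟶ P) = g₁ + M.obj.d 1 0 ≫ g₀ - (0 : M.obj.X 1 ⟶ P) ≫ (0 : P ⟶ P)
      simpa [add_comm] using h.symm
    · change (0 : M.obj.X 0 ⟶ P) = g₀ + M.obj.d 0 1 ≫ (0 : M.obj.X 1 ⟶ P) - g₀ ≫ 𝟙 P
      simp
  · rw [← card_hom]
    congr 1
    refine Nat.card_eq_of_bijective (fun g => g.1.2) ⟨?_, ?_⟩
    · rintro ⟨⟨g₁, g₀⟩, h, h'⟩ ⟨⟨f₁, f₀⟩, e, e'⟩ (rfl : g₀ = f₀)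
      change M.obj.X 1 ⟶ P at g₁ f₁
      change M.obj.X 0 ⟶ P at g₀
      change M.obj.d 1 0 ≫ g₀ + g₁ ≫ 𝟙 P = 0 at h
      change M.obj.d 1 0 ≫ g₀ + f₁ ≫ 𝟙 P = 0 at e
      have := h.trans e.symm
      simp only [Category.comp_id, add_right_inj] at this
      obtain rfl := this
      rfl
    · intro g₀
      change M.obj.X 0 ⟶ P at g₀
      refine ⟨⟨(-M.obj.d 1 0 ≫ g₀, g₀), ?_, ?_⟩, rfl⟩
      · change M.obj.d 1 0 ≫ g₀ + (-M.obj.d 1 0 ≫ g₀) ≫ 𝟙 P = 0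
        simp
      · change M.obj.d 0 1 ≫ (-M.obj.d 1 0 ≫ g₀) + g₀ ≫ (0 : P ⟶ P) = 0
        simp

end TorusAction

/-! ### Units of DH(𝒜) and their commutation rules. -/

section Localised

section Loc

variable (H : Type u) [NonUnitalNonAssocRing H] [One H] [Module ℂ H] (S : Set H)

/-- The canonical map to the universal localisation, as a linear map. -/
def Loc.ofLinear : H →ₗ[ℂ] Loc H S where
  toFun := Loc.of H S
  map_add' x y := (RingQuot.mkAlgHom_rel ℂ (LocRel.add x y)).trans (map_add _ _ _)
  map_smul' c x := (RingQuot.mkAlgHom_rel ℂ (LocRel.smul c x)).trans (map_smul _ _ _)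

lemma Loc.of_mul (x y : H) : Loc.of H S (x * y) = Loc.of H S x * Loc.of H S y :=
  (RingQuot.mkAlgHom_rel ℂ (LocRel.mul x y)).trans (map_mul _ _ _)

lemma Loc.of_one : Loc.of H S 1 = 1 :=
  (RingQuot.mkAlgHom_rel ℂ (LocRel.one (S := S))).trans (map_one _)

/-- The unit of the localisation defined by an element of `S`. -/
def Loc.unit (s : S) : (Loc H S)ˣ where
  val := Loc.of H S s
  inv := RingQuot.mkAlgHom ℂ (LocRel H S) (FreeAlgebra.ι ℂ (Sum.inr s))
  val_inv := by
    refine (map_mul _ _ _).symm.trans ((RingQuot.mkAlgHom_rel ℂ (LocRel.mul_inv s)).trans ?_)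
    exact map_one _
  inv_val := by
    refine (map_mul _ _ _).symm.trans ((RingQuot.mkAlgHom_rel ℂ (LocRel.inv_mul s)).trans ?_)
    exact map_one _

end Loc

variable {𝒜 : Type u} [Category.{v} 𝒜] [Abelian 𝒜]

lemma C2.acyclic_iff (M : C2 𝒜) : M.Acyclic ↔
    (ShortComplex.mk _ _ M.d_zero_one_zero).Exact ∧
      (ShortComplex.mk _ _ M.d_one_zero_one).Exact := by
  have r₁ : (ComplexShape.up (ZMod 2)).Rel 0 1 := by decide
  have r₀ : (ComplexShape.up (ZMod 2)).Rel 1 0 := by decide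
  have e₁ := M.exactAt_iff' 0 1 0 ((ComplexShape.up (ZMod 2)).prev_eq' r₁)
    ((ComplexShape.up (ZMod 2)).next_eq' r₀)
  have e₀ := M.exactAt_iff' 1 0 1 ((ComplexShape.up (ZMod 2)).prev_eq' r₀)
    ((ComplexShape.up (ZMod 2)).next_eq' r₁)
  exact ⟨fun h => ⟨e₁.1 (h 1), e₀.1 (h 0)⟩, fun h => forall_zmod_two (e₁.2 h.1) (e₀.2 h.2)⟩

lemma complexK_acyclic (P : 𝒜) [Projective P] : (complexK P).obj.Acyclic := by
  rw [C2.acyclic_iff]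
  constructor
  · change (ShortComplex.mk (0 : P ⟶ P) (𝟙 P) zero_comp).Exact
    exact (ShortComplex.exact_iff_mono _ rfl).2 (inferInstanceAs (Mono (𝟙 P)))
  · change (ShortComplex.mk (𝟙 P) (0 : P ⟶ P) comp_zero).Exact
    exact (ShortComplex.exact_iff_epi _ rfl).2 (inferInstanceAs (Epi (𝟙 P)))

lemma complexKstar_acyclic (P : 𝒜) [Projective P] : (complexKstar P).obj.Acyclic := by
  rw [C2.acyclic_iff]
  constructor
  · change (ShortComplex.mk (𝟙 P) (0 : P ⟶ P) comp_zero).Exact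
    exact (ShortComplex.exact_iff_epi _ rfl).2 (inferInstanceAs (Epi (𝟙 P)))
  · change (ShortComplex.mk (0 : P ⟶ P) (𝟙 P) zero_comp).Exact
    exact (ShortComplex.exact_iff_mono _ rfl).2 (inferInstanceAs (Mono (𝟙 P)))

variable (k : Type w) [Field k] [Linear k 𝒜]

namespace DH

/-- The canonical linear map from `H_tw(C₂(𝒫))` to `DH(𝒜)`. -/
def ofLinear : TwHallC2P k 𝒜 →ₗ[ℂ] DH k 𝒜 := Loc.ofLinear _ _

lemma ofLinear_mul (x y : TwHallC2P k 𝒜) :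
    ofLinear k (x * y) = ofLinear k x * ofLinear k y :=
  Loc.of_mul _ _ x y

lemma ofLinear_one : ofLinear k (1 : TwHallC2P k 𝒜) = 1 := Loc.of_one _ _

/-- The unit of `DH(𝒜)` defined by an acyclic complex. -/
def unit (M : C2P 𝒜) (hM : M.obj.Acyclic) : (DH k 𝒜)ˣ :=
  Loc.unit _ _ ⟨TwHallC2P.cls k M, M, hM, rfl⟩

/-- The unit `[K_P]`. -/
def uK (P : 𝒜) [Projective P] : (DH k 𝒜)ˣ := unit k (complexK P) (complexK_acyclic P)

/-- The unit `[K_P^*]`. -/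
def uKs (P : 𝒜) [Projective P] : (DH k 𝒜)ˣ := unit k (complexKstar P) (complexKstar_acyclic P)

@[simp] lemma coe_uK (P : 𝒜) [Projective P] : (uK k P : DH k 𝒜) = cls k (complexK P) := rfl

@[simp] lemma coe_uKs (P : 𝒜) [Projective P] : (uKs k P : DH k 𝒜) = cls k (complexKstar P) := rfl

variable [Finite k] [∀ X Y : 𝒜, Finite (X ⟶ Y)]

lemma cls_congr {M N : C2P 𝒜} (e : Nonempty (M.obj ≅ N.obj)) : cls k M = cls k N :=
  congrArg (ofLinear k) (TwHallC2P.cls_congr k e)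

lemma cls_mul_cls (M N : C2P 𝒜) : cls k M * cls k N = tt k ^ (-homDim₂ k M.obj N.obj) •
    ∑ g : C2.Cocycle M.obj N.obj, cls k (twP g) := by
  have := congrArg (ofLinear k) (TwHallC2P.cls_mul_cls k M N)
  rwa [ofLinear_mul, map_smul, map_sum] at this

variable (P : 𝒜) [Projective P] (M : C2P 𝒜)

lemma uK_mul : (uK k P : DH k 𝒜) * cls k M =
    tt k ^ chiL k P M.obj • cls k (dsum M (complexK P)) := by
  have := congrArg (ofLinear k) (TwHallC2P.complexK_mul k M P)
  rwa [ofLinear_mul, map_smul] at this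

lemma mul_uK : cls k M * (uK k P : DH k 𝒜) =
    tt k ^ (-chiR k P M.obj) • cls k (dsum M (complexK P)) := by
  have := congrArg (ofLinear k) (TwHallC2P.mul_complexK k M P)
  rwa [ofLinear_mul, map_smul] at this

lemma uKs_mul : (uKs k P : DH k 𝒜) * cls k M =
    tt k ^ (-chiL k P M.obj) • cls k (dsum M (complexKstar P)) := by
  have := congrArg (ofLinear k) (TwHallC2P.complexKstar_mul k M P)
  rwa [ofLinear_mul, map_smul] at this

lemma mul_uKs : cls k M * (uKs k P : DH k 𝒜) =
    tt k ^ chiR k P M.obj • cls k (dsum M (complexKstar P)) := by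
  have := congrArg (ofLinear k) (TwHallC2P.mul_complexKstar k M P)
  rwa [ofLinear_mul, map_smul] at this

variable {P M}

lemma cls_dsum_complexK : cls k (dsum M (complexK P)) =
    tt k ^ (-chiL k P M.obj) • ((uK k P : DH k 𝒜) * cls k M) := by
  rw [uK_mul, smul_smul, ← tt_add, neg_add_cancel, zpow_zero, one_smul]

lemma cls_dsum_complexKstar : cls k (dsum M (complexKstar P)) =
    tt k ^ chiL k P M.obj • ((uKs k P : DH k 𝒜) * cls k M) := by
  rw [uKs_mul, smul_smul, ← tt_add, add_neg_cancel, zpow_zero, one_smul]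

lemma cls_mul_uK : cls k M * (uK k P : DH k 𝒜) =
    tt k ^ (-(chiL k P M.obj + chiR k P M.obj)) • ((uK k P : DH k 𝒜) * cls k M) := by
  rw [mul_uK, cls_dsum_complexK, smul_smul, ← tt_add]
  congr 2
  ring

lemma cls_mul_uKs : cls k M * (uKs k P : DH k 𝒜) =
    tt k ^ (chiL k P M.obj + chiR k P M.obj) • ((uKs k P : DH k 𝒜) * cls k M) := by
  rw [mul_uKs, cls_dsum_complexKstar, smul_smul, ← tt_add]
  congr 2
  ring

lemma mul_unit_inv_of_mul_unit {D : Type*} [Ring D] [Algebra ℂ D] {x : D} {u : Dˣ} {c : ℂ}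
    (hc : c ≠ 0) (h : x * u = c • (u * x)) : x * (u⁻¹ : Dˣ) = c⁻¹ • ((u⁻¹ : Dˣ) * x) := by
  rw [Units.mul_inv_eq_iff_eq_mul, smul_mul_assoc, mul_assoc, h, mul_smul_comm, smul_smul,
    inv_mul_cancel₀ hc, one_smul, Units.inv_mul_cancel_left]

lemma cls_mul_uK_inv : cls k M * ((uK k P)⁻¹ : (DH k 𝒜)ˣ) =
    tt k ^ (chiL k P M.obj + chiR k P M.obj) • (((uK k P)⁻¹ : (DH k 𝒜)ˣ) * cls k M) := by
  rw [mul_unit_inv_of_mul_unit (zpow_ne_zero _ (tt_ne_zero k)) (cls_mul_uK k), ← zpow_neg, neg_neg]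

lemma cls_mul_uKs_inv : cls k M * ((uKs k P)⁻¹ : (DH k 𝒜)ˣ) =
    tt k ^ (-(chiL k P M.obj + chiR k P M.obj)) • (((uKs k P)⁻¹ : (DH k 𝒜)ˣ) * cls k M) := by
  rw [mul_unit_inv_of_mul_unit (zpow_ne_zero _ (tt_ne_zero k)) (cls_mul_uKs k), ← zpow_neg]

variable (P) (Q : 𝒜) [Projective Q]

/-- The commutation exponent is a difference between the two components of the complex, and those of
K_P coincide. The same vanishing gives the other commutation rules and makes the units
multiplicative in P. -/
lemma uK_comm_uK : Commute (uK k P) (uK k Q) := by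
  refine Units.ext ?_
  have h := cls_mul_uK k (M := complexK P) (P := Q)
  have h₁ : chiL k Q (complexK P).obj = 0 := sub_self _
  have h₂ : chiR k Q (complexK P).obj = 0 := sub_self _
  rw [h₁, h₂, add_zero, neg_zero, zpow_zero, one_smul] at h
  exact h

lemma uKs_comm_uK : Commute (uKs k P) (uK k Q) := by
  refine Units.ext ?_
  have h := cls_mul_uK k (M := complexKstar P) (P := Q)
  have h₁ : chiL k Q (complexKstar P).obj = 0 := sub_self _
  have h₂ : chiR k Q (complexKstar P).obj = 0 := sub_self _
  rw [h₁, h₂, add_zero, neg_zero, zpow_zero, one_smul] at h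
  exact h

lemma uKs_comm_uKs : Commute (uKs k P) (uKs k Q) := by
  refine Units.ext ?_
  have h := cls_mul_uKs k (M := complexKstar P) (P := Q)
  have h₁ : chiL k Q (complexKstar P).obj = 0 := sub_self _
  have h₂ : chiR k Q (complexKstar P).obj = 0 := sub_self _
  rw [h₁, h₂, add_zero, zpow_zero, one_smul] at h
  exact h

lemma uK_biprod : uK k (P ⊞ Q) = uK k P * uK k Q := by
  refine Units.ext ?_
  have h := mul_uK k Q (complexK P)
  have h₂ : chiR k Q (complexK P).obj = 0 := sub_self _
  rw [h₂, neg_zero, zpow_zero, one_smul] at h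
  refine Eq.trans (cls_congr k ⟨C2.isoMk (M := (complexK (P ⊞ Q)).obj)
    (N := (dsum (complexK P) (complexK Q)).obj)
    (Iso.refl (P ⊞ Q)) (Iso.refl (P ⊞ Q)) ?_ ?_⟩) h.symm
  · change 𝟙 (P ⊞ Q) ≫ 𝟙 (P ⊞ Q) = 𝟙 (P ⊞ Q) ≫ Biprod.ofComponents (𝟙 P) 0 0 (𝟙 Q)
    rw [ofComponents_id_id]
  · change 0 ≫ 𝟙 (P ⊞ Q) = 𝟙 (P ⊞ Q) ≫ Biprod.ofComponents (0 : P ⟶ P) 0 0 (0 : Q ⟶ Q)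
    rw [ofComponents_zero]
    simp

lemma uKs_biprod : uKs k (P ⊞ Q) = uKs k P * uKs k Q := by
  refine Units.ext ?_
  have h := mul_uKs k Q (complexKstar P)
  have h₂ : chiR k Q (complexKstar P).obj = 0 := sub_self _
  rw [h₂, zpow_zero, one_smul] at h
  refine Eq.trans (cls_congr k ⟨C2.isoMk (M := (complexKstar (P ⊞ Q)).obj)
    (N := (dsum (complexKstar P) (complexKstar Q)).obj)
    (Iso.refl (P ⊞ Q)) (Iso.refl (P ⊞ Q)) ?_ ?_⟩) h.symm
  · change 0 ≫ 𝟙 (P ⊞ Q) = 𝟙 (P ⊞ Q) ≫ Biprod.ofComponents (0 : P ⟶ P) 0 0 (0 : Q ⟶ Q)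
    rw [ofComponents_zero]
    simp
  · change 𝟙 (P ⊞ Q) ≫ 𝟙 (P ⊞ Q) = 𝟙 (P ⊞ Q) ≫ Biprod.ofComponents (𝟙 P) 0 0 (𝟙 Q)
    rw [ofComponents_id_id]

variable {P Q}

lemma uK_congr (e : P ≅ Q) : uK k P = uK k Q := by
  refine Units.ext (cls_congr k ⟨C2.isoMk (M := (complexK P).obj) (N := (complexK Q).obj) e e
    ?_ ?_⟩)
  · change 𝟙 P ≫ e.hom = e.hom ≫ 𝟙 Q
    simp
  · change (0 : P ⟶ P) ≫ e.hom = e.hom ≫ (0 : Q ⟶ Q)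
    simp

lemma uKs_congr (e : P ≅ Q) : uKs k P = uKs k Q := by
  refine Units.ext (cls_congr k ⟨C2.isoMk (M := (complexKstar P).obj) (N := (complexKstar Q).obj)
    e e ?_ ?_⟩)
  · change (0 : P ⟶ P) ≫ e.hom = e.hom ≫ (0 : Q ⟶ Q)
    simp
  · change 𝟙 P ≫ e.hom = e.hom ≫ 𝟙 Q
    simp

end DH

end Localised

/-! ### Projective resolutions of length two and Euler forms. -/

section Resolutions

set_option linter.unusedSectionVars false

lemma finrank_of_exact_sequence (k : Type w) [Field k] {V₂ V₁ V₀ W : Type*} [AddCommGroup V₂]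
    [AddCommGroup V₁] [AddCommGroup V₀] [AddCommGroup W] [Module k V₂] [Module k V₁] [Module k V₀]
    [Module k W] [Module.Finite k V₂] [Module.Finite k V₁] [Module.Finite k V₀]
    (f₂ : V₂ →ₗ[k] V₁) (f₁ : V₁ →ₗ[k] V₀) (f₀ : V₀ →ₗ[k] W) (h₂ : ∀ x, f₂ x = 0 → x = 0)
    (z₁ : ∀ x, f₁ (f₂ x) = 0) (h₁ : ∀ x, f₁ x = 0 → ∃ y, f₂ y = x)
    (z₀ : ∀ x, f₀ (f₁ x) = 0) (h₀ : ∀ x, f₀ x = 0 → ∃ y, f₁ y = x) (hs : ∀ x, ∃ y, f₀ y = x) :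
    (Module.finrank k W : ℤ) =
      Module.finrank k V₀ - Module.finrank k V₁ + Module.finrank k V₂ := by
  have e₁ : f₁.ker = f₂.range := by
    ext x
    exact ⟨h₁ x, by rintro ⟨y, rfl⟩; exact z₁ y⟩
  have e₀ : f₀.ker = f₁.range := by
    ext x
    exact ⟨h₀ x, by rintro ⟨y, rfl⟩; exact z₀ y⟩
  have n₂ := f₂.finrank_range_add_finrank_ker
  have n₁ := f₁.finrank_range_add_finrank_ker
  have n₀ := f₀.finrank_range_add_finrank_ker
  rw [LinearMap.range_eq_top.2 hs, finrank_top, e₀] at n₀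
  rw [e₁] at n₁
  rw [LinearMap.ker_eq_bot'.2 h₂, finrank_bot] at n₂
  omega

variable {𝒜 : Type u} [Category.{v} 𝒜] [Abelian 𝒜]

/-- Exactness may be tested after refining the test object, and with enough projectives the
refinement can be taken projective. Every resolution constructed below is verified by such lifting
properties. -/
lemma exact_of_projective_lift [EnoughProjectives 𝒜] {X Y Z : 𝒜} (f : X ⟶ Y) (g : Y ⟶ Z)
    (w : f ≫ g = 0)
    (h : ∀ (T : 𝒜) [Projective T] (y : T ⟶ Y), y ≫ g = 0 → ∃ x : T ⟶ X, x ≫ f = y) :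
    (ShortComplex.mk f g w).Exact := by
  rw [ShortComplex.exact_iff_exact_up_to_refinements]
  intro T y hy
  obtain ⟨x, hx⟩ := h (Projective.over T) (Projective.π T ≫ y) (by
    have : y ≫ g = 0 := hy
    rw [Category.assoc, this, comp_zero])
  exact ⟨Projective.over T, Projective.π T, inferInstance, x, hx.symm⟩

lemma mono_of_projective [EnoughProjectives 𝒜] {X Y : 𝒜} (f : X ⟶ Y)
    (h : ∀ (T : 𝒜) [Projective T] (x : T ⟶ X), x ≫ f = 0 → x = 0) : Mono f := by
  refine Preadditive.mono_of_cancel_zero f fun {T} x hx => ?_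
  rw [← cancel_epi (Projective.π T), comp_zero]
  exact h _ _ (by rw [Category.assoc, hx, comp_zero])

lemma epi_of_projective_lift [EnoughProjectives 𝒜] {X Y : 𝒜} (f : X ⟶ Y)
    (h : ∀ (T : 𝒜) [Projective T] (y : T ⟶ Y), ∃ x : T ⟶ X, x ≫ f = y) : Epi f := by
  obtain ⟨x, hx⟩ := h _ (Projective.π Y)
  exact epi_of_epi_fac hx

lemma exact_projective_lift {X Y Z T : 𝒜} [Projective T] {f : X ⟶ Y} {g : Y ⟶ Z} {w : f ≫ g = 0}
    (h : (ShortComplex.mk f g w).Exact) (y : T ⟶ Y) (hy : y ≫ g = 0) : ∃ x : T ⟶ X, x ≫ f = y :=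
  ⟨h.liftFromProjective y hy, h.liftFromProjective_comp y hy⟩

namespace ProjRes

variable {A : 𝒜}

/-- A projective resolution from lifting properties with respect to projective objects. -/
def ofLifting [EnoughProjectives 𝒜] (P₂ P₁ P₀ : 𝒜) [proj₂ : Projective P₂] [proj₁ : Projective P₁]
    [proj₀ : Projective P₀] (a₂ : P₂ ⟶ P₁) (a₁ : P₁ ⟶ P₀) (a₀ : P₀ ⟶ A) (comp₂₁ : a₂ ≫ a₁ = 0)
    (comp₁₀ : a₁ ≫ a₀ = 0)
    (h₂ : ∀ (T : 𝒜) [Projective T] (x : T ⟶ P₂), x ≫ a₂ = 0 → x = 0)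
    (h₁ : ∀ (T : 𝒜) [Projective T] (x : T ⟶ P₁), x ≫ a₁ = 0 → ∃ y : T ⟶ P₂, y ≫ a₂ = x)
    (h₀ : ∀ (T : 𝒜) [Projective T] (x : T ⟶ P₀), x ≫ a₀ = 0 → ∃ y : T ⟶ P₁, y ≫ a₁ = x)
    (h : ∀ (T : 𝒜) [Projective T] (x : T ⟶ A), ∃ y : T ⟶ P₀, y ≫ a₀ = x) : ProjRes A where
  P₂ := P₂
  P₁ := P₁
  P₀ := P₀
  proj₂ := proj₂
  proj₁ := proj₁
  proj₀ := proj₀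
  a₂ := a₂
  a₁ := a₁
  a₀ := a₀
  comp₂₁ := comp₂₁
  comp₁₀ := comp₁₀
  mono₂ := mono_of_projective _ h₂
  exact₁ := exact_of_projective_lift _ _ _ h₁
  exact₀ := exact_of_projective_lift _ _ _ h₀
  epi₀ := epi_of_projective_lift _ h

variable (R : ProjRes A)

attribute [instance] ProjRes.mono₂ ProjRes.epi₀

lemma lift₁ {T : 𝒜} [Projective T] (x : T ⟶ R.P₁) (hx : x ≫ R.a₁ = 0) :
    ∃ y : T ⟶ R.P₂, y ≫ R.a₂ = x :=
  exact_projective_lift R.exact₁ x hx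

lemma lift₀ {T : 𝒜} [Projective T] (x : T ⟶ R.P₀) (hx : x ≫ R.a₀ = 0) :
    ∃ y : T ⟶ R.P₁, y ≫ R.a₁ = x :=
  exact_projective_lift R.exact₀ x hx

lemma lift {T : 𝒜} [Projective T] (x : T ⟶ A) : ∃ y : T ⟶ R.P₀, y ≫ R.a₀ = x :=
  ⟨Projective.factorThru x R.a₀, Projective.factorThru_comp x R.a₀⟩

/-- The first syzygy. -/
def K : 𝒜 := kernel R.a₀

/-- The inclusion of the first syzygy. -/
def ι : R.K ⟶ R.P₀ := kernel.ι R.a₀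

/-- The projection to the first syzygy. -/
def π : R.P₁ ⟶ R.K := kernel.lift R.a₀ R.a₁ R.comp₁₀

instance : Mono R.ι := inferInstanceAs (Mono (kernel.ι R.a₀))

lemma π_ι : R.π ≫ R.ι = R.a₁ := kernel.lift_ι _ _ _

lemma ι_a₀ : R.ι ≫ R.a₀ = 0 := kernel.condition _

instance : Epi R.π := (ShortComplex.exact_iff_epi_kernel_lift _).1 R.exact₀

lemma a₂_π : R.a₂ ≫ R.π = 0 := by
  rw [← cancel_mono R.ι, Category.assoc, π_ι, R.comp₂₁, zero_comp]

lemma shortExact₀ : (ShortComplex.mk R.ι R.a₀ R.ι_a₀).ShortExact where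
  exact := ShortComplex.exact_kernel R.a₀
  mono_f := inferInstanceAs (Mono R.ι)
  epi_g := inferInstanceAs (Epi R.a₀)

lemma shortExact₁ : (ShortComplex.mk R.a₂ R.π R.a₂_π).ShortExact where
  exact := by
    have h := R.exact₁
    rw [ShortComplex.exact_iff_exact_up_to_refinements] at h ⊢
    intro T x hx
    refine h x ?_
    change x ≫ R.a₁ = 0
    rw [← π_ι, ← Category.assoc]
    have : x ≫ R.π = 0 := hx
    rw [this, zero_comp]
  mono_f := inferInstanceAs (Mono R.a₂)
  epi_g := inferInstanceAs (Epi R.π)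

/-- Each syzygy lowers the projective dimension by one, so the second syzygy is itself projective
and can end the resolution. -/
theorem nonempty_of_hasProjectiveDimensionLE [EnoughProjectives 𝒜] (A : 𝒜)
    [HasProjectiveDimensionLE A 2] : Nonempty (ProjRes A) := by
  have ses : ∀ X : 𝒜, (ShortComplex.mk (kernel.ι (Projective.π X)) (Projective.π X)
      (kernel.condition _)).ShortExact := fun X =>
    { exact := ShortComplex.exact_kernel _
      mono_f := inferInstanceAs (Mono (kernel.ι _))
      epi_g := inferInstanceAs (Epi (Projective.π X)) }
  let K := kernel (Projective.π A)
  have h₁ : HasProjectiveDimensionLT K 2 :=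
    (ses A).hasProjectiveDimensionLT_X₁ 2
      (inferInstanceAs (HasProjectiveDimensionLT (Projective.over A) 2))
      (inferInstanceAs (HasProjectiveDimensionLT A 3))
  have h₂ : HasProjectiveDimensionLT (kernel (Projective.π K)) 1 :=
    (ses K).hasProjectiveDimensionLT_X₁ 1
      (inferInstanceAs (HasProjectiveDimensionLT (Projective.over K) 1)) h₁
  have : Projective (kernel (Projective.π K)) := inferInstance
  refine ⟨ofLifting (kernel (Projective.π K)) (Projective.over K) (Projective.over A)
    (kernel.ι _) (Projective.π K ≫ kernel.ι _) (Projective.π A) ?_ ?_ ?_ ?_ ?_ ?_⟩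
  · simp
  · rw [Category.assoc, kernel.condition, comp_zero]
  · intro T _ x hx
    rwa [← cancel_mono (kernel.ι (Projective.π K)), zero_comp]
  · intro T _ x hx
    rw [← Category.assoc] at hx
    exact ⟨kernel.lift _ x (by rwa [← cancel_mono (kernel.ι (Projective.π A)), zero_comp]),
      kernel.lift_ι _ _ _⟩
  · intro T _ x hx
    refine ⟨Projective.factorThru (kernel.lift _ x hx) (Projective.π K), ?_⟩
    rw [← Category.assoc, Projective.factorThru_comp, kernel.lift_ι]
  · intro T _ x
    exact ⟨Projective.factorThru x _, Projective.factorThru_comp _ _⟩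

variable (k : Type w) [Field k] [Linear k 𝒜] [∀ X Y : 𝒜, Finite (X ⟶ Y)]

lemma homDim_eq (T : 𝒜) [Projective T] :
    homDim k T A = homDim k T R.P₀ - homDim k T R.P₁ + homDim k T R.P₂ := by
  have : ∀ X Y : 𝒜, Module.Finite k (X ⟶ Y) := fun _ _ => Module.Finite.of_finite
  refine finrank_of_exact_sequence k (Linear.rightComp k T R.a₂) (Linear.rightComp k T R.a₁)
    (Linear.rightComp k T R.a₀) ?_ ?_ ?_ ?_ ?_ ?_
  · intro x hx
    change x ≫ R.a₂ = 0 at hx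
    rwa [← cancel_mono R.a₂, zero_comp]
  · intro x
    change (x ≫ R.a₂) ≫ R.a₁ = 0
    rw [Category.assoc, R.comp₂₁, comp_zero]
  · intro x hx
    exact R.lift₁ x hx
  · intro x
    change (x ≫ R.a₁) ≫ R.a₀ = 0
    rw [Category.assoc, R.comp₁₀, comp_zero]
  · intro x hx
    exact R.lift₀ x hx
  · intro x
    exact R.lift x

universe w'

section Euler

open Abelian

variable [HasExt.{w'} 𝒜]

/-- The alternating sum of dimensions in the long exact sequence of `Ext(-, C)`. -/
lemma finrank_ext_one {K P A : 𝒜} [Projective P] {i : K ⟶ P} {p : P ⟶ A} {w : i ≫ p = 0}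
    (hS : (ShortComplex.mk i p w).ShortExact) (C : 𝒜) :
    (Module.finrank k (Ext.{w'} A C 1) : ℤ) = homDim k K C - homDim k P C + homDim k A C := by
  have : ∀ X Y : 𝒜, Module.Finite k (X ⟶ Y) := fun _ _ => Module.Finite.of_finite
  let δ : (K ⟶ C) →ₗ[k] Ext.{w'} A C 1 :=
    { toFun := fun f => hS.extClass.comp (Ext.mk₀ f) (add_zero 1)
      map_add' := fun f g => by rw [Ext.mk₀_add, Ext.comp_add]
      map_smul' := fun c f => by rw [Ext.mk₀_smul, Ext.comp_smul]; rfl }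
  have hp : Epi p := hS.epi_g
  refine finrank_of_exact_sequence k (Linear.leftComp k C p) (Linear.leftComp k C i) δ
    ?_ ?_ ?_ ?_ ?_ ?_
  · intro x hx
    change p ≫ x = 0 at hx
    rwa [← cancel_epi p, comp_zero]
  · intro x
    change i ≫ p ≫ x = 0
    rw [reassoc_of% w, zero_comp]
  · intro x hx
    exact shortExact_desc hS x hx
  · intro x
    change hS.extClass.comp (Ext.mk₀ (i ≫ x)) (add_zero 1) = 0
    rw [← Ext.mk₀_comp_mk₀]
    exact hS.extClass_comp_assoc _
  · intro x hx
    obtain ⟨y, hy⟩ := Ext.contravariant_sequence_exact₁ hS C (Ext.mk₀ x) (add_zero 1) hx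
    obtain ⟨y, rfl⟩ := (Ext.mk₀_bijective P C).2 y
    refine ⟨y, (Ext.mk₀_bijective _ _).1 ?_⟩
    rw [← hy, Ext.mk₀_comp_mk₀]
    rfl
  · intro x
    obtain ⟨y, hy⟩ := Ext.contravariant_sequence_exact₃ hS C x
      (Ext.eq_zero_of_projective _) (add_zero 1)
    obtain ⟨y, rfl⟩ := (Ext.mk₀_bijective K C).2 y
    exact ⟨y, hy⟩

/-- The connecting map is bijective because the Ext groups of P in positive degrees vanish on both
sides. This needs degree at least 1 for K; degree 0 is treated in `finrank_ext_one`. -/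
lemma finrank_ext_succ {K P A : 𝒜} [Projective P] {i : K ⟶ P} {p : P ⟶ A} {w : i ≫ p = 0}
    (hS : (ShortComplex.mk i p w).ShortExact) (C : 𝒜) (n : ℕ) :
    Module.finrank k (Ext.{w'} A C (n + 2)) = Module.finrank k (Ext.{w'} K C (n + 1)) := by
  have hn : 1 + (n + 1) = n + 2 := by omega
  let δ : Ext.{w'} K C (n + 1) →ₗ[k] Ext.{w'} A C (n + 2) :=
    { toFun := fun f => hS.extClass.comp f hn
      map_add' := fun f g => by rw [Ext.comp_add]
      map_smul' := fun c f => by rw [Ext.comp_smul]; rfl }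
  refine (LinearEquiv.finrank_eq (LinearEquiv.ofBijective δ ⟨?_, ?_⟩)).symm
  · rw [← LinearMap.ker_eq_bot, LinearMap.ker_eq_bot']
    intro x hx
    obtain ⟨y, rfl⟩ := Ext.contravariant_sequence_exact₁ hS C x hn hx
    have : y = 0 := Ext.eq_zero_of_projective y
    rw [this, Ext.comp_zero]
  · intro x
    exact Ext.contravariant_sequence_exact₃ hS C x (Ext.eq_zero_of_projective _) hn

end Euler

/-- Dimension shifting along the two syzygy sequences expresses Ext¹ and Ext² through Hom spaces and
kills Ext^i for i ≥ 3, which also makes the `finsum` finite. -/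
theorem eulerForm_eq (C : 𝒜) :
    eulerForm k A C = homDim k R.P₀ C - homDim k R.P₁ C + homDim k R.P₂ C := by
  let := HasExt.standard 𝒜
  have h0 : Module.finrank k (Abelian.Ext.{max u v} A C 0) = Module.finrank k (A ⟶ C) :=
    LinearEquiv.finrank_eq Abelian.Ext.linearEquiv₀
  have h1 := finrank_ext_one k R.shortExact₀ C
  have h2 := finrank_ext_succ k R.shortExact₀ C 0
  have h2' := finrank_ext_one k R.shortExact₁ C
  have h3 : ∀ n, Module.finrank k (Abelian.Ext.{max u v} A C (n + 3)) = 0 := by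
    intro n
    rw [finrank_ext_succ k R.shortExact₀ C (n + 1), finrank_ext_succ k R.shortExact₁ C n]
    have := Abelian.Ext.subsingleton_of_projective R.P₂ C n
    exact Module.finrank_zero_of_subsingleton
  unfold eulerForm
  rw [finsum_eq_sum_of_support_subset (s := Finset.range 3)]
  · rw [Finset.sum_range_succ, Finset.sum_range_succ, Finset.sum_range_one, h0, h1, h2, h2']
    unfold homDim
    ring
  · intro i hi
    by_contra h
    obtain ⟨n, rfl⟩ : ∃ n, i = n + 3 := ⟨i - 3, by simp at h; omega⟩
    simp [h3] at hi

end ProjRes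

end Resolutions

/-! ### Independence of E_A from the resolution. -/

section Independence

set_option linter.unusedSectionVars false

variable {𝒜 : Type u} [Category.{v} 𝒜] [Abelian 𝒜]

/-- The Schanuel trick: shear by `-v`, then by `u`, then swap. The first shear makes the second
summand map to `-f'`, and the second shear adds `f'` back. -/
lemma exists_biprod_iso {P P' X : 𝒜} (f : P ⟶ X) (f' : P' ⟶ X) (u : P ⟶ P') (hu : u ≫ f' = f)
    (v : P' ⟶ P) (hv : v ≫ f = f') :
    ∃ τ : P ⊞ P' ≅ P' ⊞ P, τ.hom ≫ biprod.desc f' 0 = biprod.desc f 0 := by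
  refine ⟨Biprod.unipotentLower (-v) ≪≫ Biprod.unipotentUpper u ≪≫ biprod.braiding P P', ?_⟩
  ext
  · simp [Biprod.unipotentLower, Biprod.unipotentUpper, hu]
  · simp [Biprod.unipotentLower, Biprod.unipotentUpper, hu, hv]

lemma mul_inv_mul_mul_inv_mul {G : Type*} [Group G] {a b c s s' : G} (ha : Commute s a)
    (hb : Commute s b) (hc : Commute s' c) :
    (a * s)⁻¹ * (b * s) * (c * s')⁻¹ * s' = a⁻¹ * b * c⁻¹ := by
  have h1 : Commute s (a⁻¹ * b) := ha.inv_right.mul_right hb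
  have h2 : Commute s' c⁻¹ := hc.inv_right
  have e1 : (a * s)⁻¹ * (b * s) = a⁻¹ * b := by
    rw [mul_inv_rev, mul_assoc, ← mul_assoc a⁻¹ b s, ← h1.eq, inv_mul_cancel_left]
  have e2 : (c * s')⁻¹ * s' = c⁻¹ := by
    rw [mul_inv_rev, mul_assoc, ← h2.eq, inv_mul_cancel_left]
  rw [mul_assoc _ _ s', e1, e2]

namespace ProjRes

variable {A : 𝒜} (R : ProjRes A)

/-- The direct sum of a resolution and `0 → 0 → S → S`. -/
def addDisc₀ [EnoughProjectives 𝒜] (S : 𝒜) [Projective S] : ProjRes A :=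
  ofLifting R.P₂ (R.P₁ ⊞ S) (R.P₀ ⊞ S) (biprod.lift R.a₂ 0) (biprod.map R.a₁ (𝟙 S))
    (biprod.desc R.a₀ 0)
    (by ext <;> simp [R.comp₂₁]) (by ext <;> simp [R.comp₁₀])
    (fun T _ x hx => by
      have := congrArg (· ≫ biprod.fst) hx
      simp only [Category.assoc, biprod.lift_fst, zero_comp] at this
      rwa [← cancel_mono R.a₂, zero_comp])
    (fun T _ x hx => by
      have h1 := congrArg (· ≫ biprod.fst) hx
      have h2 := congrArg (· ≫ biprod.snd) hx
      simp only [Category.assoc, biprod.map_fst, biprod.map_snd, zero_comp,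
        Category.comp_id] at h1 h2
      obtain ⟨y, hy⟩ := R.lift₁ (x ≫ biprod.fst) (by simpa using h1)
      exact ⟨y, by ext <;> simp [hy, h2]⟩)
    (fun T _ x hx => by
      obtain ⟨y, hy⟩ := R.lift₀ (x ≫ biprod.fst) (by
        rw [← hx, biprod.desc_eq]; simp)
      exact ⟨biprod.lift y (x ≫ biprod.snd), by ext <;> simp [hy]⟩)
    (fun T _ x => by
      obtain ⟨y, hy⟩ := R.lift x
      exact ⟨biprod.lift y 0, by simp [hy]⟩)

/-- The direct sum of a resolution and `0 → S → S → 0`. -/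
def addDisc₁ [EnoughProjectives 𝒜] (S : 𝒜) [Projective S] : ProjRes A :=
  ofLifting (R.P₂ ⊞ S) (R.P₁ ⊞ S) R.P₀ (biprod.map R.a₂ (𝟙 S)) (biprod.desc R.a₁ 0) R.a₀
    (by ext <;> simp [R.comp₂₁]) (by ext <;> simp [R.comp₁₀])
    (fun T _ x hx => by
      have h1 := congrArg (· ≫ biprod.fst) hx
      have h2 := congrArg (· ≫ biprod.snd) hx
      simp only [Category.assoc, biprod.map_fst, biprod.map_snd, zero_comp,
        Category.comp_id] at h1 h2
      ext
      · rw [← cancel_mono R.a₂]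
        simpa using h1
      · simpa using h2)
    (fun T _ x hx => by
      obtain ⟨y, hy⟩ := R.lift₁ (x ≫ biprod.fst) (by
        rw [← hx, biprod.desc_eq]; simp)
      exact ⟨biprod.lift y (x ≫ biprod.snd), by ext <;> simp [hy]⟩)
    (fun T _ x hx => by
      obtain ⟨y, hy⟩ := R.lift₀ x hx
      exact ⟨biprod.lift y 0, by simp [hy]⟩)
    (fun T _ x => R.lift x)

variable (k : Type w) [Field k] [Linear k 𝒜] [Finite k] [∀ X Y : 𝒜, Finite (X ⟶ Y)]

/-- The unit `[K_{P₁}]⁻¹ * [K_{P₂}] * [K_{P₂}^*]⁻¹`. -/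
def torus : (DH k 𝒜)ˣ := (DH.uK k R.P₁)⁻¹ * DH.uK k R.P₂ * (DH.uKs k R.P₂)⁻¹

lemma E_eq : R.E k = tt k ^ (homDim k R.P₁ A - 2 * homDim k R.P₂ A) •
    ((R.torus k : DH k 𝒜) * DH.cls k R.complexC) := by
  unfold E torus
  rw [eulerForm_eq_homDim, eulerForm_eq_homDim, ← DH.coe_uK, ← DH.coe_uK, ← DH.coe_uKs,
    Ring.inverse_unit, Ring.inverse_unit, Units.val_mul, Units.val_mul]

/-- Hom(S, -) is exact on the resolution, and folding it modulo 2 keeps the alternating sum of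
dimensions. This is why the exponents in E_A involve ⟨P_i, A⟩ only. -/
lemma chiL_complexC (S : 𝒜) [Projective S] : chiL k S R.complexC.obj = homDim k S A := by
  have h : homDim k S (R.complexC.obj.X 0) = _ := homDim_biprod_right k S R.P₀ R.P₂
  unfold chiL
  rw [h, R.homDim_eq k S]
  change _ - homDim k S R.P₁ = _
  ring

lemma chiR_complexC (S : 𝒜) :
    chiR k S R.complexC.obj = homDim k R.P₀ S - homDim k R.P₁ S + homDim k R.P₂ S := by
  have h : homDim k (R.complexC.obj.X 0) S = _ := homDim_biprod_left k R.P₀ R.P₂ S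
  unfold chiR
  rw [h]
  change _ - homDim k R.P₁ S = _
  ring

lemma E_congr {R R' : ProjRes A} (e₂ : R.P₂ ≅ R'.P₂) (e₁ : R.P₁ ≅ R'.P₁) (e₀ : R.P₀ ≅ R'.P₀)
    (h₂ : R.a₂ ≫ e₁.hom = e₂.hom ≫ R'.a₂) (h₁ : R.a₁ ≫ e₀.hom = e₁.hom ≫ R'.a₁) :
    R.E k = R'.E k := by
  rw [E_eq, E_eq, torus, torus, DH.uK_congr k e₁, DH.uK_congr k e₂, DH.uKs_congr k e₂,
    homDim_congr k e₁ (Iso.refl A), homDim_congr k e₂ (Iso.refl A),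
    DH.cls_congr k ⟨C2.isoMk (M := R.complexC.obj) (N := R'.complexC.obj) e₁
      (biprod.mapIso e₀ e₂) ?_ ?_⟩]
  · change biprod.lift R.a₁ 0 ≫ biprod.map e₀.hom e₂.hom = e₁.hom ≫ biprod.lift R'.a₁ 0
    ext <;> simp [h₁]
  · change biprod.desc 0 R.a₂ ≫ e₁.hom = biprod.map e₀.hom e₂.hom ≫ biprod.desc 0 R'.a₂
    ext <;> simp [h₂]

variable [EnoughProjectives 𝒜]

lemma nonempty_complexC_addDisc₀ (S : 𝒜) [Projective S] :
    Nonempty ((R.addDisc₀ S).complexC.obj ≅ (dsum R.complexC (complexK S)).obj) := by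
  let e : (R.P₀ ⊞ S) ⊞ R.P₂ ≅ (R.P₀ ⊞ R.P₂) ⊞ S :=
    { hom := biprod.lift (biprod.map biprod.fst (𝟙 _)) (biprod.fst ≫ biprod.snd)
      inv := biprod.lift (biprod.map biprod.fst (𝟙 _)) (biprod.fst ≫ biprod.snd)
      hom_inv_id := by ext <;> simp
      inv_hom_id := by ext <;> simp }
  refine ⟨C2.isoMk (M := (R.addDisc₀ S).complexC.obj) (N := (dsum R.complexC (complexK S)).obj)
    (Iso.refl (R.P₁ ⊞ S)) e ?_ ?_⟩
  · change biprod.lift (biprod.map R.a₁ (𝟙 S)) 0 ≫ e.hom =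
      𝟙 (R.P₁ ⊞ S) ≫ Biprod.ofComponents (biprod.lift R.a₁ 0) 0 0 (𝟙 S)
    ext <;> simp [e]
  · change biprod.desc 0 (biprod.lift R.a₂ 0) ≫ 𝟙 (R.P₁ ⊞ S) =
      e.hom ≫ Biprod.ofComponents (biprod.desc 0 R.a₂) 0 0 (0 : S ⟶ S)
    ext <;> simp [e]

lemma nonempty_complexC_addDisc₁ (S : 𝒜) [Projective S] :
    Nonempty ((R.addDisc₁ S).complexC.obj ≅ (dsum R.complexC (complexKstar S)).obj) := by
  refine ⟨C2.isoMk (M := (R.addDisc₁ S).complexC.obj) (N := (dsum R.complexC (complexKstar S)).obj)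
    (Iso.refl (R.P₁ ⊞ S)) (biprod.associator R.P₀ R.P₂ S).symm ?_ ?_⟩
  · change biprod.lift (biprod.desc R.a₁ 0) 0 ≫ (biprod.associator R.P₀ R.P₂ S).inv =
      𝟙 (R.P₁ ⊞ S) ≫ Biprod.ofComponents (biprod.lift R.a₁ 0) 0 0 (0 : S ⟶ S)
    ext <;> simp
  · change biprod.desc 0 (biprod.map R.a₂ (𝟙 S)) ≫ 𝟙 (R.P₁ ⊞ S) =
      (biprod.associator R.P₀ R.P₂ S).inv ≫ Biprod.ofComponents (biprod.desc 0 R.a₂) 0 0 (𝟙 S)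
    ext <;> simp

lemma commute_torus_uK (S : 𝒜) [Projective S] : Commute (DH.uK k S) (R.torus k) :=
  ((DH.uK_comm_uK k S R.P₁).inv_right.mul_right (DH.uK_comm_uK k S R.P₂)).mul_right
    (DH.uKs_comm_uK k R.P₂ S).symm.inv_right

lemma commute_torus_uKs (S : 𝒜) [Projective S] : Commute (DH.uKs k S) (R.torus k) :=
  ((DH.uKs_comm_uK k S R.P₁).inv_right.mul_right (DH.uKs_comm_uK k S R.P₂)).mul_right
    (DH.uKs_comm_uKs k S R.P₂).inv_right

lemma torus_addDisc₀ (S : 𝒜) [Projective S] :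
    (R.addDisc₀ S).torus k * DH.uK k S = R.torus k := by
  change (DH.uK k (R.P₁ ⊞ S))⁻¹ * DH.uK k R.P₂ * (DH.uKs k R.P₂)⁻¹ * _ = _
  rw [DH.uK_biprod, mul_inv_rev, mul_assoc _ (DH.uK k R.P₁)⁻¹, mul_assoc _ _ (DH.uKs k R.P₂)⁻¹]
  change (DH.uK k S)⁻¹ * R.torus k * DH.uK k S = R.torus k
  rw [mul_assoc, ← (R.commute_torus_uK k S).eq, inv_mul_cancel_left]

lemma torus_addDisc₁ (S : 𝒜) [Projective S] :
    (R.addDisc₁ S).torus k * DH.uKs k S = R.torus k := by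
  change (DH.uK k (R.P₁ ⊞ S))⁻¹ * DH.uK k (R.P₂ ⊞ S) * (DH.uKs k (R.P₂ ⊞ S))⁻¹ * _ = _
  rw [DH.uK_biprod, DH.uK_biprod, DH.uKs_biprod]
  exact mul_inv_mul_mul_inv_mul (DH.uK_comm_uK k _ _) (DH.uK_comm_uK k _ _)
    (DH.uKs_comm_uKs k _ _)

/-- The disc adds K_S to the complex, which costs t^(-⟨S, A⟩) and a factor [K_S]; the enlarged P₁ in
the torus and in the exponent compensates for both. -/
lemma E_addDisc₀ (S : 𝒜) [Projective S] : (R.addDisc₀ S).E k = R.E k := by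
  rw [E_eq, E_eq, ← R.torus_addDisc₀ k S, DH.cls_congr k (R.nonempty_complexC_addDisc₀ S),
    DH.cls_dsum_complexK, mul_smul_comm, smul_smul, ← tt_add, Units.val_mul, mul_assoc,
    chiL_complexC]
  congr 2
  change homDim k (R.P₁ ⊞ S) A - 2 * homDim k R.P₂ A + _ = _
  rw [homDim_biprod_left]
  ring

/-- The disc adds K_S^* to the complex, which gives t^⟨S, A⟩, while the exponent changes by ⟨S, A⟩ -
2⟨S, A⟩. This is the reason for the coefficient -2 of ⟨P₂, A⟩. The factors [K_S] from P₁ and P₂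
cancel. -/
lemma E_addDisc₁ (S : 𝒜) [Projective S] : (R.addDisc₁ S).E k = R.E k := by
  rw [E_eq, E_eq, ← R.torus_addDisc₁ k S, DH.cls_congr k (R.nonempty_complexC_addDisc₁ S),
    DH.cls_dsum_complexKstar, mul_smul_comm, smul_smul, ← tt_add, Units.val_mul, mul_assoc,
    chiL_complexC]
  congr 2
  change homDim k (R.P₁ ⊞ S) A - 2 * homDim k (R.P₂ ⊞ S) A + _ = _
  rw [homDim_biprod_left, homDim_biprod_left]
  ring

/-- The last term is the kernel of `a₁`, so an isomorphism of the first two terms extends to it. -/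
lemma E_eq_of_iso₁ {R R' : ProjRes A} (e₁ : R.P₁ ≅ R'.P₁) (e₀ : R.P₀ ≅ R'.P₀)
    (h₁ : R.a₁ ≫ e₀.hom = e₁.hom ≫ R'.a₁) : R.E k = R'.E k := by
  obtain ⟨y, hy⟩ := R'.lift₁ (R.a₂ ≫ e₁.hom) (by
    rw [Category.assoc, ← h₁, ← Category.assoc, R.comp₂₁, zero_comp])
  obtain ⟨z, hz⟩ := R.lift₁ (R'.a₂ ≫ e₁.inv) (by
    rw [← cancel_mono e₀.hom]
    simp [h₁, R'.comp₂₁])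
  refine E_congr k (R := R) (R' := R')
    { hom := y, inv := z, hom_inv_id := ?_, inv_hom_id := ?_ } e₁ e₀ hy.symm h₁
  · rw [← cancel_mono R.a₂, Category.assoc, hz, ← Category.assoc, hy]
    simp
  · rw [← cancel_mono R'.a₂, Category.assoc, hy, ← Category.assoc, hz]
    simp

/-- With the terms P₀ identified, P₁ and P₁' cover the same syzygy, so the Schanuel trick applies
one step further to the left. -/
lemma E_eq_of_iso₀ {R R' : ProjRes A} (e₀ : R.P₀ ≅ R'.P₀) (h₀ : e₀.hom ≫ R'.a₀ = R.a₀) :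
    R.E k = R'.E k := by
  obtain ⟨x, hx⟩ := R'.lift₀ (R.a₁ ≫ e₀.hom) (by rw [Category.assoc, h₀, R.comp₁₀])
  obtain ⟨y, hy⟩ := R.lift₀ (R'.a₁ ≫ e₀.inv) (by rw [← h₀]; simp [R'.comp₁₀])
  obtain ⟨τ, hτ⟩ := exists_biprod_iso (R.a₁ ≫ e₀.hom) R'.a₁ x hx y
    (by rw [← Category.assoc, hy]; simp)
  rw [← R.E_addDisc₁ k R'.P₁, ← R'.E_addDisc₁ k R.P₁]
  refine E_eq_of_iso₁ k (R := R.addDisc₁ R'.P₁) (R' := R'.addDisc₁ R.P₁) τ e₀ ?_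
  change biprod.desc R.a₁ 0 ≫ e₀.hom = τ.hom ≫ biprod.desc R'.a₁ 0
  rw [hτ]
  ext <;> simp

theorem E_eq_E (R R' : ProjRes A) : R.E k = R'.E k := by
  obtain ⟨x, hx⟩ := R'.lift R.a₀
  obtain ⟨y, hy⟩ := R.lift R'.a₀
  obtain ⟨τ, hτ⟩ := exists_biprod_iso R.a₀ R'.a₀ x hx y hy
  rw [← R.E_addDisc₀ k R'.P₀, ← R'.E_addDisc₀ k R.P₀]
  exact E_eq_of_iso₀ k (R := R.addDisc₀ R'.P₀) (R' := R'.addDisc₀ R.P₀) τ hτ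

end ProjRes

end Independence

/-! ### Extensions of A by C as pushouts of the first syzygy sequence. -/

section Extensions

set_option linter.unusedSectionVars false

variable {𝒜 : Type u} [Category.{v} 𝒜] [Abelian 𝒜] {A C : 𝒜}

namespace ProjRes

variable (R : ProjRes A) (f : R.K ⟶ C)

/-- The extension of `A` by `C` obtained by pushing out along `f` the first syzygy sequence. -/
def ext : 𝒜 := cokernel (biprod.lift R.ι (-f))

/-- The projection to the extension. -/
def extπ : R.P₀ ⊞ C ⟶ R.ext f := cokernel.π (biprod.lift R.ι (-f))

instance : Epi (R.extπ f) := inferInstanceAs (Epi (cokernel.π (biprod.lift R.ι (-f))))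

/-- The map from the projective term to the extension. -/
def extJ : R.P₀ ⟶ R.ext f := biprod.inl ≫ R.extπ f

/-- The inclusion of `C` into the extension. -/
def extI : C ⟶ R.ext f := biprod.inr ≫ R.extπ f

lemma extπ_eq : R.extπ f = biprod.desc (R.extJ f) (R.extI f) := by
  apply biprod.hom_ext' <;> simp [extJ, extI]

lemma lift_extπ : biprod.lift R.ι (-f) ≫ R.extπ f = 0 := cokernel.condition (biprod.lift R.ι (-f))

lemma ι_extJ : R.ι ≫ R.extJ f = f ≫ R.extI f := by
  have := R.lift_extπ f
  rw [extπ_eq, biprod.lift_desc, Preadditive.neg_comp, add_neg_eq_zero] at this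
  exact this

variable {f} in
lemma ext_hom_ext {B : 𝒜} {φ ψ : R.ext f ⟶ B} (hj : R.extJ f ≫ φ = R.extJ f ≫ ψ)
    (hi : R.extI f ≫ φ = R.extI f ≫ ψ) : φ = ψ := by
  rw [← cancel_epi (R.extπ f), extπ_eq]
  apply biprod.hom_ext' <;> simp [hj, hi]

lemma exists_ext_desc {B : 𝒜} (u : R.P₀ ⟶ B) (v : C ⟶ B) (h : R.ι ≫ u = f ≫ v) :
    ∃ φ : R.ext f ⟶ B, R.extJ f ≫ φ = u ∧ R.extI f ≫ φ = v := by
  have hd : ∃ φ : R.ext f ⟶ B, R.extπ f ≫ φ = biprod.desc u v :=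
    ⟨cokernel.desc _ (biprod.desc u v) (by simp [h]), cokernel.π_desc _ _ _⟩
  obtain ⟨φ, hφ⟩ := hd
  exact ⟨φ, by simp [extJ, hφ], by simp [extI, hφ]⟩

lemma exists_ext_lift {T : 𝒜} [Projective T] (x : T ⟶ R.ext f) :
    ∃ (y : T ⟶ R.P₀) (z : T ⟶ C), y ≫ R.extJ f + z ≫ R.extI f = x := by
  obtain ⟨y, rfl⟩ : ∃ y, y ≫ R.extπ f = x := ⟨_, Projective.factorThru_comp x (R.extπ f)⟩
  refine ⟨y ≫ biprod.fst, y ≫ biprod.snd, ?_⟩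
  rw [extπ_eq, biprod.desc_eq]
  simp

lemma exists_of_comp_ext_eq_zero {T : 𝒜} (y : T ⟶ R.P₀) (z : T ⟶ C)
    (h : y ≫ R.extJ f + z ≫ R.extI f = 0) : ∃ w : T ⟶ R.K, w ≫ R.ι = y ∧ w ≫ f = -z := by
  have hS : (ShortComplex.mk (biprod.lift R.ι (-f)) (R.extπ f) (R.lift_extπ f)).ShortExact :=
    { exact := ShortComplex.exact_cokernel _
      mono_f := mono_of_mono_fac (h := R.ι) (biprod.lift_fst R.ι (-f))
      epi_g := inferInstanceAs (Epi (R.extπ f)) }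
  obtain ⟨w, hw⟩ := shortExact_lift hS (biprod.lift y z) (by
    rw [extπ_eq, biprod.lift_desc, h])
  refine ⟨w, ?_, ?_⟩
  · simpa using congrArg (· ≫ biprod.fst) hw
  · have := congrArg (· ≫ biprod.snd) hw
    simp only [Category.assoc, biprod.lift_snd, Preadditive.comp_neg] at this
    rw [← this, neg_neg]

/-- The projection from the extension to `A`. -/
def extP : R.ext f ⟶ A := (R.exists_ext_desc f R.a₀ 0 (by simp [R.ι_a₀])).choose

lemma extJ_extP : R.extJ f ≫ R.extP f = R.a₀ :=
  (R.exists_ext_desc f R.a₀ 0 (by simp [R.ι_a₀])).choose_spec.1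

lemma extI_extP : R.extI f ≫ R.extP f = 0 :=
  (R.exists_ext_desc f R.a₀ 0 (by simp [R.ι_a₀])).choose_spec.2

lemma ext_shortExact [EnoughProjectives 𝒜] :
    (ShortComplex.mk _ _ (R.extI_extP f)).ShortExact where
  exact := by
    refine exact_of_projective_lift _ _ _ fun T _ x hx => ?_
    obtain ⟨y, z, rfl⟩ := R.exists_ext_lift f x
    simp only [Preadditive.add_comp, Category.assoc, extJ_extP, extI_extP, comp_zero,
      add_zero] at hx
    obtain ⟨w, rfl⟩ := shortExact_lift R.shortExact₀ y hx
    exact ⟨w ≫ f + z, by simp [ι_extJ]⟩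
  mono_f := by
    refine Preadditive.mono_of_cancel_zero _ fun {T} z hz => ?_
    obtain ⟨w, hw, hw'⟩ := R.exists_of_comp_ext_eq_zero f 0 z (by
      rw [zero_comp, zero_add]; exact hz)
    have : w = 0 := by rw [← cancel_mono R.ι, hw, zero_comp]
    rw [this, zero_comp, eq_comm, neg_eq_zero] at hw'
    exact hw'
  epi_g := epi_of_epi_fac (R.extJ_extP f)

/-- The projective P₀ lifts to the middle term, and the restriction of the lift to the syzygy lands
in `C`; this restriction is `f`. -/
lemma exists_hom_ext {B : 𝒜} (i' : C ⟶ B) (p' : B ⟶ A) (h : i' ≫ p' = 0)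
    (hS : (ShortComplex.mk _ _ h).ShortExact) [EnoughProjectives 𝒜] :
    ∃ (f : R.K ⟶ C) (φ : B ⟶ R.ext f), i' ≫ φ = R.extI f ∧ φ ≫ R.extP f = p' := by
  have : Epi p' := hS.epi_g
  obtain ⟨f, hf⟩ := shortExact_lift hS (R.ι ≫ Projective.factorThru R.a₀ p') (by
    rw [Category.assoc, Projective.factorThru_comp, ι_a₀])
  obtain ⟨φ, hj, hi⟩ := R.exists_ext_desc f _ _ hf.symm
  have hp : φ ≫ p' = R.extP f := by
    refine R.ext_hom_ext ?_ ?_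
    · rw [← Category.assoc, hj, Projective.factorThru_comp, extJ_extP]
    · rw [← Category.assoc, hi, h, extI_extP]
  have := isIso_of_extension_hom (R.ext_shortExact f) hS φ hi hp
  exact ⟨f, inv φ, by rw [← hi]; simp, by rw [← hp]; simp⟩

/-- An equivalence is fixed on `C`, so it is determined by its discrepancy `h` on P₀, and `h` forces
the target to be the extension of `f - ι ≫ h`. As for complexes, all `h` occur. -/
lemma card_ext_hom [EnoughProjectives 𝒜] :
    Nat.card (Σ f' : R.K ⟶ C, {φ : R.ext f ⟶ R.ext f' //
      R.extI f ≫ φ = R.extI f' ∧ φ ≫ R.extP f' = R.extP f}) = Nat.card (R.P₀ ⟶ C) := by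
  -- On the syzygy, `extJ + h ≫ extI` for `f - ι ≫ h` restricts to `f ≫ extI`, so the pushout
  -- property applies.
  have hw : ∀ h : R.P₀ ⟶ C, ∃ φ : R.ext f ⟶ R.ext (f - R.ι ≫ h),
      R.extJ f ≫ φ = R.extJ _ + h ≫ R.extI _ ∧ R.extI f ≫ φ = R.extI _ := fun h =>
    R.exists_ext_desc f _ _ (by simp [ι_extJ])
  choose Φ hΦj hΦi using hw
  have hd : ∀ x : (Σ f' : R.K ⟶ C, {φ : R.ext f ⟶ R.ext f' //
      R.extI f ≫ φ = R.extI f' ∧ φ ≫ R.extP f' = R.extP f}),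
      ∃ h : R.P₀ ⟶ C, h ≫ R.extI x.1 = R.extJ f ≫ x.2.1 - R.extJ x.1 := fun x =>
    shortExact_lift (R.ext_shortExact x.1) _ (by
      rw [Preadditive.sub_comp, Category.assoc, x.2.2.2, extJ_extP, extJ_extP, sub_self])
  choose G hG using hd
  symm
  refine Nat.card_eq_of_bijective (fun h => (⟨f - R.ι ≫ h, Φ h, hΦi h,
    R.ext_hom_ext ?_ ?_⟩ : Σ f' : R.K ⟶ C, {φ : R.ext f ⟶ R.ext f' //
      R.extI f ≫ φ = R.extI f' ∧ φ ≫ R.extP f' = R.extP f})) ⟨?_, ?_⟩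
  · rw [← Category.assoc, hΦj]
    simp [extJ_extP, extI_extP]
  · rw [← Category.assoc, hΦi, extI_extP, extI_extP]
  · refine Function.LeftInverse.injective (g := G) fun h => ?_
    have : Mono (R.extI (f - R.ι ≫ h)) := (R.ext_shortExact _).mono_f
    rw [← cancel_mono (R.extI (f - R.ι ≫ h)), hG]
    exact (congrArg (· - R.extJ (f - R.ι ≫ h)) (hΦj h)).trans (add_sub_cancel_left _ _)
  · rintro ⟨f', φ, hi, hp⟩
    obtain ⟨h, hh⟩ : ∃ h : R.P₀ ⟶ C, h ≫ R.extI f' = R.extJ f ≫ φ - R.extJ f' :=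
      ⟨_, hG ⟨f', φ, hi, hp⟩⟩
    have : Mono (R.extI f') := (R.ext_shortExact _).mono_f
    obtain rfl : f' = f - R.ι ≫ h := by
      rw [← cancel_mono (R.extI f')]
      rw [Preadditive.sub_comp, Category.assoc, hh, Preadditive.comp_sub, ← Category.assoc,
        ι_extJ, Category.assoc, hi, ι_extJ, sub_sub_cancel]
    refine ⟨h, Sigma.ext rfl (heq_of_eq (Subtype.ext (R.ext_hom_ext ?_ ?_)))⟩
    · rw [hΦj, hh, add_sub_cancel]
    · rw [hΦi, hi]

variable (C) in
/-- The family of the extensions of `A` by `C` defined by the morphisms from the first syzygy. -/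
def extFamily [EnoughProjectives 𝒜] : ExtFamily A C (R.K ⟶ C) (Nat.card (R.P₀ ⟶ C)) where
  X := R.ext
  i := R.extI
  p := R.extP
  w := R.extI_extP
  exact f := R.ext_shortExact f
  surj i' p' h hS := R.exists_hom_ext i' p' h hS
  card f := R.card_ext_hom f

/-- Transport of a resolution along an isomorphism. -/
def mapIso {A' : 𝒜} (e : A ≅ A') : ProjRes A' where
  P₂ := R.P₂
  P₁ := R.P₁
  P₀ := R.P₀
  proj₂ := R.proj₂
  proj₁ := R.proj₁
  proj₀ := R.proj₀
  a₂ := R.a₂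
  a₁ := R.a₁
  a₀ := R.a₀ ≫ e.hom
  comp₂₁ := R.comp₂₁
  comp₁₀ := by rw [reassoc_of% R.comp₁₀, zero_comp]
  mono₂ := R.mono₂
  exact₁ := R.exact₁
  exact₀ := ShortComplex.exact_of_iso (S₁ := ShortComplex.mk R.a₁ R.a₀ R.comp₁₀)
    (ShortComplex.isoMk (Iso.refl _) (Iso.refl _) e (by simp) (by simp)) R.exact₀
  epi₀ := inferInstance

variable (k : Type w) [Field k] [Finite k] [Linear k 𝒜] [∀ X Y : 𝒜, Finite (X ⟶ Y)]

/-- Both sides are computed by the same terms of one resolution, which avoids transporting Ext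
groups. -/
lemma eulerForm_congr (R : ProjRes A) {A' C' : 𝒜} (a : A ≅ A') (c : C ≅ C') :
    eulerForm k A C = eulerForm k A' C' := by
  rw [R.eulerForm_eq, (R.mapIso a).eulerForm_eq]
  simp only [homDim_congr k (Iso.refl _) c]
  rfl

theorem cls_mul_cls [EnoughProjectives 𝒜] [Fintype (R.K ⟶ C)] :
    TwHall.cls k A * TwHall.cls k C = tt k ^ (eulerForm k A C - 2 * homDim k R.P₀ C) •
      ∑ f : R.K ⟶ C, TwHall.cls k (R.ext f) := by
  refine ConstAlg.basisElt_mul_basisElt (fun f => isoClass (R.ext f)) _ _ _ fun b => ?_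
  obtain ⟨a⟩ : Nonempty (A ≅ (isoClass A).out) := Quotient.exact (Quotient.out_eq (isoClass A)).symm
  obtain ⟨c⟩ : Nonempty (C ≅ (isoClass C).out) := Quotient.exact (Quotient.out_eq (isoClass C)).symm
  rw [← R.eulerForm_congr k a c, hallNumber_eq Nat.card_pos.ne' (R.extFamily C) a c, ← mul_assoc]
  congr 1
  · rw [card_hom k, ← zpow_neg, ← tt_add, sub_eq_add_neg]
  · congr 1
    refine Nat.card_congr (Equiv.subtypeEquivRight fun f => ?_)
    have := Quotient.out_eq b
    exact (Quotient.eq (r := isIsomorphicSetoid 𝒜)).symm.trans (by rw [this]; rfl)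

end ProjRes

end Extensions

/-! ### Cocycles between resolutions and the horseshoe construction. -/

section Multiplicativity

set_option linter.unusedSectionVars false

section Counting

variable {G H : Type*} [AddCommGroup G] [AddCommGroup H] [Finite G]

lemma card_eq_card_range_mul_card_ker (φ : G →+ H) :
    Nat.card G = Nat.card φ.range * Nat.card φ.ker := by
  rw [← Nat.card_congr (QuotientAddGroup.quotientKerEquivRange φ).toEquiv]
  exact AddSubgroup.card_eq_card_quotient_mul_card_addSubgroup φ.ker

lemma sum_comp_of_surjective [Fintype G] [Fintype H] {V : Type*} [AddCommMonoid V] (ψ : G →+ H)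
    (hs : Function.Surjective ψ) (F : H → V) :
    ∑ g, F (ψ g) = Nat.card ψ.ker • ∑ h, F h := by
  classical
  rw [← Finset.sum_fiberwise (s := Finset.univ) (g := ψ), Finset.smul_sum]
  refine Finset.sum_congr rfl fun h _ => ?_
  rw [Finset.sum_congr rfl (g := fun _ => F h)
    (fun g hg => by rw [(Finset.mem_filter.1 hg).2]), Finset.sum_const]
  congr 1
  obtain ⟨g₀, rfl⟩ := hs h
  rw [← Fintype.card_subtype, ← Nat.card_eq_fintype_card]
  exact Nat.card_congr
    { toFun := fun g => ⟨g.1 - g₀, by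
        rw [AddMonoidHom.mem_ker, map_sub, g.2, sub_self]⟩
      invFun := fun g => ⟨g.1 + g₀, by
        rw [map_add, AddMonoidHom.mem_ker.1 g.2, zero_add]⟩
      left_inv := fun g => by simp
      right_inv := fun g => by simp }

end Counting

variable {𝒜 : Type u} [Category.{v} 𝒜] [Abelian 𝒜] {A C : 𝒜}

namespace ProjRes

variable (R : ProjRes A) (S : ProjRes C)

lemma mem_cocycle_iff (g₁ : R.P₁ ⟶ S.P₀ ⊞ S.P₂) (g₀ : R.P₀ ⊞ R.P₂ ⟶ S.P₁) :
    (g₁, g₀) ∈ C2.Cocycle R.complexC.obj S.complexC.obj ↔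
      (R.a₁ ≫ biprod.inl ≫ g₀ + g₁ ≫ biprod.snd ≫ S.a₂ = 0) ∧
        (biprod.inl ≫ g₀ ≫ S.a₁ = 0) ∧ (R.a₂ ≫ g₁ ≫ biprod.snd = 0) ∧
          (R.a₂ ≫ g₁ ≫ biprod.fst + biprod.inr ≫ g₀ ≫ S.a₁ = 0) := by
  have h : (g₁, g₀) ∈ C2.Cocycle R.complexC.obj S.complexC.obj ↔
      biprod.lift R.a₁ 0 ≫ g₀ + g₁ ≫ biprod.desc 0 S.a₂ = 0 ∧
        biprod.desc 0 R.a₂ ≫ g₁ + g₀ ≫ biprod.lift S.a₁ 0 = 0 := Iff.rfl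
  rw [h]
  refine and_congr (by simp [biprod.lift_eq, biprod.desc_eq]) ⟨fun h => ⟨?_, ?_, ?_⟩, fun h => ?_⟩
  · simpa using congrArg (biprod.inl ≫ · ≫ biprod.fst) h
  · simpa using congrArg (biprod.inr ≫ · ≫ biprod.snd) h
  · simpa using congrArg (biprod.inr ≫ · ≫ biprod.fst) h
  · ext <;> simp [h]

variable {R S}

variable (R S) in
/-- A cocycle from its components. -/
def mkCocycle (g₁ : R.P₁ ⟶ S.P₀ ⊞ S.P₂) (g₀ : R.P₀ ⊞ R.P₂ ⟶ S.P₁)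
    (h : R.a₁ ≫ biprod.inl ≫ g₀ + g₁ ≫ biprod.snd ≫ S.a₂ = 0)
    (h₂ : biprod.inl ≫ g₀ ≫ S.a₁ = 0) (h₃ : R.a₂ ≫ g₁ ≫ biprod.snd = 0)
    (h₄ : R.a₂ ≫ g₁ ≫ biprod.fst + biprod.inr ≫ g₀ ≫ S.a₁ = 0) :
    C2.Cocycle R.complexC.obj S.complexC.obj :=
  ⟨(g₁, g₀), (mem_cocycle_iff R S _ _).2 ⟨h, h₂, h₃, h₄⟩⟩

/-- The component of degree `1 → 0` of a cocycle. -/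
def upper (g : C2.Cocycle R.complexC.obj S.complexC.obj) : R.P₁ ⟶ S.P₀ ⊞ S.P₂ := g.1.1

/-- The component of degree `0 → 1` of a cocycle. -/
def lower (g : C2.Cocycle R.complexC.obj S.complexC.obj) : R.P₀ ⊞ R.P₂ ⟶ S.P₁ := g.1.2

lemma cocycle_mem (g : C2.Cocycle R.complexC.obj S.complexC.obj) :
    (R.a₁ ≫ biprod.inl ≫ lower g + upper g ≫ biprod.snd ≫ S.a₂ = 0) ∧
        (biprod.inl ≫ lower g ≫ S.a₁ = 0) ∧ (R.a₂ ≫ upper g ≫ biprod.snd = 0) ∧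
          (R.a₂ ≫ upper g ≫ biprod.fst + biprod.inr ≫ lower g ≫ S.a₁ = 0) :=
  (mem_cocycle_iff R S _ _).1 g.2

/-- The components P₀ ⟶ S.P₁ and P₁ ⟶ S.P₂ form a cocycle of ℤ-degree -1. Exactness at S.P₁ and
injectivity of `S.a₂` make it the boundary of some θ : P₀ ⟶ S.P₂. -/
lemma exists_homotopy (g : C2.Cocycle R.complexC.obj S.complexC.obj) :
    ∃ θ : R.P₀ ⟶ S.P₂, θ ≫ S.a₂ = biprod.inl ≫ lower g ∧
      upper g ≫ biprod.snd = -(R.a₁ ≫ θ) := by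
  obtain ⟨h1, h2, -, -⟩ := cocycle_mem g
  obtain ⟨θ, hθ⟩ := S.lift₁ (biprod.inl ≫ lower g) (by rw [Category.assoc, h2])
  refine ⟨θ, hθ, ?_⟩
  rw [← cancel_mono S.a₂, eq_neg_of_add_eq_zero_right (a := R.a₁ ≫ biprod.inl ≫ lower g)
    (b := (upper g ≫ biprod.snd) ≫ S.a₂) (by rw [Category.assoc, h1]), ← hθ]
  simp

/-- The condition of ℤ-degree 2 shows that P₁ ⟶ S.P₀ ⟶ C vanishes on P₂, so it descends to the
syzygy. The sign is the one that makes consecutive maps of the horseshoe resolution compose to zero.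
-/
lemma exists_extHom (g : C2.Cocycle R.complexC.obj S.complexC.obj) :
    ∃ f : R.K ⟶ C, R.π ≫ f = -(upper g ≫ biprod.fst ≫ S.a₀) := by
  obtain ⟨-, -, -, h⟩ := cocycle_mem g
  refine shortExact_desc R.shortExact₁ _ ?_
  have := congrArg (· ≫ S.a₀) h
  simp only [Preadditive.add_comp, Category.assoc, S.comp₁₀, comp_zero, add_zero,
    zero_comp] at this
  rw [Preadditive.comp_neg, this, neg_zero]

variable (R S) in
/-- The morphism from the first syzygy defined by a cocycle. -/
def extHom : C2.Cocycle R.complexC.obj S.complexC.obj →+ (R.K ⟶ C) where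
  -- The choice is harmless: `R.π` is epi, so the morphism is unique, and additivity follows.
  toFun g := (exists_extHom g).choose
  map_zero' := by
    rw [← cancel_epi R.π, (exists_extHom _).choose_spec, comp_zero]
    exact neg_eq_zero.2 zero_comp
  map_add' g g' := by
    rw [← cancel_epi R.π, Preadditive.comp_add, (exists_extHom _).choose_spec,
      (exists_extHom _).choose_spec, (exists_extHom _).choose_spec]
    change -((upper g + upper g') ≫ _) = _
    rw [Preadditive.add_comp, neg_add]

lemma π_extHom (g : C2.Cocycle R.complexC.obj S.complexC.obj) :
    R.π ≫ extHom R S g = -(upper g ≫ biprod.fst ≫ S.a₀) := (exists_extHom g).choose_spec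

/-- Projectivity of P₁ and P₂ lifts `f` to a map of ℤ-degree 1 between the resolutions; the part of
degree -1 is taken to be zero. -/
lemma extHom_surjective : Function.Surjective (extHom R S) := by
  intro f
  obtain ⟨x, hx⟩ := S.lift (-(R.π ≫ f))
  obtain ⟨y, hy⟩ := S.lift₀ (-(R.a₂ ≫ x)) (by
    rw [Preadditive.neg_comp, Category.assoc, hx, Preadditive.comp_neg, reassoc_of% R.a₂_π,
      zero_comp, neg_zero, neg_zero])
  refine ⟨mkCocycle R S (biprod.lift x 0) (biprod.desc 0 y) (by simp) (by simp) (by simp)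
    (by simp [hy]), ?_⟩
  rw [← cancel_epi R.π, π_extHom]
  change -(biprod.lift x 0 ≫ _) = _
  simp [hx]

variable (R S) in
/-- The cocycles with trivial class. -/
def trivialCocycle : (R.P₁ ⟶ S.P₁) × (R.P₂ ⟶ S.P₂) × (R.P₀ ⟶ S.P₂) →+
    C2.Cocycle R.complexC.obj S.complexC.obj where
  toFun x := mkCocycle R S (biprod.lift (x.1 ≫ S.a₁) (-(R.a₁ ≫ x.2.2)))
    (biprod.desc (x.2.2 ≫ S.a₂) (x.2.1 ≫ S.a₂ - R.a₂ ≫ x.1))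
    (by simp) (by simp [S.comp₂₁]) (by simp [reassoc_of% R.comp₂₁]) (by simp [S.comp₂₁])
  map_zero' := by
    refine Subtype.ext (Prod.ext ?_ ?_)
    · change biprod.lift ((0 : R.P₁ ⟶ S.P₁) ≫ S.a₁) (-(R.a₁ ≫ (0 : R.P₀ ⟶ S.P₂))) = 0
      ext <;> simp
    · change biprod.desc ((0 : R.P₀ ⟶ S.P₂) ≫ S.a₂)
        ((0 : R.P₂ ⟶ S.P₂) ≫ S.a₂ - R.a₂ ≫ (0 : R.P₁ ⟶ S.P₁)) = 0
      ext <;> simp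
  map_add' x y := by
    refine Subtype.ext (Prod.ext ?_ ?_)
    · change biprod.lift ((x.1 + y.1) ≫ S.a₁) (-(R.a₁ ≫ (x.2.2 + y.2.2))) =
        biprod.lift (x.1 ≫ S.a₁) (-(R.a₁ ≫ x.2.2)) + biprod.lift (y.1 ≫ S.a₁) (-(R.a₁ ≫ y.2.2))
      ext <;> simp [add_comm]
    · change biprod.desc ((x.2.2 + y.2.2) ≫ S.a₂)
          ((x.2.1 + y.2.1) ≫ S.a₂ - R.a₂ ≫ (x.1 + y.1)) =
        biprod.desc (x.2.2 ≫ S.a₂) (x.2.1 ≫ S.a₂ - R.a₂ ≫ x.1) +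
          biprod.desc (y.2.2 ≫ S.a₂) (y.2.1 ≫ S.a₂ - R.a₂ ≫ y.1)
      ext
      · simp
      · simp
        abel

lemma upper_trivialCocycle (x) : upper (trivialCocycle R S x) =
    biprod.lift (x.1 ≫ S.a₁) (-(R.a₁ ≫ x.2.2)) := rfl

lemma lower_trivialCocycle (x) : lower (trivialCocycle R S x) =
    biprod.desc (x.2.2 ≫ S.a₂) (x.2.1 ≫ S.a₂ - R.a₂ ≫ x.1) := rfl

lemma cocycle_ext {g g' : C2.Cocycle R.complexC.obj S.complexC.obj} (h₁ : upper g = upper g')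
    (h₀ : lower g = lower g') : g = g' := Subtype.ext (Prod.ext h₁ h₀)

/-- If the class vanishes, the component P₁ ⟶ S.P₀ lifts through `S.a₁` to `u`. What remains on P₂
then lifts through `S.a₂` to `v`, and θ accounts for the part of degree -1. -/
lemma range_trivialCocycle : (trivialCocycle R S).range = (extHom R S).ker := by
  ext g
  rw [AddMonoidHom.mem_ker, AddMonoidHom.mem_range]
  constructor
  · rintro ⟨x, rfl⟩
    rw [← cancel_epi R.π, π_extHom, upper_trivialCocycle]
    simp [S.comp₁₀]
  · intro hg
    have hu := π_extHom g
    rw [hg, comp_zero, eq_comm, neg_eq_zero] at hu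
    obtain ⟨θ, hθ, hθ'⟩ := exists_homotopy g
    obtain ⟨-, -, -, h⟩ := cocycle_mem g
    obtain ⟨u, hu⟩ := S.lift₀ (upper g ≫ biprod.fst) (by rw [Category.assoc, hu])
    obtain ⟨v, hv⟩ := S.lift₁ (R.a₂ ≫ u + biprod.inr ≫ lower g) (by
      rw [Preadditive.add_comp, Category.assoc, Category.assoc, hu, h])
    refine ⟨(u, v, θ), cocycle_ext ?_ ?_⟩
    · rw [upper_trivialCocycle]
      ext <;> simp [hu, hθ']
    · rw [lower_trivialCocycle]
      ext <;> simp [hv, hθ]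

/-- The only ambiguity is a second-order homotopy w : P₁ ⟶ S.P₂, which changes `u` by `w ≫ S.a₂` and
`v` by `R.a₂ ≫ w`; θ is determined because `S.a₂` is mono. -/
lemma card_ker_trivialCocycle :
    Nat.card (trivialCocycle R S).ker = Nat.card (R.P₁ ⟶ S.P₂) := by
  symm
  refine Nat.card_eq_of_bijective (fun w => ⟨(w ≫ S.a₂, R.a₂ ≫ w, 0), ?_⟩) ⟨?_, ?_⟩
  · rw [AddMonoidHom.mem_ker]
    refine cocycle_ext ?_ ?_
    · rw [upper_trivialCocycle]
      change _ = (0 : R.P₁ ⟶ S.P₀ ⊞ S.P₂)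
      ext <;> simp [S.comp₂₁]
    · rw [lower_trivialCocycle]
      change _ = (0 : R.P₀ ⊞ R.P₂ ⟶ S.P₁)
      ext <;> simp
  · intro w w' h
    have : w ≫ S.a₂ = w' ≫ S.a₂ := congrArg (fun x => x.1.1) h
    rwa [cancel_mono] at this
  · rintro ⟨⟨u, v, θ⟩, h⟩
    rw [AddMonoidHom.mem_ker] at h
    have h1 := congrArg upper h
    have h0 := congrArg lower h
    rw [upper_trivialCocycle] at h1
    rw [lower_trivialCocycle] at h0
    have h1' : u ≫ S.a₁ = 0 := by
      have := congrArg (· ≫ biprod.fst) h1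
      simp only [biprod.lift_fst] at this
      exact this.trans zero_comp
    have h2 : θ ≫ S.a₂ = 0 := by
      have := congrArg (biprod.inl ≫ ·) h0
      simp only [biprod.inl_desc] at this
      exact this.trans comp_zero
    have h3 : v ≫ S.a₂ - R.a₂ ≫ u = 0 := by
      have := congrArg (biprod.inr ≫ ·) h0
      simp only [biprod.inr_desc] at this
      exact this.trans comp_zero
    obtain ⟨w, rfl⟩ := S.lift₁ u h1'
    obtain rfl : θ = 0 := by rwa [← cancel_mono S.a₂, zero_comp]
    obtain rfl : v = R.a₂ ≫ w := by
      rw [← cancel_mono S.a₂, Category.assoc]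
      exact sub_eq_zero.1 h3
    exact ⟨w, rfl⟩

section Count

variable (k : Type w) [Field k] [Finite k] [Linear k 𝒜] [∀ X Y : 𝒜, Finite (X ⟶ Y)]

lemma card_ker_extHom : (Nat.card (extHom R S).ker : ℂ) =
    tt k ^ (2 * (homDim k R.P₁ S.P₁ + homDim k R.P₂ S.P₂ + homDim k R.P₀ S.P₂
      - homDim k R.P₁ S.P₂)) := by
  have h := card_eq_card_range_mul_card_ker (trivialCocycle R S)
  rw [range_trivialCocycle, card_ker_trivialCocycle, Nat.card_prod, Nat.card_prod] at h
  have h' := congrArg (Nat.cast (R := ℂ)) h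
  simp only [Nat.cast_mul, card_hom k] at h'
  have h0 := zpow_ne_zero (2 * homDim k R.P₁ S.P₂) (tt_ne_zero k)
  refine mul_right_cancel₀ h0 (h'.symm.trans ?_)
  rw [← tt_add, ← tt_add, ← tt_add]
  congr 1
  ring

end Count

variable [EnoughProjectives 𝒜]

/-- The resolution of an extension, by the sums of the terms of the resolutions of `A` and `C`. -/
def extRes (f : R.K ⟶ C) (x : R.P₁ ⟶ S.P₀) (y : R.P₂ ⟶ S.P₁) (hf : R.π ≫ f = -(x ≫ S.a₀))
    (hy : R.a₂ ≫ x + y ≫ S.a₁ = 0) : ProjRes (R.ext f) :=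
  ofLifting (R.P₂ ⊞ S.P₂) (R.P₁ ⊞ S.P₁) (R.P₀ ⊞ S.P₀) (Biprod.ofComponents R.a₂ y 0 S.a₂)
    (Biprod.ofComponents R.a₁ x 0 S.a₁) (biprod.desc (R.extJ f) (S.a₀ ≫ R.extI f))
    (by ext <;> simp [R.comp₂₁, S.comp₂₁, hy])
    (by
      apply biprod.hom_ext'
      · simp only [inl_ofComponents_assoc, biprod.inl_desc, biprod.inr_desc, comp_zero]
        rw [← R.π_ι, Category.assoc, ι_extJ, ← Category.assoc, hf, Preadditive.neg_comp,
          Category.assoc, neg_add_cancel]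
      · simp [reassoc_of% S.comp₁₀])
    (fun T _ z hz => by
      have h1 := congrArg (· ≫ biprod.fst) hz
      have h2 := congrArg (· ≫ biprod.snd) hz
      simp only [Category.assoc, Biprod.ofComponents_fst, Biprod.ofComponents_snd, comp_zero,
        add_zero, zero_comp, Preadditive.comp_add] at h1 h2
      have h1' : z ≫ biprod.fst = 0 := by
        rw [← cancel_mono R.a₂, Category.assoc, h1, zero_comp]
      rw [← Category.assoc, h1', zero_comp, zero_add] at h2
      ext
      · rw [h1', zero_comp]
      · rw [← cancel_mono S.a₂, Category.assoc, h2, zero_comp, zero_comp])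
    (fun T _ z hz => by
      obtain ⟨z₁, z₂, rfl⟩ : ∃ z₁ z₂, z = biprod.lift z₁ z₂ :=
        ⟨_, _, (biprod.hom_ext _ _ (biprod.lift_fst _ _) (biprod.lift_snd _ _)).symm⟩
      have h1 := congrArg (· ≫ biprod.fst) hz
      have h2 := congrArg (· ≫ biprod.snd) hz
      simp only [Category.assoc, Biprod.ofComponents_fst, Biprod.ofComponents_snd, comp_zero,
        add_zero, zero_comp, Preadditive.comp_add, biprod.lift_fst_assoc,
        biprod.lift_snd_assoc] at h1 h2
      obtain ⟨s, rfl⟩ := R.lift₁ z₁ h1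
      obtain ⟨t, ht⟩ := S.lift₁ (z₂ - s ≫ y) (by
        rw [Category.assoc, eq_neg_of_add_eq_zero_left hy, Preadditive.comp_neg,
          neg_add_eq_sub] at h2
        rw [Preadditive.sub_comp, Category.assoc, h2])
      refine ⟨biprod.lift s t, ?_⟩
      ext <;> simp [ht])
    (fun T _ z hz => by
      obtain ⟨z₁, z₂, rfl⟩ : ∃ z₁ z₂, z = biprod.lift z₁ z₂ :=
        ⟨_, _, (biprod.hom_ext _ _ (biprod.lift_fst _ _) (biprod.lift_snd _ _)).symm⟩
      rw [biprod.lift_desc, ← Category.assoc] at hz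
      obtain ⟨w, hw, hw'⟩ := R.exists_of_comp_ext_eq_zero f _ _ hz
      obtain ⟨s, rfl⟩ : ∃ s, s ≫ R.π = w := ⟨_, Projective.factorThru_comp w R.π⟩
      rw [Category.assoc, π_ι] at hw
      obtain ⟨t, ht⟩ := S.lift₀ (z₂ - s ≫ x) (by
        rw [Category.assoc, hf, Preadditive.comp_neg, neg_inj] at hw'
        rw [Preadditive.sub_comp, Category.assoc, hw', sub_self])
      refine ⟨biprod.lift s t, ?_⟩
      ext <;> simp [ht, hw])
    (fun T _ z => by
      obtain ⟨s, t, rfl⟩ := R.exists_ext_lift f z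
      obtain ⟨t, rfl⟩ := S.lift t
      exact ⟨biprod.lift s t, by simp⟩)

/-- The twisted sum differs from the folded horseshoe resolution only in the entries of ℤ-degree -1,
and a shear by θ removes them. -/
lemma nonempty_tw_iso_complexC (g : C2.Cocycle R.complexC.obj S.complexC.obj) :
    Nonempty ((twP g).obj ≅ (extRes (extHom R S g) (upper g ≫ biprod.fst) (biprod.inr ≫ lower g)
      (by rw [π_extHom, Category.assoc]) (by simpa using (cocycle_mem g).2.2.2)).complexC.obj) := by
  obtain ⟨θ, hθ, hθ'⟩ := exists_homotopy g
  -- Regroups the four summands and shears R.P₀ into S.P₂ by θ.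
  let e : (R.P₀ ⊞ R.P₂) ⊞ (S.P₀ ⊞ S.P₂) ≅ (R.P₀ ⊞ S.P₀) ⊞ (R.P₂ ⊞ S.P₂) :=
    { hom := biprod.lift (biprod.map biprod.fst biprod.fst)
        (biprod.map biprod.snd biprod.snd + biprod.fst ≫ biprod.fst ≫ θ ≫ biprod.inr)
      inv := biprod.lift (biprod.map biprod.fst biprod.fst)
        (biprod.map biprod.snd biprod.snd - biprod.fst ≫ biprod.fst ≫ θ ≫ biprod.inr)
      hom_inv_id := by ext <;> simp
      inv_hom_id := by ext <;> simp }
  refine ⟨C2.isoMk (M := C2.tw g) (N := (extRes (extHom R S g) (upper g ≫ biprod.fst)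
    (biprod.inr ≫ lower g) (by rw [π_extHom, Category.assoc])
    (by simpa using (cocycle_mem g).2.2.2)).complexC.obj) (Iso.refl (R.P₁ ⊞ S.P₁)) e ?_ ?_⟩
  · change Biprod.ofComponents (biprod.lift R.a₁ 0) (upper g) 0 (biprod.lift S.a₁ 0) ≫ e.hom =
      𝟙 (R.P₁ ⊞ S.P₁) ≫ biprod.lift (Biprod.ofComponents R.a₁ (upper g ≫ biprod.fst) 0 S.a₁) 0
    ext <;> simp [e, hθ']
  · change Biprod.ofComponents (biprod.desc 0 R.a₂) (lower g) 0 (biprod.desc 0 S.a₂) ≫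
        𝟙 (R.P₁ ⊞ S.P₁) = e.hom ≫ biprod.desc 0
          (Biprod.ofComponents R.a₂ (biprod.inr ≫ lower g) 0 S.a₂)
    ext <;> simp [e, hθ]

end ProjRes

end Multiplicativity

/-! ### Comparison of the two products. -/

section EmbeddingMultiplicative

set_option linter.unusedSectionVars false

variable {𝒜 : Type u} [Category.{v} 𝒜] [Abelian 𝒜] {A C : 𝒜}
  (k : Type w) [Field k] [Finite k] [Linear k 𝒜] [∀ X Y : 𝒜, Finite (X ⟶ Y)]

lemma homDim_of_shortExact {X : 𝒜} {i : C ⟶ X} {p : X ⟶ A} {h : i ≫ p = 0}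
    (hS : (ShortComplex.mk i p h).ShortExact) (T : 𝒜) [Projective T] :
    homDim k T X = homDim k T A + homDim k T C := by
  have : ∀ X Y : 𝒜, Module.Finite k (X ⟶ Y) := fun _ _ => Module.Finite.of_finite
  have hi : Mono i := hS.mono_f
  have hp : Epi p := hS.epi_g
  have := finrank_of_exact_sequence k (Linear.rightComp k T i) (Linear.rightComp k T p)
    (0 : (T ⟶ A) →ₗ[k] PUnit) ?_ ?_ ?_ (fun _ => rfl) ?_ (fun x => ⟨0, rfl⟩)
  · rw [Module.finrank_zero_of_subsingleton] at this
    unfold homDim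
    push_cast at this
    omega
  · intro x hx
    change x ≫ i = 0 at hx
    rwa [← cancel_mono i, zero_comp]
  · intro x
    change (x ≫ i) ≫ p = 0
    rw [Category.assoc, h, comp_zero]
  · intro x hx
    exact shortExact_lift hS x hx
  · intro x _
    exact ⟨Projective.factorThru x p, Projective.factorThru_comp x p⟩

namespace ProjRes

variable (R : ProjRes A) (S : ProjRes C)

/-- The factors [K_{P₂}] and [K_{P₂}^*]⁻¹ contribute the same exponent, hence the coefficient 2;
[K_{P₁}]⁻¹ contributes with the opposite sign. -/
lemma cls_mul_torus (M : C2P 𝒜) : DH.cls k M * (S.torus k : DH k 𝒜) =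
    tt k ^ ((chiL k S.P₁ M.obj + chiR k S.P₁ M.obj) - 2 * (chiL k S.P₂ M.obj + chiR k S.P₂ M.obj)) •
      ((S.torus k : DH k 𝒜) * DH.cls k M) := by
  unfold torus
  rw [Units.val_mul, Units.val_mul, ← mul_assoc, ← mul_assoc, DH.cls_mul_uK_inv, smul_mul_assoc,
    smul_mul_assoc, mul_assoc _ (DH.cls k M), DH.cls_mul_uK, mul_smul_comm, smul_mul_assoc,
    ← mul_assoc _ _ (DH.cls k M), mul_assoc _ (DH.cls k M), DH.cls_mul_uKs_inv, mul_smul_comm,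
    smul_smul, smul_smul, ← tt_add, ← tt_add, ← mul_assoc _ _ (DH.cls k M)]
  congr 2
  ring

variable [EnoughProjectives 𝒜]

lemma torus_extRes (f : R.K ⟶ C) (x : R.P₁ ⟶ S.P₀) (y : R.P₂ ⟶ S.P₁)
    (hf : R.π ≫ f = -(x ≫ S.a₀)) (hy : R.a₂ ≫ x + y ≫ S.a₁ = 0) :
    (extRes f x y hf hy).torus k = R.torus k * S.torus k := by
  change (DH.uK k (R.P₁ ⊞ S.P₁))⁻¹ * DH.uK k (R.P₂ ⊞ S.P₂) * (DH.uKs k (R.P₂ ⊞ S.P₂))⁻¹ = _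
  have h1 := R.commute_torus_uK k S.P₁
  have h2 := R.commute_torus_uK k S.P₂
  have h3 := R.commute_torus_uKs k S.P₂
  rw [DH.uK_biprod, DH.uK_biprod, DH.uKs_biprod]
  unfold torus at h1 h2 h3 ⊢
  have e1 := (DH.uK_comm_uK k R.P₁ S.P₁).eq
  have c1 := DH.uK_comm_uK k R.P₂ S.P₁
  have c2 := DH.uKs_comm_uK k R.P₂ S.P₁
  have c3 := DH.uKs_comm_uK k R.P₂ S.P₂
  have c4 := DH.uKs_comm_uKs k R.P₂ S.P₂
  rw [e1, mul_inv_rev, c4.eq, mul_inv_rev]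
  simp only [mul_assoc]
  congr 1
  rw [← mul_assoc (DH.uKs k R.P₂)⁻¹, (c2.inv_left.inv_right).eq]
  simp only [mul_assoc]
  rw [← mul_assoc (DH.uK k R.P₂) (DH.uK k S.P₁)⁻¹, c1.inv_right.eq]
  simp only [mul_assoc]
  congr 2
  rw [← mul_assoc, ← mul_assoc, c3.inv_left.eq]

lemma homDim_ext (f : R.K ⟶ C) (T : 𝒜) [Projective T] :
    homDim k T (R.ext f) = homDim k T A + homDim k T C :=
  homDim_of_shortExact k (R.ext_shortExact f) T

/-- Moving the torus of C past C_A leaves a sum over cocycles of terms which depend only on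
`extHom`. The result has the shape of the product formula in H_tw(𝒜), and `E'` frees the summands
from a chosen resolution of each extension. -/
theorem E_mul_E (R : ProjRes A) (S : ProjRes C) [Fintype (R.K ⟶ C)] {E' : 𝒜 → DH k 𝒜}
    (hE : ∀ {X : 𝒜} (T : ProjRes X), T.E k = E' X) :
    E' A * E' C = tt k ^ (eulerForm k A C - 2 * homDim k R.P₀ C) •
      ∑ f : R.K ⟶ C, E' (R.ext f) := by
  have key : ∀ g : C2.Cocycle R.complexC.obj S.complexC.obj,
      (R.torus k : DH k 𝒜) * (S.torus k : DH k 𝒜) * DH.cls k (twP g) =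
        tt k ^ (-((homDim k R.P₁ A + homDim k R.P₁ C + homDim k S.P₁ A + homDim k S.P₁ C)
          - 2 * (homDim k R.P₂ A + homDim k R.P₂ C + homDim k S.P₂ A + homDim k S.P₂ C))) •
            E' (R.ext (extHom R S g)) := by
    intro g
    have hx : R.π ≫ extHom R S g = -((upper g ≫ biprod.fst) ≫ S.a₀) := by
      rw [π_extHom, Category.assoc]
    have hy : R.a₂ ≫ (upper g ≫ biprod.fst) + (biprod.inr ≫ lower g) ≫ S.a₁ = 0 := by
      simpa using (cocycle_mem g).2.2.2
    rw [DH.cls_congr k (nonempty_tw_iso_complexC g), ← hE (extRes _ _ _ hx hy), E_eq, smul_smul,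
      ← tt_add, torus_extRes, Units.val_mul]
    have : ∀ n : ℤ, n = 0 → ∀ x : DH k 𝒜, x = tt k ^ n • x := fun n hn x => by
      rw [hn, zpow_zero, one_smul]
    -- The exponents cancel since Hom(P, -) is additive on the extension for every projective P.
    refine this _ ?_ _
    change _ + (homDim k (R.P₁ ⊞ S.P₁) _ - 2 * homDim k (R.P₂ ⊞ S.P₂) _) = 0
    rw [homDim_biprod_left, homDim_biprod_left, homDim_ext, homDim_ext, homDim_ext, homDim_ext]
    ring
  rw [← hE R, ← hE S, E_eq, E_eq, smul_mul_smul_comm, mul_assoc, ← mul_assoc (DH.cls k R.complexC),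
    cls_mul_torus, smul_mul_assoc, mul_assoc, DH.cls_mul_cls, mul_smul_comm, mul_smul_comm,
    mul_smul_comm, smul_smul, smul_smul, ← mul_assoc, Finset.mul_sum,
    Finset.sum_congr rfl (fun g _ => key g), ← Finset.smul_sum, smul_smul,
    sum_comp_of_surjective (extHom R S) extHom_surjective (fun f => E' (R.ext f)),
    ← Nat.cast_smul_eq_nsmul ℂ, smul_smul, card_ker_extHom k, ← tt_add, ← tt_add, ← tt_add,
    ← tt_add, ← tt_add]
  congr 2
  have e : homDim₂ k R.complexC.obj S.complexC.obj =
      (homDim k R.P₀ S.P₀ + homDim k R.P₀ S.P₂) + (homDim k R.P₂ S.P₀ + homDim k R.P₂ S.P₂)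
        + homDim k R.P₁ S.P₁ := by
    change homDim k (R.P₀ ⊞ R.P₂) (S.P₀ ⊞ S.P₂) + homDim k R.P₁ S.P₁ = _
    rw [homDim_biprod_left, homDim_biprod_right, homDim_biprod_right]
  -- Once Hom(R.P_i, C) is expanded along the resolution `S`, the identity of exponents is linear in
  -- the dimensions.
  rw [e, chiL_complexC, chiL_complexC, chiR_complexC, chiR_complexC, R.eulerForm_eq,
    S.homDim_eq k R.P₀, S.homDim_eq k R.P₁, S.homDim_eq k R.P₂]
  ring

end ProjRes

end EmbeddingMultiplicative

/-! ### The homomorphism I_+. -/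

section Embedding

set_option linter.unusedSectionVars false

variable {𝒜 : Type u} [Category.{v} 𝒜] [Abelian 𝒜] {A : 𝒜}
  (k : Type w) [Field k] [Finite k] [Linear k 𝒜] [∀ X Y : 𝒜, Finite (X ⟶ Y)]

lemma DH.cls_zero : DH.cls k (C2P.zero : C2P 𝒜) = 1 := DH.ofLinear_one k

lemma DH.cls_eq_one (M : C2P 𝒜) (h₁ : IsZero (M.obj.X 1)) (h₀ : IsZero (M.obj.X 0)) :
    DH.cls k M = 1 := by
  rw [← DH.cls_zero]
  exact DH.cls_congr k ⟨C2.isoMk (N := (C2P.zero : C2P 𝒜).obj) (h₁.iso (isZero_zero 𝒜))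
    (h₀.iso (isZero_zero 𝒜)) (h₁.eq_of_src _ _) (h₀.eq_of_src _ _)⟩

namespace ProjRes

lemma E_mapIso (R : ProjRes A) {A' : 𝒜} (e : A ≅ A') : (R.mapIso e).E k = R.E k := by
  rw [E_eq, E_eq, homDim_congr k (Iso.refl R.P₁) e, homDim_congr k (Iso.refl R.P₂) e]
  rfl

variable [EnoughProjectives 𝒜]

variable (𝒜) in
/-- The zero resolution of the zero object. -/
def zero : ProjRes (0 : 𝒜) :=
  ofLifting 0 0 0 0 0 0 (by simp) (by simp) (fun _ _ _ _ => (isZero_zero 𝒜).eq_of_tgt _ _)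
    (fun _ _ _ _ => ⟨0, (isZero_zero 𝒜).eq_of_tgt _ _⟩)
    (fun _ _ _ _ => ⟨0, (isZero_zero 𝒜).eq_of_tgt _ _⟩)
    (fun _ _ _ => ⟨0, (isZero_zero 𝒜).eq_of_tgt _ _⟩)

lemma E_zero : (zero 𝒜).E k = 1 := by
  have h : IsZero (0 : 𝒜) := isZero_zero 𝒜
  have hK : DH.uK k (0 : 𝒜) = 1 := Units.ext (DH.cls_eq_one k _ h h)
  have hKs : DH.uKs k (0 : 𝒜) = 1 := Units.ext (DH.cls_eq_one k _ h h)
  have ht : (zero 𝒜).torus k = 1 := by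
    change (DH.uK k (0 : 𝒜))⁻¹ * DH.uK k (0 : 𝒜) * (DH.uKs k (0 : 𝒜))⁻¹ = 1
    rw [hK, hKs]
    simp
  have hC : DH.cls k (zero 𝒜).complexC = 1 := by
    refine DH.cls_eq_one k _ h ?_
    change IsZero ((0 : 𝒜) ⊞ 0)
    simpa using h
  rw [E_eq, ht, hC]
  change tt k ^ (homDim k (0 : 𝒜) 0 - 2 * homDim k (0 : 𝒜) 0) • _ = _
  rw [homDim_zero_left k h]
  simp

end ProjRes

variable [EnoughProjectives 𝒜] (hres : ∀ X : 𝒜, Nonempty (ProjRes X))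

/-- The linear map `[A] ↦ E_A`. -/
def embedding : TwHall k 𝒜 →ₗ[ℂ] DH k 𝒜 :=
  Finsupp.linearCombination ℂ fun a : IsoCl 𝒜 => (hres a.out).some.E k

lemma embedding_cls (R : ProjRes A) : embedding k hres (TwHall.cls k A) = R.E k := by
  obtain ⟨e⟩ : Nonempty (A ≅ (isoClass A).out) := Quotient.exact (Quotient.out_eq (isoClass A)).symm
  refine Eq.trans (Finsupp.linearCombination_single _ _ _) ?_
  rw [one_smul, ← R.E_mapIso k e]
  exact ProjRes.E_eq_E k _ _

lemma TwHall.basisElt_eq (a : IsoCl 𝒜) : ConstAlg.basisElt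
    (fun a c b : IsoCl 𝒜 => tt k ^ eulerForm k a.out c.out * hallNumber a.out c.out b.out)
      (isoClass 0) a = TwHall.cls k a.out := by
  unfold TwHall.cls
  rw [show isoClass a.out = a from Quotient.out_eq a]

lemma embedding_one : embedding k hres 1 = 1 :=
  (embedding_cls k hres (ProjRes.zero 𝒜)).trans (ProjRes.E_zero k)

lemma embedding_cls_mul_cls (A C : 𝒜) :
    embedding k hres (TwHall.cls k A * TwHall.cls k C) =
      embedding k hres (TwHall.cls k A) * embedding k hres (TwHall.cls k C) := by
  obtain ⟨R⟩ := hres A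
  obtain ⟨S⟩ := hres C
  have := Fintype.ofFinite (R.K ⟶ C)
  rw [R.cls_mul_cls k, map_smul, map_sum]
  exact (ProjRes.E_mul_E k R S (E' := fun X => embedding k hres (TwHall.cls k X))
    (fun T => (embedding_cls k hres T).symm)).symm

theorem embedding_mul (x y : TwHall k 𝒜) :
    embedding k hres (x * y) = embedding k hres x * embedding k hres y := by
  induction x using ConstAlg.induction with
  | h0 => simp
  | hadd x x' hx hx' => simp [add_mul, hx, hx']
  | hsmul r x hx => simp [smul_mul_assoc, hx]
  | hb a =>
    induction y using ConstAlg.induction with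
    | h0 => simp
    | hadd y y' hy hy' => simp [mul_add, hy, hy']
    | hsmul r y hy => simp [mul_smul_comm, hy]
    | hb c =>
      rw [TwHall.basisElt_eq, TwHall.basisElt_eq]
      exact embedding_cls_mul_cls k hres _ _

/-- The algebra homomorphism `[A] ↦ E_A`. -/
def embeddingHom : TwHall k 𝒜 →ₙₐ[ℂ] DH k 𝒜 where
  toFun := embedding k hres
  map_smul' := map_smul _
  map_zero' := map_zero _
  map_add' := map_add _
  map_mul' := embedding_mul k hres

end Embedding

/-! ### Structure of acyclic complexes of projectives. -/

section Acyclic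

set_option linter.unusedSectionVars false

variable {𝒜 : Type u} [Category.{v} 𝒜] [Abelian 𝒜]

lemma comp_eq_of_comp_factorThruImage {T X Y : 𝒜} {x : T ⟶ X} {f : X ⟶ Y} {y : T ⟶ image f}
    (h : x ≫ factorThruImage f = y) : x ≫ f = y ≫ image.ι f := by
  rw [← h, Category.assoc, image.fac]

lemma shortExact_image {X Y Z : 𝒜} {f : X ⟶ Y} {g : Y ⟶ Z} {w : f ≫ g = 0}
    (h : (ShortComplex.mk f g w).Exact) :
    ∃ w' : image.ι f ≫ factorThruImage g = 0,
      (ShortComplex.mk (image.ι f) (factorThruImage g) w').ShortExact := by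
  have w' : image.ι f ≫ factorThruImage g = 0 := by
    rw [← cancel_epi (factorThruImage f), ← cancel_mono (image.ι g)]
    simp [w]
  refine ⟨w', ShortComplex.ShortExact.mk' ?_ (inferInstanceAs (Mono (image.ι f)))
    (inferInstanceAs (Epi (factorThruImage g)))⟩
  rw [ShortComplex.exact_iff_exact_up_to_refinements] at h ⊢
  intro T x hx
  have hx' : x ≫ factorThruImage g = 0 := hx
  obtain ⟨T', π, hπ, y, hy⟩ := h x
    ((comp_eq_of_comp_factorThruImage hx').trans zero_comp)
  refine ⟨T', π, hπ, y ≫ factorThruImage f, ?_⟩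
  change π ≫ x = (y ≫ factorThruImage f) ≫ image.ι f
  rw [Category.assoc, image.fac]
  exact hy

lemma exists_splitting {A C X : 𝒜} {i : C ⟶ X} {p : X ⟶ A} {h : i ≫ p = 0}
    (hS : (ShortComplex.mk i p h).ShortExact) [Projective A] :
    ∃ (s : A ⟶ X) (e : A ⊞ C ≅ X), s ≫ p = 𝟙 A ∧ e.hom = biprod.desc s i := by
  have : Projective (ShortComplex.mk i p h).X₃ := ‹Projective A›
  let σ := hS.splittingOfProjective
  have h1 : σ.s ≫ p = 𝟙 A := σ.s_g
  have h2 : i ≫ σ.r = 𝟙 C := σ.f_r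
  have h3 : σ.s ≫ σ.r = 0 := σ.s_r
  have h4 : σ.r ≫ i + p ≫ σ.s = 𝟙 X := σ.id
  generalize σ.s = s at h1 h3 h4
  generalize σ.r = r at h2 h3 h4
  exact ⟨s, { hom := biprod.desc s i
              inv := biprod.lift p r
              hom_inv_id := by ext <;> simp [h1, h2, h3, h]
              inv_hom_id := by rw [biprod.lift_desc, add_comm, h4] }, h1, rfl⟩

/-- In a 2-periodic exact complex of projectives the two images are syzygies of each other. The
bound on projective dimension therefore drops at each turn, and two turns bring it from 2 to 0. -/
lemma projective_image (hgd : ∀ X : 𝒜, HasProjectiveDimensionLE X 2) (M : C2P 𝒜)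
    (hM : M.obj.Acyclic) :
    Projective (image (M.obj.d 1 0)) ∧ Projective (image (M.obj.d 0 1)) := by
  rw [C2.acyclic_iff] at hM
  obtain ⟨w₁, h₁⟩ := shortExact_image hM.1
  obtain ⟨w₀, h₀⟩ := shortExact_image hM.2
  have p₁ : Projective (M.obj.X 1) := M.property 1
  have p₀ : Projective (M.obj.X 0) := M.property 0
  have step : ∀ {X Y P : 𝒜} [Projective P] {i : X ⟶ P} {p : P ⟶ Y} {w : i ≫ p = 0}
      (_ : (ShortComplex.mk i p w).ShortExact) (n : ℕ), HasProjectiveDimensionLT Y (n + 2) →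
        HasProjectiveDimensionLT X (n + 1) := fun {X Y P} hP i p w h n hY =>
    h.hasProjectiveDimensionLT_X₁ (n + 1)
      (inferInstanceAs (HasProjectiveDimensionLT P (n + 1))) hY
  have a₁ : HasProjectiveDimensionLT (image (M.obj.d 0 1)) 2 := step h₁ 1 (hgd _)
  have a₀ : HasProjectiveDimensionLT (image (M.obj.d 1 0)) 2 := step h₀ 1 (hgd _)
  have b₁ : HasProjectiveDimensionLT (image (M.obj.d 0 1)) 1 := step h₁ 0 a₀
  have b₀ : HasProjectiveDimensionLT (image (M.obj.d 1 0)) 1 := step h₀ 0 a₁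
  exact ⟨projective_iff_hasProjectiveDimensionLT_one.2 b₀,
    projective_iff_hasProjectiveDimensionLT_one.2 b₁⟩

/-- Both short exact sequences of images split, and each image then occurs once in either degree,
joined to itself by the identity. -/
lemma nonempty_iso_of_acyclic (M : C2P 𝒜) (hM : M.obj.Acyclic)
    [Projective (image (M.obj.d 1 0))] [Projective (image (M.obj.d 0 1))] :
    Nonempty (M.obj ≅ (dsum (complexK (image (M.obj.d 1 0)))
      (complexKstar (image (M.obj.d 0 1)))).obj) := by
  rw [C2.acyclic_iff] at hM
  obtain ⟨w₁, h₁⟩ := shortExact_image hM.1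
  obtain ⟨w₀, h₀⟩ := shortExact_image hM.2
  obtain ⟨s₁, e₁, hs₁, he₁⟩ := exists_splitting h₁
  obtain ⟨s₀, e₀, hs₀, he₀⟩ := exists_splitting h₀
  let e₀' := biprod.braiding (image (M.obj.d 1 0)) (image (M.obj.d 0 1)) ≪≫ e₀
  refine ⟨(C2.isoMk (M := (dsum (complexK (image (M.obj.d 1 0)))
      (complexKstar (image (M.obj.d 0 1)))).obj) (N := M.obj) e₁ e₀' ?_ ?_).symm⟩
  · change Biprod.ofComponents (𝟙 (image (M.obj.d 1 0))) 0 0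
      (0 : image (M.obj.d 0 1) ⟶ image (M.obj.d 0 1)) ≫ e₀'.hom = e₁.hom ≫ M.obj.d 1 0
    rw [he₁]
    apply biprod.hom_ext'
    · have : s₁ ≫ M.obj.d 1 0 = image.ι (M.obj.d 1 0) :=
        (comp_eq_of_comp_factorThruImage hs₁).trans (Category.id_comp _)
      simp [e₀', he₀, this]
    · have : image.ι (M.obj.d 0 1) ≫ M.obj.d 1 0 = 0 :=
        (comp_eq_of_comp_factorThruImage w₁).trans zero_comp
      simp [e₀', he₀, this]
  · change Biprod.ofComponents (0 : image (M.obj.d 1 0) ⟶ image (M.obj.d 1 0)) 0 0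
      (𝟙 (image (M.obj.d 0 1))) ≫ e₁.hom = e₀'.hom ≫ M.obj.d 0 1
    apply biprod.hom_ext'
    · have : image.ι (M.obj.d 1 0) ≫ M.obj.d 0 1 = 0 :=
        (comp_eq_of_comp_factorThruImage w₀).trans zero_comp
      simp [e₀', he₀, he₁, this]
    · have : s₀ ≫ M.obj.d 0 1 = image.ι (M.obj.d 0 1) :=
        (comp_eq_of_comp_factorThruImage hs₀).trans (Category.id_comp _)
      simp [e₀', he₀, he₁, this]

lemma nonempty_image_iso_of_fac {X Y X' Y' : 𝒜} {f : X ⟶ Y} {f' : X' ⟶ Y'} (e : X ≅ X')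
    (e' : Y ≅ Y') (h : f ≫ e'.hom = e.hom ≫ f') : Nonempty (image f ≅ image f') := by
  have : Mono (image.ι f ≫ e'.hom) := inferInstance
  have : Epi (e.inv ≫ factorThruImage f) := inferInstance
  have : StrongEpi (e.inv ≫ factorThruImage f) := strongEpi_of_epi _
  exact ⟨image.isoStrongEpiMono (e.inv ≫ factorThruImage f) (image.ι f ≫ e'.hom)
    (by simp [h])⟩

lemma nonempty_image_neg_iso {X Y : 𝒜} (f : X ⟶ Y) : Nonempty (image (-f) ≅ image f) := by
  have : Epi (-factorThruImage f) := Preadditive.epi_of_cancel_zero _ fun g hg => by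
    rwa [Preadditive.neg_comp, neg_eq_zero, ← comp_zero (f := factorThruImage f),
      cancel_epi] at hg
  have : StrongEpi (-factorThruImage f) := strongEpi_of_epi _
  exact ⟨(image.isoStrongEpiMono (-factorThruImage f) (image.ι f) (by simp)).symm⟩

/-- The shift exchanges the two differentials up to sign, and a sign does not change an image. -/
lemma nonempty_image_iso_of_iso_star {M : C2 𝒜} (e : M ≅ M.star) :
    Nonempty (image (M.d 1 0) ≅ image (M.d 0 1)) := by
  obtain ⟨φ⟩ := nonempty_image_iso_of_fac (C2.appIso e 1) (C2.appIso e 0) (f := M.d 1 0)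
    (f' := M.star.d 1 0) (e.hom.comm 1 0).symm
  obtain ⟨ψ⟩ := nonempty_image_neg_iso (M.d 0 1)
  exact ⟨φ ≪≫ ψ⟩

end Acyclic

/-! ### A representation of DH_red(𝒜). -/

section Representation

set_option linter.unusedSectionVars false

section LocLift

variable {H : Type u} [NonUnitalNonAssocRing H] [One H] [Module ℂ H] {S : Set H}
  {D : Type w} [Ring D] [Algebra ℂ D]

/-- The universal property of the localisation. -/
def Loc.lift (ρ : H →ₗ[ℂ] D) (h1 : ρ 1 = 1) (hmul : ∀ x y, ρ (x * y) = ρ x * ρ y)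
    (hS : ∀ s ∈ S, IsUnit (ρ s)) : Loc H S →ₐ[ℂ] D :=
  RingQuot.liftAlgHom ℂ ⟨FreeAlgebra.lift ℂ
    (Sum.elim ρ fun s : S => (((hS s.1 s.2).unit⁻¹ : Dˣ) : D)), fun x y h => by
      induction h with
      | add x y => simp
      | smul c x => simp
      | one => simp [h1]
      | mul x y => simp [hmul]
      | mul_inv s => simp
      | inv_mul s => simp⟩

lemma Loc.lift_of (ρ : H →ₗ[ℂ] D) (h1 : ρ 1 = 1) (hmul : ∀ x y, ρ (x * y) = ρ x * ρ y)
    (hS : ∀ s ∈ S, IsUnit (ρ s)) (x : H) : Loc.lift ρ h1 hmul hS (Loc.of H S x) = ρ x := by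
  unfold Loc.lift Loc.of
  rw [RingQuot.liftAlgHom_mkAlgHom_apply]
  simp

end LocLift

variable (k : Type w) [Field k] [Finite k] {𝒜 : Type u} [Category.{v} 𝒜] [Abelian 𝒜] [Linear k 𝒜]
  [∀ X Y : 𝒜, Finite (X ⟶ Y)]

variable (𝒜) in
/-- The subspace by which right multiplication by `[K_P]` and `[K_P^*]` is trivialised. -/
def trivSub : Submodule ℂ (TwHallC2P k 𝒜) :=
  Submodule.span ℂ {y | ∃ (x : TwHallC2P k 𝒜) (P : 𝒜) (_ : Projective P),
    y = x * TwHallC2P.cls k (complexK P) - x ∨ y = x * TwHallC2P.cls k (complexKstar P) - x}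

/-- Left and right multiplications commute by associativity, so dividing by right multiplications
leaves an action from the left. -/
lemma trivSub_le_comap (h : TwHallC2P k 𝒜) :
    trivSub k 𝒜 ≤ (trivSub k 𝒜).comap (LinearMap.mulLeft ℂ h) := by
  refine Submodule.span_le.2 ?_
  rintro _ ⟨x, P, hP, rfl | rfl⟩
  · refine Submodule.subset_span ⟨h * x, P, hP, Or.inl ?_⟩
    rw [LinearMap.mulLeft_apply, mul_sub, TwHallC2P.mul_assoc]
  · refine Submodule.subset_span ⟨h * x, P, hP, Or.inr ?_⟩
    rw [LinearMap.mulLeft_apply, mul_sub, TwHallC2P.mul_assoc]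

variable (𝒜) in
/-- The quotient of `H_tw(C₂(𝒫))` by the right multiplications by `[K_P]` and `[K_P^*]`. -/
abbrev TrivQuot : Type _ := TwHallC2P k 𝒜 ⧸ trivSub k 𝒜

namespace TrivQuot

/-- The class in `TrivQuot` of a complex. -/
def cls (M : C2P 𝒜) : TrivQuot k 𝒜 := (trivSub k 𝒜).mkQ (TwHallC2P.cls k M)

lemma mkQ_mul_complexK (x : TwHallC2P k 𝒜) (P : 𝒜) [hP : Projective P] :
    (trivSub k 𝒜).mkQ (x * TwHallC2P.cls k (complexK P)) = (trivSub k 𝒜).mkQ x :=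
  (Submodule.Quotient.eq _).2 (Submodule.subset_span ⟨x, P, hP, Or.inl rfl⟩)

lemma mkQ_mul_complexKstar (x : TwHallC2P k 𝒜) (P : 𝒜) [hP : Projective P] :
    (trivSub k 𝒜).mkQ (x * TwHallC2P.cls k (complexKstar P)) = (trivSub k 𝒜).mkQ x :=
  (Submodule.Quotient.eq _).2 (Submodule.subset_span ⟨x, P, hP, Or.inr rfl⟩)

lemma hom_ext {V : Type*} [AddCommGroup V] [Module ℂ V] {f g : TrivQuot k 𝒜 →ₗ[ℂ] V}
    (h : ∀ M : C2P 𝒜, f (cls k M) = g (cls k M)) : f = g := by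
  refine Submodule.linearMap_qext _ (LinearMap.ext fun x => ?_)
  induction x using ConstAlg.induction with
  | h0 => simp
  | hadd x y hx hy => rw [map_add, map_add, hx, hy]
  | hsmul c x hx => rw [map_smul, map_smul, hx]
  | hb m =>
    have := h m.out
    unfold cls TwHallC2P.cls at this
    rw [show isoClass m.out = m from Quotient.out_eq m] at this
    exact this

variable (𝒜) in
/-- The action of `H_tw(C₂(𝒫))` on `TrivQuot` by left multiplication. -/
def action : TwHallC2P k 𝒜 →ₗ[ℂ] Module.End ℂ (TrivQuot k 𝒜) where
  toFun h := (trivSub k 𝒜).mapQ _ (LinearMap.mulLeft ℂ h) (trivSub_le_comap k h)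
  map_add' h h' := by
    refine Submodule.linearMap_qext _ (LinearMap.ext fun x => ?_)
    simp [add_mul]
  map_smul' c h := by
    refine Submodule.linearMap_qext _ (LinearMap.ext fun x => ?_)
    simp [smul_mul_assoc]

lemma action_mkQ (h x : TwHallC2P k 𝒜) :
    action k 𝒜 h ((trivSub k 𝒜).mkQ x) = (trivSub k 𝒜).mkQ (h * x) := rfl

lemma action_mul (h h' : TwHallC2P k 𝒜) : action k 𝒜 (h * h') = action k 𝒜 h * action k 𝒜 h' := by
  refine Submodule.linearMap_qext _ (LinearMap.ext fun x => ?_)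
  change action k 𝒜 (h * h') ((trivSub k 𝒜).mkQ x) =
    action k 𝒜 h (action k 𝒜 h' ((trivSub k 𝒜).mkQ x))
  rw [action_mkQ, action_mkQ, action_mkQ, TwHallC2P.mul_assoc]

/-- Moving K_P from the left of [M] to its right costs a power of t, and on the right it is trivial
in the quotient. For K_P^* the power is inverse, so the relations of DH_red can hold in this module.
-/
lemma action_complexK (P : 𝒜) [Projective P] (M : C2P 𝒜) :
    action k 𝒜 (TwHallC2P.cls k (complexK P)) (cls k M) =
      tt k ^ (chiL k P M.obj + chiR k P M.obj) • cls k M := by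
  have h := mkQ_mul_complexK k (TwHallC2P.cls k M) P
  rw [TwHallC2P.mul_complexK, map_smul] at h
  unfold cls
  rw [action_mkQ, TwHallC2P.complexK_mul, map_smul, ← h, smul_smul, ← tt_add]
  congr 2
  ring

lemma action_complexKstar (P : 𝒜) [Projective P] (M : C2P 𝒜) :
    action k 𝒜 (TwHallC2P.cls k (complexKstar P)) (cls k M) =
      tt k ^ (-(chiL k P M.obj + chiR k P M.obj)) • cls k M := by
  have h := mkQ_mul_complexKstar k (TwHallC2P.cls k M) P
  rw [TwHallC2P.mul_complexKstar, map_smul] at h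
  unfold cls
  rw [action_mkQ, TwHallC2P.complexKstar_mul, map_smul, ← h, smul_smul, ← tt_add]
  congr 2
  ring

lemma cls_zero_eq : TwHallC2P.cls k (C2P.zero : C2P 𝒜) = TwHallC2P.cls k (complexK (0 : 𝒜)) := by
  have h : IsZero (0 : 𝒜) := isZero_zero 𝒜
  exact TwHallC2P.cls_congr k ⟨C2.isoMk (M := (C2P.zero : C2P 𝒜).obj)
    (N := (complexK (0 : 𝒜)).obj) (Iso.refl (0 : 𝒜)) (Iso.refl (0 : 𝒜))
    (h.eq_of_src _ _) (h.eq_of_src _ _)⟩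

lemma action_one : action k 𝒜 1 = 1 := by
  refine hom_ext k fun M => ?_
  change action k 𝒜 (TwHallC2P.cls k (C2P.zero : C2P 𝒜)) (cls k M) = cls k M
  have h : IsZero (0 : 𝒜) := isZero_zero 𝒜
  have h' : chiL k (0 : 𝒜) M.obj + chiR k (0 : 𝒜) M.obj = 0 := by
    unfold chiL chiR
    rw [homDim_zero_left k h, homDim_zero_left k h, homDim_zero_right k h, homDim_zero_right k h]
    simp
  rw [cls_zero_eq, action_complexK, h', zpow_zero, one_smul]

/-- The automorphism of `TrivQuot` defined by `[K_P]`, with the inverse `[K_P^*]`. -/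
def unitK (P : 𝒜) [Projective P] : (Module.End ℂ (TrivQuot k 𝒜))ˣ where
  val := action k 𝒜 (TwHallC2P.cls k (complexK P))
  inv := action k 𝒜 (TwHallC2P.cls k (complexKstar P))
  val_inv := by
    refine hom_ext k fun M => ?_
    change action k 𝒜 _ (action k 𝒜 _ (cls k M)) = cls k M
    rw [action_complexKstar, map_smul, action_complexK, smul_smul, ← tt_add, neg_add_cancel,
      zpow_zero, one_smul]
  inv_val := by
    refine hom_ext k fun M => ?_
    change action k 𝒜 _ (action k 𝒜 _ (cls k M)) = cls k M
    rw [action_complexK, map_smul, action_complexKstar, smul_smul, ← tt_add, add_neg_cancel,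
      zpow_zero, one_smul]

lemma unitK_congr {P Q : 𝒜} [Projective P] [Projective Q] (e : P ≅ Q) : unitK k P = unitK k Q := by
  refine Units.ext (congrArg (action k 𝒜) (TwHallC2P.cls_congr k
    ⟨C2.isoMk (M := (complexK P).obj) (N := (complexK Q).obj) e e ?_ ?_⟩))
  · change 𝟙 P ≫ e.hom = e.hom ≫ 𝟙 Q
    simp
  · change (0 : P ⟶ P) ≫ e.hom = e.hom ≫ (0 : Q ⟶ Q)
    simp

lemma action_dsum (P Q : 𝒜) [Projective P] [Projective Q] :
    action k 𝒜 (TwHallC2P.cls k (dsum (complexK P) (complexKstar Q))) =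
      (unitK k P * (unitK k Q)⁻¹ : (Module.End ℂ (TrivQuot k 𝒜))ˣ) := by
  have h := TwHallC2P.mul_complexKstar k (complexK P) Q
  have h₂ : chiR k Q (complexK P).obj = 0 := sub_self _
  rw [h₂, zpow_zero, one_smul] at h
  rw [← h, action_mul]
  rfl

lemma exists_action_acyclic (hgd : ∀ X : 𝒜, HasProjectiveDimensionLE X 2) (M : C2P 𝒜)
    (hM : M.obj.Acyclic) :
    ∃ (_ : Projective (image (M.obj.d 1 0))) (_ : Projective (image (M.obj.d 0 1))),
      action k 𝒜 (TwHallC2P.cls k M) = (unitK k (image (M.obj.d 1 0)) *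
        (unitK k (image (M.obj.d 0 1)))⁻¹ : (Module.End ℂ (TrivQuot k 𝒜))ˣ) := by
  obtain ⟨h₁, h₀⟩ := projective_image hgd M hM
  exact ⟨h₁, h₀, by rw [TwHallC2P.cls_congr k (nonempty_iso_of_acyclic M hM), action_dsum]⟩

variable (hgd : ∀ X : 𝒜, HasProjectiveDimensionLE X 2)

/-- The action of `DH(𝒜)` on `TrivQuot`. -/
def actionDH : DH k 𝒜 →ₐ[ℂ] Module.End ℂ (TrivQuot k 𝒜) :=
  Loc.lift (action k 𝒜) (action_one k) (action_mul k) (by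
    rintro _ ⟨M, hM, rfl⟩
    obtain ⟨h₁, h₀, h⟩ := exists_action_acyclic k hgd M hM
    rw [h]
    exact Units.isUnit _)

lemma actionDH_cls (M : C2P 𝒜) :
    actionDH k hgd (DH.cls k M) = action k 𝒜 (TwHallC2P.cls k M) := Loc.lift_of _ _ _ _ _

/-- The action of `DH_red(𝒜)` on `TrivQuot`. -/
def actionDHred : DHred k 𝒜 →ₐ[ℂ] Module.End ℂ (TrivQuot k 𝒜) :=
  RingQuot.liftAlgHom ℂ ⟨actionDH k hgd, fun x y h => by
    obtain ⟨M, hM, ⟨e⟩⟩ := h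
    obtain ⟨h₁, h₀, h⟩ := exists_action_acyclic k hgd M hM
    obtain ⟨φ⟩ := nonempty_image_iso_of_iso_star e
    -- Self-duality identifies the two images, so the operator has the form u * u⁻¹.
    rw [actionDH_cls, h, unitK_congr k φ, mul_inv_cancel, Units.val_one, map_one]⟩

lemma actionDHred_redMap (x : DH k 𝒜) : actionDHred k hgd (redMap k 𝒜 x) = actionDH k hgd x :=
  RingQuot.liftAlgHom_mkAlgHom_apply _ _ _ _

end TrivQuot

end Representation

/-! ### A functional that detects zeroth homology. -/

section Functional

set_option linter.unusedSectionVars false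

variable (k : Type w) [Field k] [Finite k] {𝒜 : Type u} [Category.{v} 𝒜] [Abelian 𝒜] [Linear k 𝒜]
  [∀ X Y : 𝒜, Finite (X ⟶ Y)]

namespace C2

lemma isZero_homology_of_acyclic {N : C2 𝒜} (hN : N.Acyclic) (i : ZMod 2) :
    IsZero (N.homology i) :=
  (HomologicalComplex.exactAt_iff_isZero_homology N i).1 (hN i)

lemma nonempty_homology_tw_zero_iso (M : C2 𝒜) {N : C2 𝒜} (hN : N.Acyclic) (i : ZMod 2) :
    Nonempty ((tw (0 : Cocycle M N)).homology i ≅ M.homology i) := by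
  let twInl : M ⟶ tw (0 : Cocycle M N) :=
    homMk (N := tw (0 : Cocycle M N)) biprod.inl biprod.inl
      (show M.d 1 0 ≫ biprod.inl = biprod.inl ≫ Biprod.ofComponents (M.d 1 0) 0 0 (N.d 1 0) by simp)
      (show M.d 0 1 ≫ biprod.inl = biprod.inl ≫ Biprod.ofComponents (M.d 0 1) 0 0 (N.d 0 1) by simp)
  let twSnd : tw (0 : Cocycle M N) ⟶ N :=
    homMk (M := tw (0 : Cocycle M N)) biprod.snd biprod.snd
      (show Biprod.ofComponents (M.d 1 0) 0 0 (N.d 1 0) ≫ biprod.snd = biprod.snd ≫ N.d 1 0 by simp)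
      (show Biprod.ofComponents (M.d 0 1) 0 0 (N.d 0 1) ≫ biprod.snd = biprod.snd ≫ N.d 0 1 by simp)
  have h1 : twInl ≫ twFst 0 = 𝟙 M := hom_ext biprod.inl_fst biprod.inl_fst
  have h2 : twFst 0 ≫ twInl + twSnd ≫ twInr 0 = 𝟙 (tw (0 : Cocycle M N)) :=
    hom_ext biprod.total biprod.total
  have h3 : HomologicalComplex.homologyMap twSnd i = 0 :=
    (isZero_homology_of_acyclic hN i).eq_of_tgt _ _
  refine ⟨⟨HomologicalComplex.homologyMap (twFst 0) i, HomologicalComplex.homologyMap twInl i,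
    ?_, ?_⟩⟩
  · have := congrArg (fun f => HomologicalComplex.homologyMap f i) h2
    simpa [HomologicalComplex.homologyMap_add, HomologicalComplex.homologyMap_comp, h3] using this
  · rw [← HomologicalComplex.homologyMap_comp, h1, HomologicalComplex.homologyMap_id]

lemma nonempty_image_biprod_map {X Y X' Y' : 𝒜} (f : X ⟶ Y) (g : X' ⟶ Y') :
    Nonempty (image (Biprod.ofComponents f 0 0 g) ≅ image f ⊞ image g) := by
  have : StrongEpi (biprod.map (factorThruImage f) (factorThruImage g)) := strongEpi_of_epi _
  exact ⟨(image.isoStrongEpiMono (biprod.map (factorThruImage f) (factorThruImage g))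
    (biprod.map (image.ι f) (image.ι g)) (by ext <;> simp)).symm⟩

lemma nonempty_image_id (P : 𝒜) : Nonempty (image (𝟙 P) ≅ P) :=
  ⟨(image.isoStrongEpiMono (𝟙 P) (𝟙 P) (by simp)).symm⟩

/-- The exponent of `t` in the functional which detects the classes `E_A`. -/
def weight (M : C2 𝒜) : ℤ :=
  chiR k (image (M.d 1 0)) M - chiR k (image (M.d 0 1)) M

lemma chiR_congr {P Q : 𝒜} (e : P ≅ Q) {M N : C2 𝒜} (f : M ≅ N) : chiR k P M = chiR k Q N := by
  unfold chiR
  rw [homDim_congr k (appIso f 0) e, homDim_congr k (appIso f 1) e]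

lemma weight_congr {M N : C2 𝒜} (e : M ≅ N) : weight k M = weight k N := by
  obtain ⟨φ⟩ := nonempty_image_iso_of_fac (C2.appIso e 1) (C2.appIso e 0) (f := M.d 1 0)
    (f' := N.d 1 0) (e.hom.comm 1 0).symm
  obtain ⟨ψ⟩ := nonempty_image_iso_of_fac (C2.appIso e 0) (C2.appIso e 1) (f := M.d 0 1)
    (f' := N.d 0 1) (e.hom.comm 0 1).symm
  unfold weight
  rw [chiR_congr k φ e, chiR_congr k ψ e]

lemma chiR_biprod (P Q : 𝒜) (M : C2 𝒜) : chiR k (P ⊞ Q) M = chiR k P M + chiR k Q M := by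
  unfold chiR
  rw [homDim_biprod_right, homDim_biprod_right]
  ring

lemma chiR_isZero {P : 𝒜} (h : IsZero P) (M : C2 𝒜) : chiR k P M = 0 := by
  unfold chiR
  rw [homDim_zero_right k h, homDim_zero_right k h, sub_zero]

lemma chiR_tw (P : 𝒜) {M N : C2 𝒜} (g : Cocycle M N) :
    chiR k P (tw g) = chiR k P M + chiR k P N := by
  change homDim k (M.X 0 ⊞ N.X 0) P - homDim k (M.X 1 ⊞ N.X 1) P = _
  unfold chiR
  rw [homDim_biprod_left, homDim_biprod_left]
  ring

/-- The images of the differentials add, and `N` contributes nothing in the second argument by `h`.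
So the weight changes only by pairing `M` with the new images. -/
lemma weight_dsum (M N : C2P 𝒜) (P Q : 𝒜) (e₁ : image (N.obj.d 1 0) ≅ P)
    (e₀ : image (N.obj.d 0 1) ≅ Q) (h : ∀ T, chiR k T N.obj = 0) :
    weight k (dsum M N).obj = weight k M.obj + (chiR k P M.obj - chiR k Q M.obj) := by
  obtain ⟨φ⟩ := nonempty_image_biprod_map (M.obj.d 1 0) (N.obj.d 1 0)
  obtain ⟨ψ⟩ := nonempty_image_biprod_map (M.obj.d 0 1) (N.obj.d 0 1)
  have h1 : chiR k (image ((dsum M N).obj.d 1 0)) (dsum M N).obj = _ :=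
    chiR_congr k φ (Iso.refl _)
  have h0 : chiR k (image ((dsum M N).obj.d 0 1)) (dsum M N).obj = _ :=
    chiR_congr k ψ (Iso.refl _)
  have ht : ∀ T, chiR k T (dsum M N).obj = chiR k T M.obj := fun T =>
    (chiR_tw k T _).trans (by rw [h, add_zero])
  unfold weight
  rw [h1, h0, ht, ht, chiR_biprod, chiR_biprod, chiR_congr k e₁ (Iso.refl M.obj),
    chiR_congr k e₀ (Iso.refl M.obj)]
  ring

lemma weight_dsum_complexK (M : C2P 𝒜) (P : 𝒜) [Projective P] :
    weight k (dsum M (complexK P)).obj = weight k M.obj + chiR k P M.obj := by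
  obtain ⟨e⟩ := nonempty_image_id P
  rw [weight_dsum k M (complexK P) P 0 e (imageZero (X := P) (Y := P)) (fun T => sub_self _),
    chiR_isZero k (isZero_zero 𝒜), sub_zero]

lemma weight_dsum_complexKstar (M : C2P 𝒜) (P : 𝒜) [Projective P] :
    weight k (dsum M (complexKstar P)).obj = weight k M.obj - chiR k P M.obj := by
  obtain ⟨e⟩ := nonempty_image_id P
  rw [weight_dsum k M (complexKstar P) 0 P (imageZero (X := P) (Y := P)) e (fun T => sub_self _),
    chiR_isZero k (isZero_zero 𝒜), zero_sub, sub_eq_add_neg]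

end C2

namespace ProjRes

variable {A : 𝒜} (R : ProjRes A)

/-- Since `a₂` is mono, the cycles in degree 0 are exactly P₀, and the boundaries are the image of
`a₁`. -/
lemma nonempty_homology_complexC : Nonempty (R.complexC.obj.homology 0 ≅ A) := by
  let S : ShortComplex 𝒜 := ShortComplex.mk (biprod.lift R.a₁ (0 : R.P₁ ⟶ R.P₂))
    (biprod.desc (0 : R.P₀ ⟶ R.P₁) R.a₂) (by simp)
  have wi : (biprod.inl : R.P₀ ⟶ R.P₀ ⊞ R.P₂) ≫ biprod.desc (0 : R.P₀ ⟶ R.P₁) R.a₂ = 0 := by simp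
  let hi : IsLimit (KernelFork.ofι (f := S.g) (biprod.inl : R.P₀ ⟶ R.P₀ ⊞ R.P₂) wi) :=
    KernelFork.IsLimit.ofι _ _ (fun x _ => x ≫ biprod.fst)
      (fun {T} x hx => by
        have h : x ≫ biprod.snd = 0 := by
          rw [← cancel_mono R.a₂, zero_comp]
          have hx' : x ≫ biprod.desc (0 : R.P₀ ⟶ R.P₁) R.a₂ = 0 := hx
          rw [← hx', biprod.desc_eq]
          simp
        refine biprod.hom_ext _ _ (by simp) (by simp [h]))
      (fun x _ m hm => by rw [← hm, Category.assoc, biprod.inl_fst, Category.comp_id])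
  have hf : hi.lift (KernelFork.ofι S.f S.zero) = R.a₁ := biprod.lift_fst _ _
  let hL : S.LeftHomologyData :=
    { K := R.P₀
      H := A
      i := biprod.inl
      π := R.a₀
      wi := wi
      hi := hi
      wπ := by rw [hf, R.comp₁₀]
      hπ := CokernelCofork.IsColimit.ofπ _ _ (fun x hx => R.exact₀.desc x (by rwa [hf] at hx))
        (fun x hx => R.exact₀.g_desc x _)
        (fun x hx m hm => by
          rw [← cancel_epi R.a₀, hm]
          exact (R.exact₀.g_desc x _).symm) }
  have r : (ComplexShape.up (ZMod 2)).prev 0 = 1 :=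
    (ComplexShape.up (ZMod 2)).prev_eq' (show (1 : ZMod 2) + 1 = 0 by decide)
  have r' : (ComplexShape.up (ZMod 2)).next 0 = 1 :=
    (ComplexShape.up (ZMod 2)).next_eq' (show (0 : ZMod 2) + 1 = 1 by decide)
  exact ⟨ShortComplex.homologyMapIso (R.complexC.obj.isoSc' 1 0 1 r r') ≪≫ hL.homologyIso⟩

end ProjRes

namespace TrivQuot

/-- The functional `[M] ↦ t^weight(M) [H₀(M)]` before passing to the quotient. -/
def preFunctional : TwHallC2P k 𝒜 →ₗ[ℂ] (IsoCl 𝒜 →₀ ℂ) :=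
  Finsupp.linearCombination ℂ fun m : IsoCl (C2P 𝒜) =>
    tt k ^ C2.weight k m.out.obj • Finsupp.single (isoClass (m.out.obj.homology 0)) 1

lemma preFunctional_cls (M : C2P 𝒜) : preFunctional k (TwHallC2P.cls k M) =
    tt k ^ C2.weight k M.obj • Finsupp.single (isoClass (M.obj.homology 0)) 1 := by
  obtain ⟨e⟩ := nonempty_iso_out M
  refine (Finsupp.linearCombination_single _ _ _).trans ?_
  rw [one_smul, C2.weight_congr k e, show isoClass (M.obj.homology 0) =
    isoClass ((isoClass M).out.obj.homology 0) from
      Quotient.sound ⟨HomologicalComplex.homologyMapIso e 0⟩]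

lemma preFunctional_dsum (M : C2P 𝒜) {N : C2P 𝒜} (hN : N.obj.Acyclic) :
    preFunctional k (TwHallC2P.cls k (dsum M N)) =
      tt k ^ C2.weight k (dsum M N).obj • Finsupp.single (isoClass (M.obj.homology 0)) 1 := by
  rw [preFunctional_cls, show isoClass ((dsum M N).obj.homology 0) =
    isoClass (M.obj.homology 0) from
      Quotient.sound (C2.nonempty_homology_tw_zero_iso M.obj hN 0)]

/-- Adding K_P or K_P^* does not change homology, and the weight is designed so that its change
cancels the power of t in right multiplication. -/
lemma trivSub_le_ker : trivSub k 𝒜 ≤ (preFunctional k).ker := by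
  refine Submodule.span_le.2 ?_
  rintro _ ⟨x, P, hP, h⟩
  rw [SetLike.mem_coe, LinearMap.mem_ker]
  have hx : preFunctional k (x * TwHallC2P.cls k (complexK P)) = preFunctional k x ∧
      preFunctional k (x * TwHallC2P.cls k (complexKstar P)) = preFunctional k x := by
    clear h
    induction x using ConstAlg.induction with
    | h0 => simp
    | hadd x y hx hy => simp only [add_mul, map_add, hx, hy, and_self]
    | hsmul c x hx => simp only [smul_mul_assoc, map_smul, hx, and_self]
    | hb m =>
      have hm : TwHallC2P.cls k m.out = ConstAlg.basisElt _ _ m := by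
        unfold TwHallC2P.cls
        rw [show isoClass m.out = m from Quotient.out_eq m]
      rw [← hm, TwHallC2P.mul_complexK, TwHallC2P.mul_complexKstar, map_smul, map_smul,
        preFunctional_dsum k _ (complexK_acyclic P),
        preFunctional_dsum k _ (complexKstar_acyclic P), preFunctional_cls, smul_smul, smul_smul,
        ← tt_add, ← tt_add, C2.weight_dsum_complexK, C2.weight_dsum_complexKstar,
        add_sub_cancel, neg_add_eq_sub, add_sub_cancel_right]
      exact ⟨rfl, rfl⟩
  obtain rfl | rfl := h
  · rw [map_sub, hx.1, sub_self]
  · rw [map_sub, hx.2, sub_self]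

/-- The functional `[M] ↦ t^weight(M) [H₀(M)]`. -/
def functional : TrivQuot k 𝒜 →ₗ[ℂ] (IsoCl 𝒜 →₀ ℂ) :=
  (trivSub k 𝒜).liftQ (preFunctional k) (trivSub_le_ker k)

lemma functional_cls (M : C2P 𝒜) : functional k (cls k M) =
    tt k ^ C2.weight k M.obj • Finsupp.single (isoClass (M.obj.homology 0)) 1 :=
  preFunctional_cls k M

end TrivQuot

end Functional

/-! ### Injectivity of the reduced embedding. -/

section Injectivity

set_option linter.unusedSectionVars false

variable (k : Type w) [Field k] [Finite k] {𝒜 : Type u} [Category.{v} 𝒜] [Abelian 𝒜] [Linear k 𝒜]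
  [∀ X Y : 𝒜, Finite (X ⟶ Y)] (hgd : ∀ X : 𝒜, HasProjectiveDimensionLE X 2)

namespace TrivQuot

/-- The units of `DH(𝒜)` which act on the class of every complex by a nonzero scalar. -/
def scalarUnits : Subgroup (DH k 𝒜)ˣ where
  carrier := {x | ∀ M : C2P 𝒜, ∃ c : ℂ, c ≠ 0 ∧ actionDH k hgd (x : DH k 𝒜) (cls k M) = c • cls k M}
  one_mem' M := ⟨1, one_ne_zero, by simp⟩
  mul_mem' {x y} hx hy M := by
    obtain ⟨c, hc, hx⟩ := hx M
    obtain ⟨d, hd, hy⟩ := hy M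
    exact ⟨d * c, mul_ne_zero hd hc, by
      rw [Units.val_mul, map_mul, Module.End.mul_apply, hy, map_smul, hx, smul_smul]⟩
  inv_mem' {x} hx M := by
    obtain ⟨c, hc, hx⟩ := hx M
    refine ⟨c⁻¹, inv_ne_zero hc, ?_⟩
    have h : actionDH k hgd ((x⁻¹ : (DH k 𝒜)ˣ) : DH k 𝒜)
        (actionDH k hgd (x : DH k 𝒜) (cls k M)) = cls k M := by
      rw [← Module.End.mul_apply, ← map_mul, Units.inv_mul, map_one, Module.End.one_apply]
    rw [hx, map_smul] at h
    rw [eq_inv_smul_iff₀ hc, h]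

lemma uK_mem_scalarUnits (P : 𝒜) [Projective P] : DH.uK k P ∈ scalarUnits k hgd := fun M =>
  ⟨_, zpow_ne_zero _ (tt_ne_zero k), by rw [DH.coe_uK, actionDH_cls, action_complexK]⟩

lemma uKs_mem_scalarUnits (P : 𝒜) [Projective P] : DH.uKs k P ∈ scalarUnits k hgd := fun M =>
  ⟨_, zpow_ne_zero _ (tt_ne_zero k), by rw [DH.coe_uKs, actionDH_cls, action_complexKstar]⟩

lemma torus_mem_scalarUnits {A : 𝒜} (R : ProjRes A) : R.torus k ∈ scalarUnits k hgd :=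
  mul_mem (mul_mem (inv_mem (uK_mem_scalarUnits k hgd _)) (uK_mem_scalarUnits k hgd _))
    (inv_mem (uKs_mem_scalarUnits k hgd _))

/-- The torus part acts on [C_A] by a nonzero scalar, and the zeroth homology of C_A is A. The value
of the scalar is irrelevant. -/
lemma functional_E {A : 𝒜} (R : ProjRes A) : ∃ c : ℂ, c ≠ 0 ∧
    functional k (actionDH k hgd (R.E k) (cls k C2P.zero)) = c • Finsupp.single (isoClass A) 1 := by
  have h0 : actionDH k hgd (DH.cls k R.complexC) (cls k C2P.zero) = cls k R.complexC := by
    rw [actionDH_cls]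
    unfold cls
    rw [action_mkQ, cls_zero_eq, mkQ_mul_complexK]
  obtain ⟨c, hc, hc'⟩ := torus_mem_scalarUnits k hgd R R.complexC
  refine ⟨_, mul_ne_zero (mul_ne_zero (zpow_ne_zero (homDim k R.P₁ A - 2 * homDim k R.P₂ A)
    (tt_ne_zero k)) hc) (zpow_ne_zero (C2.weight k R.complexC.obj) (tt_ne_zero k)), ?_⟩
  rw [R.E_eq, map_smul, map_mul, LinearMap.smul_apply, Module.End.mul_apply, h0, hc', map_smul,
    map_smul, functional_cls, smul_smul, smul_smul,
    show isoClass (R.complexC.obj.homology 0) = isoClass A from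
      Quotient.sound R.nonempty_homology_complexC]

end TrivQuot

lemma injective_of_diagonal {I : Type*} (L : (I →₀ ℂ) →ₗ[ℂ] (I →₀ ℂ))
    (h : ∀ i, ∃ c : ℂ, c ≠ 0 ∧ L (Finsupp.single i 1) = c • Finsupp.single i 1) :
    Function.Injective L := by
  choose c hc h using h
  have key : ∀ x i, L x i = c i * x i := by
    intro x i
    induction x using Finsupp.induction_linear with
    | zero => simp
    | add x y hx hy => rw [map_add, Finsupp.add_apply, hx, hy, Finsupp.add_apply, mul_add]
    | single j r =>
      have : (Finsupp.single j r : I →₀ ℂ) = r • Finsupp.single j 1 := by simp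
      rw [this, map_smul, h]
      by_cases hij : j = i
      · subst hij
        simp [mul_comm]
      · simp [hij]
  intro x y hxy
  ext i
  have := congrArg (fun z => z i) hxy
  simp only [key] at this
  exact mul_left_cancel₀ (hc i) this

variable [EnoughProjectives 𝒜] (hres : ∀ X : 𝒜, Nonempty (ProjRes X))

/-- The action of DH(𝒜) factors through DH_red(𝒜), so an operator applied to the class of the zero
complex depends only on the reduced element; the functional then recovers each coefficient up to a
nonzero factor. -/
theorem injective_redMap_embedding (hgd : ∀ X : 𝒜, HasProjectiveDimensionLE X 2) :
    Function.Injective fun x => redMap k 𝒜 (embedding k hres x) := by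
  let ev : Module.End ℂ (TrivQuot k 𝒜) →ₗ[ℂ] TrivQuot k 𝒜 :=
    LinearMap.applyₗ (TrivQuot.cls k C2P.zero)
  let L : (IsoCl 𝒜 →₀ ℂ) →ₗ[ℂ] (IsoCl 𝒜 →₀ ℂ) :=
    TrivQuot.functional k ∘ₗ ev ∘ₗ (TrivQuot.actionDH k hgd).toLinearMap ∘ₗ embedding k hres
  have hL : Function.Injective L := injective_of_diagonal L fun a => by
    obtain ⟨R⟩ := hres a.out
    obtain ⟨c, hc, h⟩ := TrivQuot.functional_E k hgd R
    refine ⟨c, hc, ?_⟩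
    rw [← embedding_cls k hres R, show isoClass a.out = a from Quotient.out_eq a, TwHall.cls,
      show isoClass a.out = a from Quotient.out_eq a] at h
    exact h
  intro x y hxy
  refine hL ?_
  have h := congrArg (TrivQuot.actionDHred k hgd) hxy
  simp only [TrivQuot.actionDHred_redMap] at h
  exact congrArg (fun f => TrivQuot.functional k (ev f)) h

end Injectivity

/-! ### Finitely generated modules over a finite ring. -/

section Modules

lemma surjective_of_epi {R : Type u} [Ring R] [IsNoetherianRing R]
    {X Y : FGModuleCat.{u} R} (f : X ⟶ Y) [Epi f] : Function.Surjective f.hom.hom :=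
  (ModuleCat.epi_iff_surjective _).1
    (inferInstanceAs (Epi ((forget₂ (FGModuleCat.{u} R) (ModuleCat.{u} R)).map f)))

lemma projective_of_module {R : Type u} [Ring R] [IsNoetherianRing R] (V : Type u)
    [AddCommGroup V] [Module R V] [Module.Finite R V] [Module.Projective R V] :
    Projective (FGModuleCat.of R V) where
  factors {E X} f e _ := by
    obtain ⟨g, hg⟩ := Module.projective_lifting_property e.hom.hom f.hom.hom
      (surjective_of_epi e)
    exact ⟨FGModuleCat.ofHom g, FGModuleCat.hom_ext hg⟩

/-- Free modules of finite rank are finitely generated, projective, and cover every object. -/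
instance enoughProjectives_fgModuleCat {R : Type u} [Ring R] [IsNoetherianRing R] :
    EnoughProjectives (FGModuleCat.{u} R) where
  presentation M := by
    obtain ⟨n, f, hf⟩ := Module.Finite.exists_fin' R M
    have : Epi ((forget₂ (FGModuleCat.{u} R) (ModuleCat.{u} R)).map
        (FGModuleCat.ofHom f : FGModuleCat.of R (Fin n → R) ⟶ M)) :=
      (ModuleCat.epi_iff_surjective _).2 hf
    exact ⟨{ p := FGModuleCat.of R (Fin n → R)
             projective := projective_of_module _
             f := FGModuleCat.ofHom f
             epi := (forget₂ (FGModuleCat.{u} R) (ModuleCat.{u} R)).epi_of_epi_map this }⟩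

lemma finite_hom_fgModuleCat {R : Type u} [Ring R] [Finite R] (X Y : FGModuleCat.{u} R) :
    Finite (X ⟶ Y) := by
  have : Finite X := Module.finite_of_finite R
  have : Finite Y := Module.finite_of_finite R
  exact Finite.of_injective (fun f : X ⟶ Y => (f.hom.hom : X → Y)) fun f g h =>
    FGModuleCat.hom_ext (DFunLike.coe_injective h)

end Modules

end BridgelandHall

end

theorem theorem3 {k : Type w} [Field k] [Finite k] {B : Type u} [Ring B] [Algebra k B]
    [Module.Finite k B] :
    letI : IsNoetherianRing Bᵐᵒᵖ := isNoetherianRing_op k B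
    (∀ A : FGModuleCat.{u} Bᵐᵒᵖ, HasProjectiveDimensionLE A 2) →
    ∃ I : TwHall k (FGModuleCat.{u} Bᵐᵒᵖ) →ₙₐ[ℂ] DH k (FGModuleCat.{u} Bᵐᵒᵖ),
      I 1 = 1 ∧
      (∀ A : FGModuleCat.{u} Bᵐᵒᵖ, Nonempty (ProjRes A) ∧
        ∀ R : ProjRes A, I (TwHall.cls k A) = R.E k) ∧
      Function.Injective (fun x => redMap k (FGModuleCat.{u} Bᵐᵒᵖ) (I x)) := by
  have := isNoetherianRing_op k B
  intro hgd
  have : Finite B := Module.finite_of_finite k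
  have : Finite Bᵐᵒᵖ := Finite.of_equiv B MulOpposite.opEquiv
  have hfin : ∀ X Y : FGModuleCat.{u} Bᵐᵒᵖ, Finite (X ⟶ Y) := finite_hom_fgModuleCat
  have hres : ∀ X : FGModuleCat.{u} Bᵐᵒᵖ, Nonempty (ProjRes X) := fun X =>
    have := hgd X
    ProjRes.nonempty_of_hasProjectiveDimensionLE X
  exact ⟨embeddingHom k hres, embedding_one k hres,
    fun A => ⟨hres A, fun R => embedding_cls k hres R⟩, injective_redMap_embedding k hres hgd⟩
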